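/- **Setting.** Let $k$ be an algebraically closed field, $Q_0$ a finite set, $S=k^{Q_0}$ with primitive idempotents $e_i$, and $G$ a finite group acting on $Q_0$ whose order is not divisible by $\mathrm{char}(k)$. Let $M=\bigoplus_{i,j\in Q_0}{}_iM_j$ (${}_iM_j=e_iMe_j$) be a finite dimensional $S$-bimodule with a linear action of $G$, written $m\mapsto{}^gm$, such that ${}^g({}_iM_j)={}_{g\cdot i}M_{g\cdot j}$. The dual $M^*$ is the $S$-bimodule with ${}_iM^*_j=({}_jM_i)^*$ and ${}^g\varphi=\varphi({}^{g^{-1}}\bullet)$. Let $G_i$ be the stabiliser of $i$. Fix a set $[G\backslash Q_0]$ of representatives of the orbits, sets $[G/G_i]$ of representatives of the left cosets of $G_i$, and, for $i\in[G\backslash Q_0]$, a complete set $\mathrm{irr}(G_i)$ of representatives of the isomorphism classes of irreducible $k$-representations of $G_i$. **Intertwiners.** For $n\ge 0$, a sequence $\underline i=i_0,\dots,i_n$ and a $kG_{i_n}$-module $V$, let $$M(\underline i;V)=\bigoplus_{\underline y}\ {}_{i_0}M_{y_1 i_1}\otimes{}_{y_1i_1}M_{y_1y_2i_2}\otimes\cdots\otimes{}_{y_1\cdots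 y_{n-1}i_{n-1}}M_{y_1\cdots y_ni_n}\otimes y_1\cdots y_nV,$$ where $\underline y=y_1,\dots,y_n$ with $y_t\in[G/G_{i_t}]$. It is a $kG_{i_0}$-module by ${}^g(m_1\otimes\cdots\otimes m_n\otimes y_1\cdots y_nv)={}^gm_1\otimes\cdots\otimes{}^gm_n\otimes y_1'\cdots y_n'\,{}^hv$, where $y'_t\in[G/G_{i_t}]$ and $h\in G_{i_n}$ are determined by $gy_1\cdots y_tG_{i_t}=y_1'\cdots y_t'G_{i_t}$ for all $t$ and $gy_1\cdots y_n=y_1'\cdots y_n'h$; in particular $M(i_0;V)=V$. For $f\in\mathrm{Hom}_{kG_{i_0}}(U,M(i_0,\dots,i_m;V))$ and $f'\in\mathrm{Hom}_{kG_{i_m}}(V,M(i_m,\dots,i_{m+n};W))$ let $f'\circledast f\in\mathrm{Hom}_{kG_{i_0}}(U,M(i_0,\dots,i_{m+n};W))$ be the composite of $f$ with the map $$m_1\otimes\cdots\otimes m_m\otimes y_1\cdots y_mv\mapsto\sum m_1\otimes\cdots\otimes m_m\otimes{}^{y_1\cdots y_m}m'_1\otimes\cdots\otimes{}^{y_1\cdots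 y_m}m'_n\otimes y_1\cdots y_m\,y_{m+1}\cdots y_{m+n}w$$ where $f'(v)=\sum m_1'\otimes\cdots\otimes m'_n\otimes y_{m+1}\cdots y_{m+n}w$. The algebra of intertwiners is $$\mathrm{Intw}=\bigoplus_{n,\underline i,U,V}\mathrm{Hom}_{kG_{i_0}}(U,M(\underline i;V))$$ with $n\ge 0$, $\underline i=i_0,\dots,i_n$ in $[G\backslash Q_0]$, $U\in\mathrm{irr}(G_{i_0})$, $V\in\mathrm{irr}(G_{i_n})$, and with product $\circledast$ (zero for summands that cannot be composed). It is an associative algebra with unit $\sum_{(i,U)}\mathrm{id}_U$. **Pairing.** For $\underline i=i_0,\dots,i_n$ in $[G\backslash Q_0]$, $U\in\mathrm{irr}(G_{i_0})$, $V\in\mathrm{irr}(G_{i_n})$, $f\in\mathrm{Hom}_{kG_{i_0}}(U,M(i_0,\dots,i_n;V))$ and $\varphi\in\mathrm{Hom}_{kG_{i_n}}(V,M^*(i_n,\dots,i_0;U))$, the scalar $(f|\varphi)$ is defined by $\Phi(\varphi)\circ f=(f|\varphi)\,\mathrm{id}_U$, where $\Phi(\varphi)\colon M(i_0,\dots,i_n;V)\to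 U$ is the linear map $$m_1\otimes\cdots\otimes m_n\otimes y_1\cdots y_nv\mapsto\sum\Big(\prod_{t=1}^n\varphi_{t}\big({}^{(y_1\cdots y_n)^{-1}}m_t\big)\Big)\ {}^{h_0^{-1}}u .$$ Here $x_t\in[G/G_{i_t}]$ ($0\le t\le n-1$) and $h_0\in G_{i_0}$ are determined by $(y_t\cdots y_n)^{-1}\in x_{n-1}\cdots x_{t-1}G_{i_{t-1}}$ for $1\le t\le n$ and $(y_1\cdots y_n)^{-1}=x_{n-1}\cdots x_0h_0$, and $\sum\varphi_{n}\otimes\cdots\otimes\varphi_{1}\otimes x_{n-1}\cdots x_0u$ is the component of $\varphi(v)$ of index $x_{n-1},\dots,x_0$. **Quiver.** Let $Q_G$ be a quiver whose vertices are the pairs $(i,U)$ with $i\in[G\backslash Q_0]$ and $U\in\mathrm{irr}(G_i)$, and whose arrows $(i,U)\to(j,V)$ form a basis of $\mathrm{Hom}_{kG_i}(U,M(i,j;V))$. Products of paths in $kQ_G$ are read from left to right ($\gamma\gamma'$ is $\gamma$ followed by $\gamma'$). For a path $\gamma\colon(i_0,U_0)\xrightarrow{f_1}\cdots\xrightarrow{f_n}(i_n,U_n)$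 let $f_\gamma=f_n\circledast\cdots\circledast f_1\in\mathrm{Hom}_{kG_{i_0}}(U_0,M(i_0,\dots,i_n;U_n))$, which is $\mathrm{id}_{U_0}$ if $n=0$. **Theorem.** 1. There is an isomorphism of $k$-algebras $kQ_G\xrightarrow{\sim}\mathrm{Intw}^{\mathrm{op}}$ that maps every path $\gamma$ to $f_\gamma$. 2. The scalars $(f|\varphi)$ are well defined. There is a unique family which assigns to every arrow $f\colon(i,U)\to(j,V)$ an intertwiner $f^\vee\in\mathrm{Hom}_{kG_j}(V,M^*(j,i;U))$ such that, for every arrow $f'\colon(i,U)\to(j,V)$, $(f'|f^\vee)=1$ if $f'=f$ and $(f'|f^\vee)=0$ otherwise. For every path $\gamma$ as above, let $\varphi_\gamma=f_1^\vee\circledast\cdots\circledast f_n^\vee\in\mathrm{Hom}_{kG_{i_n}}(U_n,M^*(i_n,\dots,i_0;U_0))$, which is $\mathrm{id}_{U_0}$ if $n=0$. Then, for all $i_0,\dots,i_n\in[G\backslash Q_0]$, $U_0\in\mathrm{irr}(G_{i_0})$, $U_n\in\mathrm{irr}(G_{i_n})$ and $f\in\mathrm{Hom}_{kG_{i_0}}(U_0,M(i_0,\dots,i_n;U_n))$,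 $$f=\sum_\gamma(f|\varphi_\gamma)\,f_\gamma,$$ where $\gamma$ runs through the (finitely many) paths of $Q_G$ of the shape $(i_0,U_0)\to(i_1,\bullet)\to\cdots\to(i_{n-1},\bullet)\to(i_n,U_n)$. -/

import Mathlib

open scoped TensorProduct DirectSum

universe u v w x y z q

/-- A finite dimensional bimodule over `S = k^{Q₀}` with a compatible action of `G`; here
`proj i j` is the map `m ↦ e_i m e_j`, so that its range is `_iM_j` and `M` is the direct sum
of these subspaces. -/
structure EquivariantBimodule (k : Type u) (G : Type v) (Q₀ : Type w) (M : Type x)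
    [Field k] [Group G] [Fintype Q₀] [MulAction G Q₀] [AddCommGroup M] [Module k M] where
  rho : Representation k G M
  proj : Q₀ → Q₀ → M →ₗ[k] M
  proj_comp_self : ∀ i j, proj i j ∘ₗ proj i j = proj i j
  proj_comp_ne : ∀ i j i' j', (i, j) ≠ (i', j') → proj i j ∘ₗ proj i' j' = 0
  sum_proj : ∑ i, ∑ j, proj i j = LinearMap.id
  rho_proj : ∀ g i j, rho g ∘ₗ proj i j = proj (g • i) (g • j) ∘ₗ rho g

namespace EquivariantBimodule

variable {k : Type u} {G : Type v} {Q₀ : Type w} {M : Type x}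
  [Field k] [Group G] [Fintype Q₀] [MulAction G Q₀] [AddCommGroup M] [Module k M]

/-- The dual bimodule, with `_iM^*_j = (_jM_i)^*` and `^gφ = φ(^{g⁻¹} •)`. -/
def dual (B : EquivariantBimodule k G Q₀ M) :
    EquivariantBimodule k G Q₀ (Module.Dual k M) where
  rho := B.rho.dual
  proj i j := (B.proj j i).dualMap
  proj_comp_self i j := by
    ext φ m
    exact congrArg φ (LinearMap.congr_fun (B.proj_comp_self j i) m)
  proj_comp_ne i j i' j' h := by
    ext φ m
    have h' : (j', i') ≠ (j, i) := by
      intro h'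
      apply h
      simp only [Prod.mk.injEq] at h' ⊢
      exact ⟨h'.2.symm, h'.1.symm⟩
    have := congrArg φ (LinearMap.congr_fun (B.proj_comp_ne j' i' j i h') m)
    simpa using this
  sum_proj := by
    ext φ m
    have h := congrArg φ (LinearMap.congr_fun B.sum_proj m)
    rw [Finset.sum_comm]
    simpa [LinearMap.sum_apply, map_sum] using h
  rho_proj g i j := by
    ext φ m
    have h := congrArg φ (LinearMap.congr_fun (B.rho_proj g⁻¹ (g • j) (g • i)) m)
    simp only [inv_smul_smul] at h
    exact h.symm

/-- The subspace `_iM_j` of `M`. -/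
def comp (B : EquivariantBimodule k G Q₀ M) (i j : Q₀) : Submodule k M :=
  LinearMap.range (B.proj i j)

/-- The action of `G` on the tensor algebra of `M` by algebra endomorphisms,
`^g(m₁ ⊗ ⋯ ⊗ m_n) = ^gm₁ ⊗ ⋯ ⊗ ^gm_n`. -/
noncomputable def tensorAct (B : EquivariantBimodule k G Q₀ M) (g : G) :
    TensorAlgebra k M →ₐ[k] TensorAlgebra k M :=
  TensorAlgebra.lift k (TensorAlgebra.ι k ∘ₗ B.rho g)

theorem tensorAct_ι (B : EquivariantBimodule k G Q₀ M) (g : G) (m : M) :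
    B.tensorAct g (TensorAlgebra.ι k m) = TensorAlgebra.ι k (B.rho g m) := by
  simp [tensorAct]

theorem tensorAct_one (B : EquivariantBimodule k G Q₀ M) :
    B.tensorAct 1 = AlgHom.id k _ := by
  apply TensorAlgebra.hom_ext
  ext m
  simp [tensorAct_ι]

theorem tensorAct_mul (B : EquivariantBimodule k G Q₀ M) (g h : G) :
    B.tensorAct (g * h) = (B.tensorAct g).comp (B.tensorAct h) := by
  apply TensorAlgebra.hom_ext
  ext m
  simp [tensorAct_ι]

theorem tensorAct_mul_apply (B : EquivariantBimodule k G Q₀ M) (g h : G)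
    (t : TensorAlgebra k M) :
    B.tensorAct (g * h) t = B.tensorAct g (B.tensorAct h t) := by
  rw [tensorAct_mul]; rfl

theorem map_comp_le (B : EquivariantBimodule k G Q₀ M) (g : G) (i j : Q₀) :
    (B.comp i j).map (B.rho g) ≤ B.comp (g • i) (g • j) := by
  rintro _ ⟨_, ⟨m, rfl⟩, rfl⟩
  exact ⟨B.rho g m, (LinearMap.congr_fun (B.rho_proj g i j) m).symm⟩

end EquivariantBimodule

/-- Finite sequences `i₀, i₁, …, i_n` (`n ≥ 0`) of elements of `X`, with given ends `i₀`, `i_n`. -/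
inductive EndSeq (X : Type u) : X → X → Type u
  | nil (i : X) : EndSeq X i i
  | cons (i : X) {j l : X} (s : EndSeq X j l) : EndSeq X i l

namespace EndSeq

variable {X : Type u}

/-- The sequence `i, j`. -/
def pair (i j : X) : EndSeq X i j := cons i (nil j)

/-- Gluing `i₀, …, i_m` and `i_m, …, i_{m+n}` to `i₀, …, i_{m+n}`. -/
def append : {i j l : X} → EndSeq X i j → EndSeq X j l → EndSeq X i l
  | _, _, _, nil _, t => t
  | _, _, _, cons i s, t => cons i (append s t)

/-- The opposite sequence `i_n, …, i₀`. -/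
def rev : {i j : X} → EndSeq X i j → EndSeq X j i
  | _, _, nil i => nil i
  | _, _, cons (j := j) i s => append (rev s) (pair j i)

theorem append_nil : {i j : X} → (s : EndSeq X i j) → s.append (nil j) = s
  | _, _, nil _ => rfl
  | _, _, cons i s => by rw [append, append_nil s]

theorem append_assoc : {i j l m : X} → (s : EndSeq X i j) → (t : EndSeq X j l) →
    (r : EndSeq X l m) → (s.append t).append r = s.append (t.append r)
  | _, _, _, _, nil _, t, r => rfl
  | _, _, _, _, cons i s, t, r => by simp only [append, append_assoc s]

theorem rev_append_pair : {i j : X} → (s : EndSeq X i j) → (l : X) →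
    (s.append (pair j l)).rev = cons l s.rev
  | _, _, nil _, l => rfl
  | _, _, cons i s, l => by simp only [append, rev, rev_append_pair s l]

end EndSeq

/-- The choices attached to the action of `G` on `Q₀`: representatives `orb` of the orbits,
representatives `cosets i` of `G / G_i` for all `i`, and, for every `i` in `orb`, a complete
irredundant family of irreducible representations of `G_i`. -/
structure OrbitData (k : Type u) (G : Type v) (Q₀ : Type w) [Field k] [Group G]
    [MulAction G Q₀] where
  orb : Set Q₀
  orb_spec : ∀ q : Q₀, ∃! i, i ∈ orb ∧ i ∈ MulAction.orbit G q
  cosets : Q₀ → Set G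
  cosets_spec : ∀ i : Q₀,
    Subgroup.IsComplement (cosets i) (MulAction.stabilizer G i : Set G)
  Irr : orb → Type x
  finite_Irr : ∀ i : orb, Finite (Irr i)
  V : (i : orb) → Irr i → Type y
  instAddCommGroup : ∀ (i : orb) (U : Irr i), AddCommGroup (V i U)
  instModule : ∀ (i : orb) (U : Irr i), Module k (V i U)
  sigma : ∀ (i : orb) (U : Irr i), Representation k (MulAction.stabilizer G (i : Q₀)) (V i U)
  irreducible : ∀ (i : orb) (U : Irr i), (sigma i U).IsIrreducible
  eq_of_equiv : ∀ (i : orb) (U U' : Irr i), Nonempty ((sigma i U).Equiv (sigma i U')) → U = U'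
  exists_equiv : ∀ (i : orb) (W : Type u) [AddCommGroup W] [Module k W]
    (τ : Representation k (MulAction.stabilizer G (i : Q₀)) W),
    τ.IsIrreducible → ∃ U, Nonempty (τ.Equiv (sigma i U))

attribute [instance] OrbitData.instAddCommGroup OrbitData.instModule OrbitData.finite_Irr

namespace OrbitData

variable {k : Type u} {G : Type v} {Q₀ : Type w} [Field k] [Group G] [MulAction G Q₀]

/-- The vertices `(i, U)` of the quiver `Q_G`. -/
structure Vertex (D : OrbitData.{u, v, w, x, y} k G Q₀) where
  pt : D.orb
  irr : D.Irr pt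

variable (D : OrbitData.{u, v, w, x, y} k G Q₀)

instance [Finite Q₀] : Finite D.Vertex :=
  Finite.of_injective (β := Σ i : D.orb, D.Irr i) (fun a => ⟨a.pt, a.irr⟩) (by
    rintro ⟨a, b⟩ ⟨c, d⟩ h
    cases h
    rfl)

variable {D}

/-- The stabiliser of the point of `Q₀` underlying an orbit representative. -/
abbrev Stab (i : D.orb) : Subgroup G := MulAction.stabilizer G (i : Q₀)

/-- The vector space `U` underlying a vertex `(i, U)`. -/
abbrev Vertex.Sp (a : D.Vertex) : Type y := D.V a.pt a.irr

/-- The representation of `G_i` carried by a vertex `(i, U)`. -/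
abbrev Vertex.rep (a : D.Vertex) : Representation k (Stab a.pt) a.Sp := D.sigma a.pt a.irr

/-- The element `y` of `[G/G_j]` such that `g ∈ y G_j`. -/
noncomputable def cosetRep (j : D.orb) (g : G) : G := ((D.cosets_spec j).equiv g).1

/-- The element `h` of `G_j` such that `g = y h` with `y ∈ [G/G_j]`. -/
noncomputable def cosetRem (j : D.orb) (g : G) : Stab j := ((D.cosets_spec j).equiv g).2

theorem cosetRep_mem (j : D.orb) (g : G) : cosetRep j g ∈ D.cosets j :=
  ((D.cosets_spec j).equiv g).1.2

theorem cosetRep_mul_cosetRem (j : D.orb) (g : G) :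
    cosetRep j g * (cosetRem j g : G) = g :=
  (D.cosets_spec j).equiv_fst_mul_equiv_snd g

theorem coset_unique (j : D.orb) {y : G} (hy : y ∈ D.cosets j) (h : Stab j) :
    cosetRep j (y * h) = y ∧ cosetRem j (y * h) = h := by
  have : (D.cosets_spec j).equiv (y * h) = (⟨y, hy⟩, ⟨h, h.2⟩) := by
    rw [← Equiv.eq_symm_apply]; rfl
  constructor
  · rw [cosetRep, this]
  · rw [cosetRem, this]
    rfl

/-- `y = y₁, …, y_n` satisfies `y_t ∈ [G/G_{i_t}]` for all `t`, where the sequence of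
points is `i₀, …, i_n`. -/
def IsReps : {i j : D.orb} → EndSeq D.orb i j → List G → Prop
  | _, _, .nil _, [] => True
  | _, _, .nil _, _ :: _ => False
  | _, _, .cons _ _, [] => False
  | _, _, .cons (j := j) _ s, y :: ys => y ∈ D.cosets j ∧ IsReps s ys

/-- The sequence `y'₁, …, y'_n` such that `g y₁ ⋯ y_t G_{i_t} = y'₁ ⋯ y'_t G_{i_t}` for all `t`. -/
noncomputable def moveReps : {i j : D.orb} → EndSeq D.orb i j → Stab i → List G → List G
  | _, _, .nil _, _, _ => []
  | _, _, .cons _ _, _, [] => []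
  | _, _, .cons (j := j) _ s, g, y :: ys =>
      cosetRep j (g * y) :: moveReps s (cosetRem j (g * y)) ys

/-- The element `h` of `G_{i_n}` such that `g y₁ ⋯ y_n = y'₁ ⋯ y'_n h`. -/
noncomputable def moveRem : {i j : D.orb} → EndSeq D.orb i j → Stab i → List G → Stab j
  | _, _, .nil _, g, _ => g
  | _, _, .cons _ _, _, [] => 1
  | _, _, .cons (j := j) _ s, g, y :: ys => moveRem s (cosetRem j (g * y)) ys

theorem moveReps_isReps : {i j : D.orb} → (s : EndSeq D.orb i j) → (g : Stab i) →
    {ys : List G} → IsReps s ys → IsReps s (moveReps s g ys)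
  | _, _, .nil _, _, [], _ => trivial
  | _, _, .nil _, _, _ :: _, h => h.elim
  | _, _, .cons _ _, _, [], h => h.elim
  | _, _, .cons _ s, _, _ :: _, h => ⟨cosetRep_mem _ _, moveReps_isReps s _ h.2⟩

theorem mul_prod_eq : {i j : D.orb} → (s : EndSeq D.orb i j) → (g : Stab i) →
    {ys : List G} → IsReps s ys →
    (g : G) * ys.prod = (moveReps s g ys).prod * (moveRem s g ys : G)
  | _, _, .nil _, g, [], _ => by simp [moveReps, moveRem]
  | _, _, .nil _, _, _ :: _, h => h.elim
  | _, _, .cons _ _, _, [], h => h.elim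
  | _, _, .cons (j := j) _ s, g, y :: ys, h => by
      simp only [moveReps, moveRem, List.prod_cons]
      rw [mul_assoc, ← mul_prod_eq s _ h.2, ← mul_assoc, ← mul_assoc, cosetRep_mul_cosetRem]

theorem moveReps_one : {i j : D.orb} → (s : EndSeq D.orb i j) →
    {ys : List G} → IsReps s ys → moveReps s 1 ys = ys ∧ moveRem s 1 ys = 1
  | _, _, .nil _, [], _ => ⟨rfl, rfl⟩
  | _, _, .nil _, _ :: _, h => h.elim
  | _, _, .cons _ _, [], h => h.elim
  | _, _, .cons (j := j) _ s, y :: ys, h => by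
      have h1 := coset_unique j h.1 1
      have h2 := moveReps_one s h.2
      simp only [OneMemClass.coe_one, mul_one] at h1
      simp only [moveReps, moveRem, OneMemClass.coe_one, one_mul, h1.1, h1.2, h2.1, h2.2, and_self]

theorem moveReps_mul : {i j : D.orb} → (s : EndSeq D.orb i j) → (g h : Stab i) →
    {ys : List G} → IsReps s ys → moveReps s (g * h) ys = moveReps s g (moveReps s h ys) ∧
      moveRem s (g * h) ys = moveRem s g (moveReps s h ys) * moveRem s h ys
  | _, _, .nil _, _, _, [], _ => ⟨rfl, rfl⟩
  | _, _, .nil _, _, _, _ :: _, h => h.elim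
  | _, _, .cons _ _, _, _, [], h => h.elim
  | _, _, .cons (j := j) _ s, g, h, y :: ys, hy => by
      have e : ((g * h : Stab _) : G) * y = cosetRep j (g * cosetRep j (h * y)) *
          ((cosetRem j (g * cosetRep j (h * y)) * cosetRem j (h * y) : Stab j) : G) := by
        push_cast
        rw [← mul_assoc, cosetRep_mul_cosetRem, mul_assoc, mul_assoc, cosetRep_mul_cosetRem]
      have h1 := coset_unique j (cosetRep_mem j (g * cosetRep j (h * y)))
        (cosetRem j (g * cosetRep j (h * y)) * cosetRem j (h * y))
      rw [← e] at h1
      have h2 := moveReps_mul s (cosetRem j (g * cosetRep j (h * y))) (cosetRem j (h * y)) hy.2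
      simp only [moveReps, moveRem, h1.1, h1.2, h2.1, h2.2, and_self]

theorem moveReps_append : {i j l : D.orb} → (s : EndSeq D.orb i j) → (t : EndSeq D.orb j l) →
    (g : Stab i) → {ys : List G} → (zs : List G) → IsReps s ys →
    moveReps (s.append t) g (ys ++ zs) = moveReps s g ys ++ moveReps t (moveRem s g ys) zs ∧
      moveRem (s.append t) g (ys ++ zs) = moveRem t (moveRem s g ys) zs
  | _, _, _, .nil _, _, _, [], _, _ => ⟨rfl, rfl⟩
  | _, _, _, .nil _, _, _, _ :: _, _, h => h.elim
  | _, _, _, .cons _ _, _, _, [], _, h => h.elim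
  | _, _, _, .cons (j := j) _ s, t, g, y :: ys, zs, h => by
      have h2 := moveReps_append s t (cosetRem j (g * y)) zs h.2
      simp only [EndSeq.append, List.cons_append, moveReps, moveRem, h2.1, h2.2, and_self]

theorem isReps_append : {i j l : D.orb} → (s : EndSeq D.orb i j) → (t : EndSeq D.orb j l) →
    {ys zs : List G} → IsReps s ys → IsReps t zs → IsReps (s.append t) (ys ++ zs)
  | _, _, _, .nil _, _, [], _, _, h => h
  | _, _, _, .nil _, _, _ :: _, _, h, _ => h.elim
  | _, _, _, .cons _ _, _, [], _, h, _ => h.elim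
  | _, _, _, .cons _ s, t, _ :: _, _, h, h' => ⟨h.1, isReps_append s t h.2 h'⟩

end OrbitData

/-- The ambient space of `M(i₀, …, i_n; V)`: the summand of index `y₁, …, y_n` of the latter
is a subspace of the copy of index `y₁, …, y_n` of `T(M) ⊗ V`, where `T(M)` is the tensor
algebra of the vector space `M`; an element `m₁ ⊗ ⋯ ⊗ m_n ⊗ y₁⋯y_n v` of this summand is
`Finsupp.single [y₁, …, y_n] ((m₁ ⋯ m_n) ⊗ₜ v)`. -/
abbrev Amb (k : Type u) (G : Type v) (M : Type z) (V : Type y) [Field k]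
    [AddCommGroup M] [Module k M] [AddCommGroup V] [Module k V] : Type (max u v y z) :=
  List G →₀ (TensorAlgebra k M ⊗[k] V)

theorem amb_ext {k : Type u} {G : Type v} {M : Type z} {V : Type y} [Field k]
    [AddCommGroup M] [Module k M] [AddCommGroup V] [Module k V] {N : Type*} [AddCommMonoid N]
    [Module k N] {A A' : Amb k G M V →ₗ[k] N}
    (h : ∀ ys t v, A (Finsupp.single ys (t ⊗ₜ[k] v)) = A' (Finsupp.single ys (t ⊗ₜ[k] v))) :
    A = A' := by
  ext1 ys
  apply TensorProduct.ext'
  intro t v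
  exact h ys t v

section Intertwiners


variable {k : Type u} {G : Type v} {Q₀ : Type w} [Field k] [Group G] [Fintype Q₀]
  [MulAction G Q₀]

variable {M : Type z} [AddCommGroup M] [Module k M]
variable {D : OrbitData.{u, v, w, x, y} k G Q₀}

namespace EquivariantBimodule

open OrbitData

variable (B : EquivariantBimodule k G Q₀ M)

/-- The subspace
`_{a i₀}M_{a y₁ i₁} ⊗ _{a y₁ i₁}M_{a y₁ y₂ i₂} ⊗ ⋯ ⊗ _{a y₁⋯y_{n-1} i_{n-1}}M_{a y₁⋯y_n i_n}`
of the tensor algebra of `M`. -/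
def prodSpace : {i j : D.orb} → EndSeq D.orb i j → G → List G →
    Submodule k (TensorAlgebra k M)
  | _, _, .nil _, _, _ => 1
  | _, _, .cons _ _, _, [] => ⊥
  | _, _, .cons (j := j) i s, a, y :: ys =>
      (B.comp (a • (i : Q₀)) ((a * y) • (j : Q₀))).map (TensorAlgebra.ι k) *
        prodSpace s (a * y) ys

variable (V : Type*) [AddCommGroup V] [Module k V]

/-- The space `M_y(i₀, …, i_n; V)`. -/
def layer {i j : D.orb} (s : EndSeq D.orb i j) (ys : List G) :
    Submodule k (TensorAlgebra k M ⊗[k] V) :=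
  Submodule.map₂ (TensorProduct.mk k (TensorAlgebra k M) V) (B.prodSpace s 1 ys) ⊤

/-- The space `M(i₀, …, i_n; V)`, the direct sum of the spaces `M_y(i₀, …, i_n; V)`. -/
def moduleSpace {i j : D.orb} (s : EndSeq D.orb i j) : Submodule k (Amb k G M V) where
  carrier := {F | ∀ ys, (IsReps s ys → F ys ∈ B.layer V s ys) ∧ (¬ IsReps s ys → F ys = 0)}
  add_mem' {F F'} h h' ys :=
    ⟨fun hy => add_mem ((h ys).1 hy) ((h' ys).1 hy),
      fun hy => by rw [Finsupp.add_apply, (h ys).2 hy, (h' ys).2 hy, add_zero]⟩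
  zero_mem' ys := ⟨fun _ => zero_mem _, fun _ => rfl⟩
  smul_mem' c F h ys :=
    ⟨fun hy => Submodule.smul_mem _ c ((h ys).1 hy),
      fun hy => by rw [Finsupp.smul_apply, (h ys).2 hy, smul_zero]⟩

/-- The homogeneous tensors of `M(i₀, …, i_n; V)`. -/
def gens {i j : D.orb} (s : EndSeq D.orb i j) : Set (Amb k G M V) :=
  {F | ∃ ys t v, IsReps s ys ∧ t ∈ B.prodSpace s 1 ys ∧ F = Finsupp.single ys (t ⊗ₜ[k] v)}

variable {V}

theorem single_mem {i j : D.orb} {s : EndSeq D.orb i j} {ys : List G} (hy : IsReps s ys)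
    {x : TensorAlgebra k M ⊗[k] V} (hx : x ∈ B.layer V s ys) :
    Finsupp.single ys x ∈ B.moduleSpace V s := by
  classical
  intro zs
  by_cases h : ys = zs
  · subst h
    simp only [Finsupp.single_eq_same]
    exact ⟨fun _ => hx, fun h => (h hy).elim⟩
  · rw [Finsupp.single_eq_of_ne (Ne.symm h)]
    exact ⟨fun _ => zero_mem _, fun _ => rfl⟩

theorem tmul_mem_layer {i j : D.orb} {s : EndSeq D.orb i j} {ys : List G}
    {t : TensorAlgebra k M} (ht : t ∈ B.prodSpace s 1 ys) (v : V) :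
    t ⊗ₜ[k] v ∈ B.layer V s ys :=
  Submodule.apply_mem_map₂ (TensorProduct.mk k (TensorAlgebra k M) V) ht trivial

theorem span_gens {i j : D.orb} (s : EndSeq D.orb i j) :
    Submodule.span k (B.gens V s) = B.moduleSpace V s := by
  apply le_antisymm
  · rw [Submodule.span_le]
    rintro _ ⟨ys, t, v, hy, ht, rfl⟩
    exact B.single_mem hy (B.tmul_mem_layer ht v)
  · intro F hF
    rw [← F.sum_single]
    refine Submodule.sum_mem _ fun ys hys => ?_
    have hy : IsReps s ys := by
      by_contra h
      exact (Finsupp.mem_support_iff.1 hys) ((hF ys).2 h)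
    have : B.layer V s ys ≤
        (Submodule.span k (B.gens V s)).comap (Finsupp.lsingle ys) := by
      refine Submodule.map₂_le.2 fun t ht v _ => ?_
      exact Submodule.subset_span ⟨ys, t, v, hy, ht, rfl⟩
    exact this ((hF ys).1 hy)

theorem prodSpace_move : {i j : D.orb} → (s : EndSeq D.orb i j) → (g a a' : G) →
    (h : Stab i) → (g * a = a' * h) → {ys : List G} → IsReps s ys →
    (B.prodSpace s a ys).map (B.tensorAct g).toLinearMap ≤ B.prodSpace s a' (moveReps s h ys)
  | _, _, .nil _, g, _, _, _, _, [], _ => by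
      simp only [prodSpace, Submodule.map_one, le_refl]
  | _, _, .nil _, _, _, _, _, _, _ :: _, h => h.elim
  | _, _, .cons _ _, _, _, _, _, _, [], h => h.elim
  | _, _, .cons (j := j) i s, g, a, a', h, e, y :: ys, hy => by
      have e1 : g * (a * y) = a' * cosetRep j (h * y) * (cosetRem j (h * y) : G) := by
        rw [mul_assoc, cosetRep_mul_cosetRem, ← mul_assoc, e, mul_assoc]
      have e2 : g • a • (i : Q₀) = a' • (i : Q₀) := by
        rw [← mul_smul, e, mul_smul, h.2]
      have e3 : g • (a * y) • (j : Q₀) = (a' * cosetRep j (h * y)) • (j : Q₀) := by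
        rw [← mul_smul, e1, mul_smul, (cosetRem j (h * y)).2]
      simp only [prodSpace, moveReps]
      rw [Submodule.map_mul]
      refine mul_le_mul' ?_ (prodSpace_move s g _ _ _ e1 hy.2)
      rintro _ ⟨_, ⟨m, hm, rfl⟩, rfl⟩
      refine ⟨B.rho g m, ?_, (B.tensorAct_ι g m).symm⟩
      have := B.map_comp_le g _ _ (Submodule.mem_map_of_mem hm)
      rwa [e2, e3] at this

theorem prodSpace_append : {i j l : D.orb} → (s : EndSeq D.orb i j) → (t : EndSeq D.orb j l) →
    (a : G) → {ys zs : List G} → IsReps s ys →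
    B.prodSpace s a ys * B.prodSpace t (a * ys.prod) zs ≤ B.prodSpace (s.append t) a (ys ++ zs)
  | _, _, _, .nil _, _, _, [], _, _ => by simp [prodSpace, EndSeq.append]
  | _, _, _, .nil _, _, _, _ :: _, _, h => h.elim
  | _, _, _, .cons _ _, _, _, [], _, h => h.elim
  | _, _, _, .cons _ s, t, a, y :: ys, zs, h => by
      simp only [prodSpace, EndSeq.append, List.cons_append, List.prod_cons]
      rw [mul_assoc, ← mul_assoc a]
      exact mul_le_mul' le_rfl (prodSpace_append s t (a * y) h.2)

/-- The action of `g` on `M(i₀, …, i_n; V)`,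
`m₁ ⊗ ⋯ ⊗ m_n ⊗ y₁⋯y_n v ↦ ^gm₁ ⊗ ⋯ ⊗ ^gm_n ⊗ y'₁⋯y'_n ^hv`. -/
noncomputable def ambAct {i j : D.orb} (s : EndSeq D.orb i j)
    (σ : Representation k (Stab j) V) (g : Stab i) : Amb k G M V →ₗ[k] Amb k G M V :=
  Finsupp.lsum k fun ys => Finsupp.lsingle (moveReps s g ys) ∘ₗ
    TensorProduct.map (B.tensorAct g).toLinearMap (σ (moveRem s g ys))

theorem ambAct_single {i j : D.orb} (s : EndSeq D.orb i j)
    (σ : Representation k (Stab j) V) (g : Stab i) (ys : List G) (t : TensorAlgebra k M) (v : V) :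
    B.ambAct s σ g (Finsupp.single ys (t ⊗ₜ[k] v)) =
      Finsupp.single (moveReps s g ys) (B.tensorAct g t ⊗ₜ[k] σ (moveRem s g ys) v) := by
  simp [ambAct]

theorem ambAct_mem {i j : D.orb} (s : EndSeq D.orb i j)
    (σ : Representation k (Stab j) V) (g : Stab i) {F : Amb k G M V}
    (hF : F ∈ B.moduleSpace V s) : B.ambAct s σ g F ∈ B.moduleSpace V s := by
  revert F
  change B.moduleSpace V s ≤ (B.moduleSpace V s).comap (B.ambAct s σ g)
  rw [← B.span_gens, Submodule.span_le]
  rintro _ ⟨ys, t, v, hy, ht, rfl⟩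
  rw [SetLike.mem_coe, Submodule.mem_comap, B.ambAct_single, B.span_gens]
  refine B.single_mem (moveReps_isReps s g hy) (B.tmul_mem_layer ?_ _)
  exact B.prodSpace_move s g 1 1 g (by simp) hy (Submodule.mem_map_of_mem ht)

theorem ext_moduleSpace {i j : D.orb} {s : EndSeq D.orb i j} {N : Type*} [AddCommMonoid N]
    [Module k N] {A A' : Amb k G M V →ₗ[k] N}
    (h : ∀ ys t v, IsReps s ys → t ∈ B.prodSpace s 1 ys →
      A (Finsupp.single ys (t ⊗ₜ[k] v)) = A' (Finsupp.single ys (t ⊗ₜ[k] v)))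
    {F : Amb k G M V} (hF : F ∈ B.moduleSpace V s) : A F = A' F := by
  rw [← B.span_gens] at hF
  refine LinearMap.eqOn_span ?_ hF
  rintro _ ⟨ys, t, v, hy, ht, rfl⟩
  exact h ys t v hy ht

/-- The `G_{i₀}`-module `M(i₀, …, i_n; V)`. -/
noncomputable def moduleRep {i j : D.orb} (s : EndSeq D.orb i j)
    (σ : Representation k (Stab j) V) : Representation k (Stab i) (B.moduleSpace V s) where
  toFun g := (B.ambAct s σ g).restrict fun _ hF => B.ambAct_mem s σ g hF
  map_one' := by
    ext1 F
    apply Subtype.ext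
    refine B.ext_moduleSpace (A := B.ambAct s σ 1) (A' := LinearMap.id) ?_ F.2
    intro ys t v hy _
    rw [B.ambAct_single, (moveReps_one s hy).1, (moveReps_one s hy).2]
    simp [tensorAct_one]
  map_mul' g h := by
    ext1 F
    apply Subtype.ext
    refine B.ext_moduleSpace (A := B.ambAct s σ (g * h))
      (A' := B.ambAct s σ g ∘ₗ B.ambAct s σ h) ?_ F.2
    intro ys t v hy _
    rw [LinearMap.comp_apply, B.ambAct_single, B.ambAct_single, B.ambAct_single,
      (moveReps_mul s g h hy).1, (moveReps_mul s g h hy).2]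
    simp [tensorAct_mul_apply]

theorem moduleRep_coe {i j : D.orb} (s : EndSeq D.orb i j)
    (σ : Representation k (Stab j) V) (g : Stab i) (F : B.moduleSpace V s) :
    ((B.moduleRep s σ g F : B.moduleSpace V s) : Amb k G M V) = B.ambAct s σ g F := rfl

/-- The operator
`m₁ ⊗ ⋯ ⊗ m_n ⊗ z₁⋯z_n v ↦ t ⊗ ^{y}m₁ ⊗ ⋯ ⊗ ^{y}m_n ⊗ y₁⋯y_m z₁⋯z_n v`, where `y` stands
for `y₁⋯y_m`; it depends linearly on `t`. -/
noncomputable def ambMul (V : Type*) [AddCommGroup V] [Module k V] (ys : List G) :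
    TensorAlgebra k M →ₗ[k] Amb k G M V →ₗ[k] Amb k G M V where
  toFun t := Finsupp.lsum k fun zs => Finsupp.lsingle (ys ++ zs) ∘ₗ
    TensorProduct.map (LinearMap.mulLeft k t ∘ₗ (B.tensorAct ys.prod).toLinearMap) LinearMap.id
  map_add' t t' := by
    ext1 zs
    apply TensorProduct.ext'
    intro a b
    simp [add_mul, TensorProduct.add_tmul]
  map_smul' c t := by
    ext1 zs
    apply TensorProduct.ext'
    intro a b
    simp [TensorProduct.smul_tmul']

theorem ambMul_single (ys zs : List G) (t t' : TensorAlgebra k M) (v : V) :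
    B.ambMul V ys t (Finsupp.single zs (t' ⊗ₜ[k] v)) =
      Finsupp.single (ys ++ zs) ((t * B.tensorAct ys.prod t') ⊗ₜ[k] v) := by
  simp [ambMul]

variable {W : Type*} [AddCommGroup W] [Module k W] {X : Type*} [AddCommGroup X] [Module k X]

/-- The map `f' ⊛ -` on the ambient space:
`m₁ ⊗ ⋯ ⊗ m_m ⊗ y₁⋯y_m v ↦ m₁ ⊗ ⋯ ⊗ m_m ⊗ ^{y₁⋯y_m}(f'(v))`. -/
noncomputable def ambCirc (f' : V →ₗ[k] Amb k G M W) : Amb k G M V →ₗ[k] Amb k G M W :=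
  Finsupp.lsum k fun ys => TensorProduct.lift (LinearMap.lcomp k _ f' ∘ₗ B.ambMul W ys)

theorem ambCirc_single (f' : V →ₗ[k] Amb k G M W) (ys : List G) (t : TensorAlgebra k M) (v : V) :
    B.ambCirc f' (Finsupp.single ys (t ⊗ₜ[k] v)) = B.ambMul W ys t (f' v) := by
  simp [ambCirc]

theorem ambMul_ambMul (ys zs : List G) (t t' : TensorAlgebra k M) (F : Amb k G M V) :
    B.ambMul V ys t (B.ambMul V zs t' F) =
      B.ambMul V (ys ++ zs) (t * B.tensorAct ys.prod t') F := by
  refine LinearMap.congr_fun (f := B.ambMul V ys t ∘ₗ B.ambMul V zs t') (amb_ext ?_) F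
  intro xs t'' v
  simp only [LinearMap.comp_apply, ambMul_single, List.append_assoc, List.prod_append,
    tensorAct_mul_apply, map_mul, mul_assoc]

theorem ambCirc_ambMul (f' : V →ₗ[k] Amb k G M W) (ys : List G) (t : TensorAlgebra k M)
    (F : Amb k G M V) : B.ambCirc f' (B.ambMul V ys t F) = B.ambMul W ys t (B.ambCirc f' F) := by
  refine LinearMap.congr_fun (f := B.ambCirc f' ∘ₗ B.ambMul V ys t)
    (g := B.ambMul W ys t ∘ₗ B.ambCirc f') (amb_ext ?_) F
  intro xs t'' v
  simp only [LinearMap.comp_apply, ambMul_single, ambCirc_single, ambMul_ambMul]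

theorem ambCirc_ambCirc (f'' : W →ₗ[k] Amb k G M X) (f' : V →ₗ[k] Amb k G M W)
    (F : Amb k G M V) :
    B.ambCirc f'' (B.ambCirc f' F) = B.ambCirc (B.ambCirc f'' ∘ₗ f') F := by
  refine LinearMap.congr_fun (f := B.ambCirc f'' ∘ₗ B.ambCirc f') (amb_ext ?_) F
  intro xs t'' v
  simp only [LinearMap.comp_apply, ambCirc_single, ambCirc_ambMul]

theorem ambMul_mem {i j l : D.orb} {s : EndSeq D.orb i j} {t : EndSeq D.orb j l} {ys : List G}
    (hy : IsReps s ys) {a : TensorAlgebra k M} (ha : a ∈ B.prodSpace s 1 ys)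
    {F : Amb k G M V} (hF : F ∈ B.moduleSpace V t) :
    B.ambMul V ys a F ∈ B.moduleSpace V (s.append t) := by
  revert F
  change B.moduleSpace V t ≤ (B.moduleSpace V (s.append t)).comap (B.ambMul V ys a)
  rw [← B.span_gens, Submodule.span_le]
  rintro _ ⟨zs, b, v, hz, hb, rfl⟩
  rw [SetLike.mem_coe, Submodule.mem_comap, B.ambMul_single]
  refine B.single_mem (isReps_append s t hy hz) (B.tmul_mem_layer ?_ _)
  refine B.prodSpace_append s t 1 hy (Submodule.mul_mem_mul ha ?_)
  have := B.prodSpace_move t ys.prod 1 ys.prod 1 (by simp) hz (Submodule.mem_map_of_mem hb)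
  rw [(moveReps_one t hz).1] at this
  simpa using this

theorem ambCirc_mem {i j l : D.orb} {s : EndSeq D.orb i j} {t : EndSeq D.orb j l}
    {f' : V →ₗ[k] Amb k G M W} (hf : ∀ v, f' v ∈ B.moduleSpace W t)
    {F : Amb k G M V} (hF : F ∈ B.moduleSpace V s) :
    B.ambCirc f' F ∈ B.moduleSpace W (s.append t) := by
  revert F
  change B.moduleSpace V s ≤ (B.moduleSpace W (s.append t)).comap (B.ambCirc f')
  rw [← B.span_gens, Submodule.span_le]
  rintro _ ⟨zs, b, v, hz, hb, rfl⟩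
  rw [SetLike.mem_coe, Submodule.mem_comap, B.ambCirc_single]
  exact B.ambMul_mem hz hb (hf v)

theorem ambMul_ambAct {i j l : D.orb} {s : EndSeq D.orb i j} {t : EndSeq D.orb j l}
    (τ : Representation k (Stab l) V) (g : Stab i) {ys : List G}
    (hy : IsReps s ys) (a : TensorAlgebra k M) {F : Amb k G M V} (hF : F ∈ B.moduleSpace V t) :
    B.ambMul V (moveReps s g ys) (B.tensorAct g a) (B.ambAct t τ (moveRem s g ys) F) =
      B.ambAct (s.append t) τ g (B.ambMul V ys a F) := by
  refine B.ext_moduleSpace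
    (A := B.ambMul V (moveReps s g ys) (B.tensorAct g a) ∘ₗ B.ambAct t τ (moveRem s g ys))
    (A' := B.ambAct (s.append t) τ g ∘ₗ B.ambMul V ys a) ?_ hF
  intro zs b v hz _
  simp only [LinearMap.comp_apply, ambMul_single, ambAct_single]
  rw [(moveReps_append s t g zs hy).1, (moveReps_append s t g zs hy).2, map_mul,
    ← tensorAct_mul_apply, ← tensorAct_mul_apply, mul_prod_eq s g hy]

end EquivariantBimodule

/-- The space of intertwiners `Hom_{k G_{i₀}}(U, M(i₀, …, i_n; V))` for `U` in `Irr(G_{i₀})` and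
`V` in `Irr(G_{i_n})`. -/
abbrev Intertwiner (B : EquivariantBimodule k G Q₀ M) (a b : D.Vertex)
    (s : EndSeq D.orb a.pt b.pt) :=
  Representation.IntertwiningMap a.rep (B.moduleRep s b.rep)

namespace Intertwiner

variable {B : EquivariantBimodule k G Q₀ M}

/-- The linear map underlying an intertwiner, with values in the ambient space. -/
noncomputable def lin {a b : D.Vertex} {s : EndSeq D.orb a.pt b.pt} (f : Intertwiner B a b s) :
    a.Sp →ₗ[k] Amb k G M b.Sp :=
  (B.moduleSpace b.Sp s).subtype ∘ₗ f.toLinearMap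

theorem lin_apply {a b : D.Vertex} {s : EndSeq D.orb a.pt b.pt} (f : Intertwiner B a b s)
    (u : a.Sp) : f.lin u = (f u : Amb k G M b.Sp) := rfl

theorem lin_mem {a b : D.Vertex} {s : EndSeq D.orb a.pt b.pt} (f : Intertwiner B a b s)
    (u : a.Sp) : f.lin u ∈ B.moduleSpace b.Sp s := (f u).2

theorem lin_rep {a b : D.Vertex} {s : EndSeq D.orb a.pt b.pt} (f : Intertwiner B a b s)
    (g : OrbitData.Stab a.pt) (u : a.Sp) :
    f.lin (a.rep g u) = B.ambAct s b.rep g (f.lin u) := by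
  rw [lin_apply, f.isIntertwining]
  rfl

theorem lin_injective {a b : D.Vertex} {s : EndSeq D.orb a.pt b.pt}
    {f f' : Intertwiner B a b s} (h : f.lin = f'.lin) : f = f' := by
  apply Representation.IntertwiningMap.ext
  ext1 u
  exact Subtype.ext (LinearMap.congr_fun h u)

/-- An intertwiner from its underlying linear map. -/
noncomputable def mk' {a b : D.Vertex} {s : EndSeq D.orb a.pt b.pt} (f : a.Sp →ₗ[k] Amb k G M b.Sp)
    (hf : ∀ u, f u ∈ B.moduleSpace b.Sp s)
    (hf' : ∀ g u, f (a.rep g u) = B.ambAct s b.rep g (f u)) : Intertwiner B a b s where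
  toLinearMap := f.codRestrict _ hf
  isIntertwining' g := by
    ext1 u
    exact Subtype.ext (hf' g u)

theorem lin_mk' {a b : D.Vertex} {s : EndSeq D.orb a.pt b.pt} (f : a.Sp →ₗ[k] Amb k G M b.Sp)
    (hf : ∀ u, f u ∈ B.moduleSpace b.Sp s)
    (hf' : ∀ g u, f (a.rep g u) = B.ambAct s b.rep g (f u)) : (mk' f hf hf').lin = f := rfl

/-- The intertwiner `f' ⊛ f`. -/
noncomputable def circ {a b c : D.Vertex} {s : EndSeq D.orb a.pt b.pt}
    {t : EndSeq D.orb b.pt c.pt} (f' : Intertwiner B b c t) (f : Intertwiner B a b s) :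
    Intertwiner B a c (s.append t) :=
  mk' (B.ambCirc f'.lin ∘ₗ f.lin) (fun u => B.ambCirc_mem f'.lin_mem (f.lin_mem u)) (by
    intro g u
    rw [LinearMap.comp_apply, LinearMap.comp_apply, f.lin_rep]
    refine B.ext_moduleSpace (A := B.ambCirc f'.lin ∘ₗ B.ambAct s b.rep g)
      (A' := B.ambAct (s.append t) c.rep g ∘ₗ B.ambCirc f'.lin) ?_ (f.lin_mem u)
    intro ys x v hy _
    rw [LinearMap.comp_apply, LinearMap.comp_apply, B.ambAct_single, B.ambCirc_single,
      B.ambCirc_single, f'.lin_rep, B.ambMul_ambAct _ _ hy _ (f'.lin_mem v)])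

theorem lin_circ {a b c : D.Vertex} {s : EndSeq D.orb a.pt b.pt}
    {t : EndSeq D.orb b.pt c.pt} (f' : Intertwiner B b c t) (f : Intertwiner B a b s) :
    (circ f' f).lin = B.ambCirc f'.lin ∘ₗ f.lin := rfl

/-- The identity of `U`, as an intertwiner `U → M(i; U) = U`. -/
noncomputable def one (B : EquivariantBimodule k G Q₀ M) (a : D.Vertex) :
    Intertwiner B a a (.nil a.pt) :=
  mk' (Finsupp.lsingle [] ∘ₗ TensorProduct.mk k (TensorAlgebra k M) a.Sp 1)
    (fun u => B.single_mem (s := .nil a.pt) (ys := []) (by simp [OrbitData.IsReps])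
      (B.tmul_mem_layer (by simp [EquivariantBimodule.prodSpace]) u))
    (by
      intro g u
      simp only [LinearMap.comp_apply, Finsupp.lsingle_apply, TensorProduct.mk_apply]
      rw [B.ambAct_single]
      simp [OrbitData.moveReps, OrbitData.moveRem])

theorem lin_one_apply (a : D.Vertex) (u : a.Sp) :
    (one B a).lin u = Finsupp.single [] (1 ⊗ₜ[k] u) := rfl

/-- `circ` as a bilinear map. -/
noncomputable def circL {a b c : D.Vertex} (s : EndSeq D.orb a.pt b.pt)
    (t : EndSeq D.orb b.pt c.pt) :
    Intertwiner B b c t →ₗ[k] Intertwiner B a b s →ₗ[k] Intertwiner B a c (s.append t) :=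
  LinearMap.mk₂ k circ
    (by
      intro f f' h
      apply lin_injective
      have : (f + f').lin = f.lin + f'.lin := rfl
      change B.ambCirc (f + f').lin ∘ₗ h.lin = B.ambCirc f.lin ∘ₗ h.lin + B.ambCirc f'.lin ∘ₗ h.lin
      rw [← LinearMap.add_comp]
      congr 1
      apply amb_ext
      intro ys x v
      simp [this, EquivariantBimodule.ambCirc_single])
    (by
      intro r f h
      apply lin_injective
      have : (r • f).lin = r • f.lin := rfl
      change B.ambCirc (r • f).lin ∘ₗ h.lin = r • (B.ambCirc f.lin ∘ₗ h.lin)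
      rw [← LinearMap.smul_comp]
      congr 1
      apply amb_ext
      intro ys x v
      simp [this, EquivariantBimodule.ambCirc_single])
    (by
      intro f h h'
      apply lin_injective
      change B.ambCirc f.lin ∘ₗ (h.lin + h'.lin) = _
      rw [LinearMap.comp_add]
      rfl)
    (by
      intro r f h
      apply lin_injective
      change B.ambCirc f.lin ∘ₗ (r • h.lin) = _
      rw [LinearMap.comp_smul]
      rfl)

theorem circL_apply {a b c : D.Vertex} {s : EndSeq D.orb a.pt b.pt}
    {t : EndSeq D.orb b.pt c.pt} (f' : Intertwiner B b c t) (f : Intertwiner B a b s) :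
    circL s t f' f = circ f' f := rfl

theorem lin_circ_one {a b : D.Vertex} {s : EndSeq D.orb a.pt b.pt} (f : Intertwiner B a b s) :
    (circ f (one B a)).lin = f.lin := by
  ext1 u
  rw [lin_circ, LinearMap.comp_apply, lin_one_apply, B.ambCirc_single]
  refine LinearMap.congr_fun (f := B.ambMul b.Sp [] 1) (g := LinearMap.id) (amb_ext ?_) (f.lin u)
  intro ys x v
  simp [EquivariantBimodule.ambMul_single, EquivariantBimodule.tensorAct_one]

theorem lin_one_circ {a b : D.Vertex} {s : EndSeq D.orb a.pt b.pt} (f : Intertwiner B a b s) :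
    (circ (one B b) f).lin = f.lin := by
  ext1 u
  rw [lin_circ, LinearMap.comp_apply]
  refine LinearMap.congr_fun (f := B.ambCirc (one B b).lin) (g := LinearMap.id) (amb_ext ?_)
    (f.lin u)
  intro ys x v
  simp [EquivariantBimodule.ambMul_single, EquivariantBimodule.ambCirc_single, lin_one_apply]

theorem lin_circ_circ {a b c d : D.Vertex} {s : EndSeq D.orb a.pt b.pt}
    {t : EndSeq D.orb b.pt c.pt} {r : EndSeq D.orb c.pt d.pt} (f'' : Intertwiner B c d r)
    (f' : Intertwiner B b c t) (f : Intertwiner B a b s) :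
    (circ (circ f'' f') f).lin = (circ f'' (circ f' f)).lin := by
  ext1 u
  simp only [lin_circ, LinearMap.comp_apply, B.ambCirc_ambCirc]

end Intertwiner

end Intertwiners

section IntertwinerAlgebra

variable {k : Type u} {G : Type v} {Q₀ : Type w} [Field k] [Group G] [Fintype Q₀]
  [MulAction G Q₀] {M : Type z} [AddCommGroup M] [Module k M]
  {D : OrbitData.{u, v, w, x, y} k G Q₀}

/-- The indices `(i₀, …, i_n; U, V)` of the summands of the algebra of intertwiners: the ends of
the sequence of orbit representatives are the points of `src = (i₀, U)` and `tgt = (i_n, V)`. -/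
structure IntwIdx (D : OrbitData.{u, v, w, x, y} k G Q₀) where
  src : D.Vertex
  tgt : D.Vertex
  seq : EndSeq D.orb src.pt tgt.pt

/-- The algebra of intertwiners relative to `M`, the direct sum of the spaces
`Hom_{k G_{i₀}}(U, M(i₀, …, i_n; V))`. -/
def Intw (D : OrbitData.{u, v, w, x, y} k G Q₀) (B : EquivariantBimodule k G Q₀ M) :=
  DirectSum (IntwIdx D) fun p => Intertwiner B p.src p.tgt p.seq

namespace Intw

variable {B : EquivariantBimodule k G Q₀ M}

noncomputable instance instAddCommMonoid : AddCommMonoid (Intw D B) :=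
  inferInstanceAs (AddCommMonoid (DirectSum (IntwIdx D) fun p => Intertwiner B p.src p.tgt p.seq))

noncomputable instance : Module k (Intw D B) :=
  inferInstanceAs (Module k (DirectSum (IntwIdx D) fun p => Intertwiner B p.src p.tgt p.seq))

open Classical in
/-- An intertwiner, as an element of the algebra of intertwiners. -/
noncomputable def of {a b : D.Vertex} (s : EndSeq D.orb a.pt b.pt) :
    Intertwiner B a b s →ₗ[k] Intw D B :=
  DirectSum.lof k (IntwIdx D) (fun p => Intertwiner B p.src p.tgt p.seq) ⟨a, b, s⟩

theorem of_eq {a b : D.Vertex} {s t : EndSeq D.orb a.pt b.pt} (h : s = t)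
    {f : Intertwiner B a b s} {g : Intertwiner B a b t} (hfg : f.lin = g.lin) :
    of s f = of t g := by
  subst h
  rw [Intertwiner.lin_injective hfg]

theorem induction {P : Intw D B → Prop} (h0 : P 0) (hadd : ∀ x y, P x → P y → P (x + y))
    (hof : ∀ (a b : D.Vertex) (s : EndSeq D.orb a.pt b.pt) (f : Intertwiner B a b s),
      P (of s f)) (x : Intw D B) : P x := by
  classical
  refine DirectSum.induction_on (motive := P) x h0 ?_ hadd
  rintro ⟨a, b, s⟩ f
  have := hof a b s f
  exact this

open Classical in
/-- The product of two summands: `f' ⊛ f` if these can be composed, and `0` otherwise. -/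
noncomputable def mulAux {a b b' c : D.Vertex} (t : EndSeq D.orb b'.pt c.pt)
    (s : EndSeq D.orb a.pt b.pt) :
    Intertwiner B b' c t →ₗ[k] Intertwiner B a b s →ₗ[k] Intw D B :=
  if h : b = b' then by
    subst h
    exact (Intertwiner.circL s t).compr₂ (of (s.append t))
  else 0

theorem mulAux_self {a b c : D.Vertex} (t : EndSeq D.orb b.pt c.pt)
    (s : EndSeq D.orb a.pt b.pt) (f' : Intertwiner B b c t) (f : Intertwiner B a b s) :
    mulAux t s f' f = of (s.append t) (f'.circ f) := by
  simp only [mulAux, dif_pos]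
  rfl

theorem mulAux_ne {a b b' c : D.Vertex} (h : b ≠ b') (t : EndSeq D.orb b'.pt c.pt)
    (s : EndSeq D.orb a.pt b.pt) (f' : Intertwiner B b' c t) (f : Intertwiner B a b s) :
    mulAux t s f' f = 0 := by
  simp [mulAux, dif_neg h]

open Classical in
/-- The linear map out of the algebra of intertwiners with given restrictions to the summands. -/
noncomputable def lift {N : Type*} [AddCommMonoid N] [Module k N]
    (F : (p : IntwIdx D) → Intertwiner B p.src p.tgt p.seq →ₗ[k] N) : Intw D B →ₗ[k] N :=
  DirectSum.toModule k (IntwIdx D) N F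

open Classical in
theorem lift_of {N : Type*} [AddCommMonoid N] [Module k N]
    (F : (p : IntwIdx D) → Intertwiner B p.src p.tgt p.seq →ₗ[k] N) {a b : D.Vertex}
    (s : EndSeq D.orb a.pt b.pt) (f : Intertwiner B a b s) :
    lift F (of s f) = F ⟨a, b, s⟩ f :=
  DirectSum.toModule_lof k (φ := F) (⟨a, b, s⟩ : IntwIdx D) f

/-- The operation `⊛` on the algebra of intertwiners, as a bilinear map. -/
noncomputable def mulL : Intw D B →ₗ[k] Intw D B →ₗ[k] Intw D B :=
  lift fun p => LinearMap.flip (lift fun q => (mulAux p.seq q.seq).flip)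

theorem mulL_of_of {a b b' c : D.Vertex} (t : EndSeq D.orb b'.pt c.pt)
    (s : EndSeq D.orb a.pt b.pt) (f' : Intertwiner B b' c t) (f : Intertwiner B a b s) :
    mulL (of t f') (of s f) = mulAux t s f' f := by
  rw [mulL, lift_of, LinearMap.flip_apply, lift_of, LinearMap.flip_apply]

theorem mulL_assoc (x₁ x₂ x₃ : Intw D B) :
    mulL (mulL x₁ x₂) x₃ = mulL x₁ (mulL x₂ x₃) := by
  induction x₁ using induction with
  | h0 => simp
  | hadd x y hx hy => simp [hx, hy]
  | hof c' d r f₁ =>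
  induction x₂ using induction with
  | h0 => simp
  | hadd x y hx hy => simp [hx, hy]
  | hof b' c t f₂ =>
  induction x₃ using induction with
  | h0 => simp
  | hadd x y hx hy => simp [hx, hy]
  | hof a b s f₃ =>
  rw [mulL_of_of, mulL_of_of]
  by_cases h : c = c'
  · subst h
    rw [mulAux_self, mulL_of_of]
    by_cases h : b = b'
    · subst h
      rw [mulAux_self, mulAux_self, mulL_of_of, mulAux_self]
      exact of_eq (EndSeq.append_assoc s t r).symm (Intertwiner.lin_circ_circ f₁ f₂ f₃)
    · rw [mulAux_ne h, mulAux_ne h, map_zero]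
  · rw [mulAux_ne h, map_zero, LinearMap.zero_apply]
    by_cases h : b = b'
    · subst h
      rw [mulAux_self, mulL_of_of, mulAux_ne ‹_›]
    · rw [mulAux_ne h, map_zero]

/-- The unit of the algebra of intertwiners, the sum of the identities of all `(i, U)`. -/
noncomputable def unit : Intw D B :=
  letI := Fintype.ofFinite D.Vertex
  ∑ a : D.Vertex, of (.nil a.pt) (Intertwiner.one B a)

theorem unit_mulL (x₁ : Intw D B) : mulL unit x₁ = x₁ := by
  classical
  induction x₁ using induction with
  | h0 => simp
  | hadd x y hx hy => simp [hx, hy]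
  | hof a b s f =>
  let _ := Fintype.ofFinite D.Vertex
  rw [unit, map_sum, LinearMap.sum_apply, Finset.sum_eq_single b]
  · rw [mulL_of_of, mulAux_self]
    exact of_eq (EndSeq.append_nil s) (Intertwiner.lin_one_circ f)
  · intro c _ hc
    rw [mulL_of_of, mulAux_ne (Ne.symm hc)]
  · intro h
    exact (h (Finset.mem_univ _)).elim

theorem mulL_unit (x₁ : Intw D B) : mulL x₁ unit = x₁ := by
  classical
  induction x₁ using induction with
  | h0 => simp
  | hadd x y hx hy => simp [hx, hy]
  | hof a b s f =>
  let _ := Fintype.ofFinite D.Vertex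
  rw [unit, map_sum, Finset.sum_eq_single a]
  · rw [mulL_of_of, mulAux_self]
    exact of_eq rfl (Intertwiner.lin_circ_one f)
  · intro c _ hc
    rw [mulL_of_of, mulAux_ne hc]
  · intro h
    exact (h (Finset.mem_univ _)).elim

noncomputable instance : Semiring (Intw D B) where
  __ := instAddCommMonoid
  mul x₁ x₂ := mulL x₁ x₂
  one := unit
  left_distrib x₁ x₂ x₃ := map_add (mulL x₁) x₂ x₃
  right_distrib x₁ x₂ x₃ := LinearMap.map_add₂ mulL x₁ x₂ x₃
  zero_mul x₁ := LinearMap.map_zero₂ mulL x₁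
  mul_zero x₁ := map_zero (mulL x₁)
  mul_assoc := mulL_assoc
  one_mul := unit_mulL
  mul_one := mulL_unit

theorem of_mul_of {a b c : D.Vertex} (t : EndSeq D.orb b.pt c.pt)
    (s : EndSeq D.orb a.pt b.pt) (f' : Intertwiner B b c t) (f : Intertwiner B a b s) :
    of t f' * of s f = of (s.append t) (f'.circ f) := by
  rw [← mulAux_self, ← mulL_of_of]
  rfl

noncomputable instance : Algebra k (Intw D B) :=
  Algebra.ofModule (fun r x₁ x₂ => LinearMap.map_smul₂ mulL r x₁ x₂)
    (fun r x₁ x₂ => map_smul (mulL x₁) r x₂)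

end Intw

end IntertwinerAlgebra

section PathAlgebra

/-- A path of a quiver, together with its ends. -/
structure PathIdx (V : Type u) [Quiver.{v + 1} V] where
  src : V
  tgt : V
  path : Quiver.Path src tgt

/-- The path algebra `kQ` of a quiver `Q` with finitely many vertices: the paths form a basis, and
the product of two paths is the path which traverses the first one, and then the second one,
or `0` if this makes no sense. -/
def PathAlgebra (k : Type w) (V : Type u) [Field k] [Quiver.{v + 1} V] := PathIdx V →₀ k

namespace PathAlgebra

variable {k : Type w} {V : Type u} [Field k] [Quiver.{v + 1} V]

noncomputable instance instAddCommMonoid : AddCommMonoid (PathAlgebra k V) :=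
  inferInstanceAs (AddCommMonoid (PathIdx V →₀ k))

noncomputable instance : Module k (PathAlgebra k V) :=
  inferInstanceAs (Module k (PathIdx V →₀ k))

/-- A path, as an element of the path algebra. -/
noncomputable def of (k : Type w) {V : Type u} [Field k] [Quiver.{v + 1} V] {a b : V}
    (p : Quiver.Path a b) : PathAlgebra k V :=
  Finsupp.single (⟨a, b, p⟩ : PathIdx V) (1 : k)

open Classical in
/-- The product of two paths. -/
noncomputable def mulAux (k : Type w) {V : Type u} [Field k] [Quiver.{v + 1} V] {a b b' c : V}
    (p : Quiver.Path a b) (q : Quiver.Path b' c) : PathAlgebra k V :=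
  if h : b' = b then of k (p.comp (q.cast h rfl)) else 0

theorem mulAux_self {a b c : V} (p : Quiver.Path a b) (q : Quiver.Path b c) :
    mulAux k p q = of k (p.comp q) := by
  simp [mulAux]

theorem mulAux_ne {a b b' c : V} (h : b' ≠ b) (p : Quiver.Path a b) (q : Quiver.Path b' c) :
    mulAux k p q = 0 := by
  simp [mulAux, dif_neg h]

/-- The linear map out of the path algebra with given values on the paths. -/
noncomputable def lift {N : Type*} [AddCommMonoid N] [Module k N] (F : PathIdx V → N) :
    PathAlgebra k V →ₗ[k] N :=
  Finsupp.lsum k fun p => LinearMap.toSpanSingleton k N (F p)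

theorem lift_of {N : Type*} [AddCommMonoid N] [Module k N] (F : PathIdx V → N) {a b : V}
    (p : Quiver.Path a b) : lift F (of k p) = F ⟨a, b, p⟩ := by
  refine (Finsupp.lsum_single k _ _ _).trans ?_
  rw [LinearMap.toSpanSingleton_apply, one_smul]

/-- The product of the path algebra, as a bilinear map. -/
noncomputable def mulL : PathAlgebra k V →ₗ[k] PathAlgebra k V →ₗ[k] PathAlgebra k V :=
  lift fun p => lift fun q => mulAux k p.path q.path

theorem mulL_of_of {a b b' c : V} (p : Quiver.Path a b) (q : Quiver.Path b' c) :
    mulL (of k p) (of k q) = mulAux k p q := by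
  rw [mulL, lift_of, lift_of]

theorem induction {P : PathAlgebra k V → Prop} (h0 : P 0)
    (hadd : ∀ x y, P x → P y → P (x + y)) (hsmul : ∀ (r : k) x, P x → P (r • x))
    (hof : ∀ (a b : V) (p : Quiver.Path a b), P (of k p)) (x : PathAlgebra k V) : P x := by
  refine Finsupp.induction_linear (motive := P) x h0 hadd ?_
  rintro ⟨a, b, p⟩ r
  have := hsmul r _ (hof a b p)
  unfold of at this
  have e : Finsupp.single (⟨a, b, p⟩ : PathIdx V) r =
      r • Finsupp.single (⟨a, b, p⟩ : PathIdx V) (1 : k) := (Finsupp.smul_single_one _ r).symm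
  rw [e]
  exact this

theorem mulL_assoc (x₁ x₂ x₃ : PathAlgebra k V) :
    mulL (mulL x₁ x₂) x₃ = mulL x₁ (mulL x₂ x₃) := by
  induction x₁ using induction with
  | h0 => simp
  | hadd x y hx hy => simp [hx, hy]
  | hsmul r x hx => simp [hx]
  | hof a b p =>
  induction x₂ using induction with
  | h0 => simp
  | hadd x y hx hy => simp [hx, hy]
  | hsmul r x hx => simp [hx]
  | hof b' c q =>
  induction x₃ using induction with
  | h0 => simp
  | hadd x y hx hy => simp [hx, hy]
  | hsmul r x hx => simp [hx]
  | hof c' d r =>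
  rw [mulL_of_of, mulL_of_of]
  by_cases h : b' = b
  · subst h
    rw [mulAux_self, mulL_of_of]
    by_cases h : c' = c
    · subst h
      rw [mulAux_self, mulAux_self, mulL_of_of, mulAux_self, Quiver.Path.comp_assoc]
    · rw [mulAux_ne h, mulAux_ne h, map_zero]
  · rw [mulAux_ne h, map_zero, LinearMap.zero_apply]
    by_cases h : c' = c
    · subst h
      rw [mulAux_self, mulL_of_of, mulAux_ne ‹_›]
    · rw [mulAux_ne h, map_zero]

variable [Finite V]

/-- The unit of the path algebra, the sum of the paths of length `0`. -/
noncomputable def unit : PathAlgebra k V :=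
  letI := Fintype.ofFinite V
  ∑ a : V, of k (Quiver.Path.nil : Quiver.Path a a)

theorem unit_mulL (x₁ : PathAlgebra k V) : mulL unit x₁ = x₁ := by
  classical
  induction x₁ using induction with
  | h0 => simp
  | hadd x y hx hy => simp [hx, hy]
  | hsmul r x hx => simp [hx]
  | hof a b p =>
  let _ := Fintype.ofFinite V
  rw [unit, map_sum, LinearMap.sum_apply, Finset.sum_eq_single a]
  · rw [mulL_of_of, mulAux_self, Quiver.Path.nil_comp]
  · intro c _ hc
    rw [mulL_of_of, mulAux_ne (Ne.symm hc)]
  · intro h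
    exact (h (Finset.mem_univ _)).elim

theorem mulL_unit (x₁ : PathAlgebra k V) : mulL x₁ unit = x₁ := by
  classical
  induction x₁ using induction with
  | h0 => simp
  | hadd x y hx hy => simp [hx, hy]
  | hsmul r x hx => simp [hx]
  | hof a b p =>
  let _ := Fintype.ofFinite V
  rw [unit, map_sum, Finset.sum_eq_single b]
  · rw [mulL_of_of, mulAux_self, Quiver.Path.comp_nil]
  · intro c _ hc
    rw [mulL_of_of, mulAux_ne hc]
  · intro h
    exact (h (Finset.mem_univ _)).elim

noncomputable instance : Semiring (PathAlgebra k V) where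
  __ := instAddCommMonoid
  mul x₁ x₂ := mulL x₁ x₂
  one := unit
  left_distrib x₁ x₂ x₃ := map_add (mulL x₁) x₂ x₃
  right_distrib x₁ x₂ x₃ := LinearMap.map_add₂ mulL x₁ x₂ x₃
  zero_mul x₁ := LinearMap.map_zero₂ mulL x₁
  mul_zero x₁ := map_zero (mulL x₁)
  mul_assoc := mulL_assoc
  one_mul := unit_mulL
  mul_one := mulL_unit

noncomputable instance : Algebra k (PathAlgebra k V) :=
  Algebra.ofModule (fun r x₁ x₂ => LinearMap.map_smul₂ mulL r x₁ x₂)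
    (fun r x₁ x₂ => map_smul (mulL x₁) r x₂)

end PathAlgebra

end PathAlgebra

section Pairing

namespace TensorContraction

variable (k : Type u) (M : Type z) [Field k] [AddCommGroup M] [Module k M]

/-- Auxiliary to `peel`: `m` acts by `(x, Z) ↦ (m ⊗ x, φ ↦ φ(m) x)`. -/
noncomputable def peelAux : M →ₗ[k] Module.End k
    (TensorAlgebra k M × (Module.Dual k M →ₗ[k] TensorAlgebra k M)) where
  toFun m := (LinearMap.mulLeft k (TensorAlgebra.ι k m) ∘ₗ LinearMap.fst k _ _).prod
    (LinearMap.smulRightₗ (Module.Dual.eval k M m) ∘ₗ LinearMap.fst k _ _)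
  map_add' m m' := by
    apply LinearMap.ext
    rintro ⟨t, Z⟩
    ext <;> simp [add_mul]
  map_smul' r m := by
    apply LinearMap.ext
    rintro ⟨t, Z⟩
    ext <;> simp

/-- `m₁ ⊗ m₂ ⊗ ⋯ ⊗ m_n ↦ (φ ↦ φ(m₁) m₂ ⊗ ⋯ ⊗ m_n)` for `n ≥ 1`, and `1 ↦ 0`. -/
noncomputable def peel :
    TensorAlgebra k M →ₗ[k] Module.Dual k M →ₗ[k] TensorAlgebra k M :=
  LinearMap.snd k _ _ ∘ₗ LinearMap.applyₗ (1, 0) ∘ₗ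
    (TensorAlgebra.lift k (peelAux k M)).toLinearMap

variable {k M}

theorem lift_peelAux_fst (t : TensorAlgebra k M)
    (p : TensorAlgebra k M × (Module.Dual k M →ₗ[k] TensorAlgebra k M)) :
    (TensorAlgebra.lift k (peelAux k M) t p).1 = t * p.1 := by
  induction t using TensorAlgebra.induction generalizing p with
  | algebraMap r => simp [Algebra.smul_def]
  | ι m => simp [peelAux]
  | mul a b ha hb => rw [map_mul, Module.End.mul_apply, ha, hb, mul_assoc]
  | add a b ha hb => simp [ha, hb, add_mul]

theorem peel_one (φ : Module.Dual k M) : peel k M 1 φ = 0 := by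
  simp [peel]

theorem peel_ι_mul (m : M) (t : TensorAlgebra k M) (φ : Module.Dual k M) :
    peel k M (TensorAlgebra.ι k m * t) φ = φ m • t := by
  have := lift_peelAux_fst t (1, (0 : Module.Dual k M →ₗ[k] TensorAlgebra k M))
  rw [mul_one] at this
  simp only [peel, LinearMap.comp_apply, AlgHom.toLinearMap_apply, map_mul,
    TensorAlgebra.lift_ι_apply, LinearMap.applyₗ_apply_apply, Module.End.mul_apply]
  have e (p : TensorAlgebra k M × (Module.Dual k M →ₗ[k] TensorAlgebra k M)) :
      LinearMap.snd k _ _ (peelAux k M m p) φ = φ m • p.1 := rfl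
  rw [e, this]

variable (k M)

/-- `φ_n ⊗ ⋯ ⊗ φ₁` acts on the tensor algebra by successively removing the first factor of a
tensor, using `φ₁`, …, `φ_n`. -/
noncomputable def peelHom :
    TensorAlgebra k (Module.Dual k M) →ₐ[k] Module.End k (TensorAlgebra k M) :=
  TensorAlgebra.lift k (peel k M).flip

/-- The pairing
`(φ_n ⊗ ⋯ ⊗ φ₁, m₁ ⊗ ⋯ ⊗ m_n) ↦ φ₁(m₁) ⋯ φ_n(m_n)`; tensors of distinct degrees are
orthogonal. -/
noncomputable def contract :
    TensorAlgebra k M →ₗ[k] TensorAlgebra k (Module.Dual k M) →ₗ[k] k :=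
  ((peelHom k M).toLinearMap.compr₂ (TensorAlgebra.algebraMapInv (M := M)).toLinearMap).flip

variable {k M}

theorem contract_one_one : contract k M 1 1 = 1 := by
  simp [contract]

theorem contract_ι_mul (m : M) (t : TensorAlgebra k M) (φ : Module.Dual k M)
    (θ : TensorAlgebra k (Module.Dual k M)) :
    contract k M (TensorAlgebra.ι k m * t) (θ * TensorAlgebra.ι k φ) =
      φ m * contract k M t θ := by
  simp [contract, peelHom, peel_ι_mul]

end TensorContraction

variable {k : Type u} {G : Type v} {Q₀ : Type w} [Field k] [Group G] [Fintype Q₀]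
  [MulAction G Q₀] {M : Type z} [AddCommGroup M] [Module k M]
  {D : OrbitData.{u, v, w, x, y} k G Q₀}

namespace OrbitData

/-- For `y = y₁, …, y_n` along `i₀, …, i_n`, the sequence `x = x_{n-1}, …, x₀` and the element
`h₀` of `G_{i₀}` such that `x_t ∈ [G/G_{i_t}]` for all `t`,
`(y_t ⋯ y_n)⁻¹ ∈ x_{n-1} ⋯ x_{t-1} G_{i_{t-1}}` for all `1 ≤ t ≤ n`, and
`(y₁ ⋯ y_n)⁻¹ = x_{n-1} ⋯ x₀ h₀`. -/
noncomputable def dualReps : {i j : D.orb} → EndSeq D.orb i j → List G → List G × Stab i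
  | _, _, .nil _, _ => ([], 1)
  | _, _, .cons _ _, [] => ([], 1)
  | _, _, .cons i s, y :: ys =>
      ((dualReps s ys).1 ++ [cosetRep i ((dualReps s ys).2 * y⁻¹)],
        cosetRem i ((dualReps s ys).2 * y⁻¹))

theorem prod_inv_eq : {i j : D.orb} → (s : EndSeq D.orb i j) → {ys : List G} → IsReps s ys →
    ys.prod⁻¹ = (dualReps s ys).1.prod * ((dualReps s ys).2 : G)
  | _, _, .nil _, [], _ => by simp [dualReps]
  | _, _, .nil _, _ :: _, h => h.elim
  | _, _, .cons _ _, [], h => h.elim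
  | _, _, .cons i s, y :: ys, h => by
      simp only [dualReps, List.prod_cons, mul_inv_rev, List.prod_append, List.prod_nil, mul_one]
      rw [mul_assoc, cosetRep_mul_cosetRem, ← mul_assoc, ← prod_inv_eq s h.2]

end OrbitData

open OrbitData TensorContraction

/-- The map `Φ(φ) : M(i₀, …, i_n; V) → U` attached to `φ : V → M^*(i_n, …, i₀; U)`. It sends
`m₁ ⊗ ⋯ ⊗ m_n ⊗ y₁⋯y_n v` to `∏_t φ_t(^{(y₁⋯y_n)⁻¹} m_t) · ^{h₀⁻¹} u`, where
`φ_n ⊗ ⋯ ⊗ φ₁ ⊗ x_{n-1}⋯x₀ u` is the component of `φ(v)` whose index `x` is, together with `h₀`,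
determined by `y` as in `OrbitData.dualReps`. -/
noncomputable def evalDual (B : EquivariantBimodule k G Q₀ M) {i j : D.orb}
    (s : EndSeq D.orb i j) {V : Type*} [AddCommGroup V] [Module k V]
    {U : Type*} [AddCommGroup U] [Module k U] (σ : Representation k (Stab i) U)
    (φ : V →ₗ[k] Amb k G (Module.Dual k M) U) : Amb k G M V →ₗ[k] U :=
  Finsupp.lsum k fun ys => TensorProduct.lift <| LinearMap.mk₂ k
    (fun t v => σ (dualReps s ys).2⁻¹ (TensorProduct.lid k U
      ((contract k M (B.tensorAct ys.prod⁻¹ t)).rTensor U (φ v (dualReps s ys).1))))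
    (by intros; simp [LinearMap.rTensor_add])
    (by intros; simp [LinearMap.rTensor_smul])
    (by intros; simp)
    (by intros; simp)

theorem evalDual_single (B : EquivariantBimodule k G Q₀ M) {i j : D.orb}
    (s : EndSeq D.orb i j) {V : Type*} [AddCommGroup V] [Module k V]
    {U : Type*} [AddCommGroup U] [Module k U] (σ : Representation k (Stab i) U)
    (φ : V →ₗ[k] Amb k G (Module.Dual k M) U) (ys : List G) (t : TensorAlgebra k M) (v : V)
    (θ : TensorAlgebra k (Module.Dual k M)) (u : U)
    (h : φ v (dualReps s ys).1 = θ ⊗ₜ[k] u) :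
    evalDual B s σ φ (Finsupp.single ys (t ⊗ₜ[k] v)) =
      contract k M (B.tensorAct ys.prod⁻¹ t) θ • σ (dualReps s ys).2⁻¹ u := by
  simp [evalDual, h]

/-- The pairing `(f | φ)`, the scalar such that `Φ(φ) ∘ f = (f | φ) · id_U`, for intertwiners
`f : U → M(i₀, …, i_n; V)` and `φ : V → M^*(i_n, …, i₀; U)`. -/
noncomputable def pairing (B : EquivariantBimodule k G Q₀ M) {a b : D.Vertex}
    (s : EndSeq D.orb a.pt b.pt) (f : a.Sp →ₗ[k] Amb k G M b.Sp)
    (φ : b.Sp →ₗ[k] Amb k G (Module.Dual k M) a.Sp) : k :=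
  Classical.epsilon fun c : k => ∀ u : a.Sp, evalDual B s a.rep φ (f u) = c • u

section Paths

variable [Quiver.{q + 1} D.Vertex] {B : EquivariantBimodule k G Q₀ M}

/-- The sequence `i₀, …, i_n` attached to a path `(i₀, U₀) → ⋯ → (i_n, U_n)` of `Q_G`. -/
def pathSeq {a : D.Vertex} : {b : D.Vertex} → Quiver.Path a b → EndSeq D.orb a.pt b.pt
  | _, .nil => .nil a.pt
  | _, .cons (b := b) (c := c) p _ => (pathSeq p).append (.pair b.pt c.pt)

/-- The sequence `i_n, …, i₀` attached to a path `(i₀, U₀) → ⋯ → (i_n, U_n)` of `Q_G`. -/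
def pathSeqRev {a : D.Vertex} : {b : D.Vertex} → Quiver.Path a b → EndSeq D.orb b.pt a.pt
  | _, .nil => .nil a.pt
  | _, .cons (b := b) (c := c) p _ => (EndSeq.pair c.pt b.pt).append (pathSeqRev p)

theorem pathSeqRev_eq {a b : D.Vertex} (p : Quiver.Path a b) : pathSeqRev p = (pathSeq p).rev := by
  induction p with
  | nil => rfl
  | cons p _ ih => rw [pathSeq, EndSeq.rev_append_pair, pathSeqRev, ih]; rfl

/-- The intertwiner `f_γ = f_n ⊛ ⋯ ⊛ f₁` attached to a path `γ` with arrows `f₁, …, f_n`. -/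
noncomputable def pathIntertwiner
    (arr : (a b : D.Vertex) → (a ⟶ b) → Intertwiner B a b (.pair a.pt b.pt)) {a : D.Vertex} :
    {b : D.Vertex} → (p : Quiver.Path a b) → Intertwiner B a b (pathSeq p)
  | _, .nil => .one B a
  | _, .cons p e => (arr _ _ e).circ (pathIntertwiner arr p)

/-- The intertwiner `φ_γ = f₁^∨ ⊛ ⋯ ⊛ f_n^∨` relative to `M^*` attached to a path `γ` with
arrows `f₁, …, f_n`. -/
noncomputable def pathDualIntertwiner
    (d : (a b : D.Vertex) → (a ⟶ b) → Intertwiner B.dual b a (.pair b.pt a.pt)) {a : D.Vertex} :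
    {b : D.Vertex} → (p : Quiver.Path a b) → Intertwiner B.dual b a (pathSeqRev p)
  | _, .nil => .one B.dual a
  | _, .cons p e => (pathDualIntertwiner d p).circ (d _ _ e)

/-- `d` assigns to the arrows of `Q_G` the elements `f^∨` of the dual bases:
`(f' | f^∨)` is `1` if `f' = f`, and `0` for every other arrow `f'` parallel to `f`. -/
def IsDualFamily (arr : (a b : D.Vertex) → (a ⟶ b) → Intertwiner B a b (.pair a.pt b.pt))
    (d : (a b : D.Vertex) → (a ⟶ b) → Intertwiner B.dual b a (.pair b.pt a.pt)) : Prop :=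
  ∀ (a b : D.Vertex) (f f' : a ⟶ b),
    (f' = f → pairing B (.pair a.pt b.pt) (arr a b f').lin (d a b f).lin = 1) ∧
    (f' ≠ f → pairing B (.pair a.pt b.pt) (arr a b f').lin (d a b f).lin = 0)

end Paths

end Pairing

/-! Two facts carry the theorem: in each summand of the algebra of intertwiners the `f_γ` span, and
the `φ_γ` are dual to them.

Spanning. The module `M(i₀, …, i_n; V)` is a quotient of `M(i₀, …, i_{n-1}; M(i_{n-1}, i_n; V))`
(`circMap_id_surjective`). Since the order of `G_{i₀}` is invertible in `k`, an intertwiner lifts to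
this module, and splitting the inner module `M(i_{n-1}, i_n; V)` into irreducibles writes it as a
sum of products `f₂ ⊛ f₁` with `f₂` of length one (`exists_eq_sum_circ`). Induction on `n`, with
Schur's lemma for `n = 0`, yields `mem_span_pathIntertwiner`.

Duality. The map `Φ(φ)` is equivariant (`evalDual_ambAct`), so `Φ(φ) ∘ f` is a scalar by Schur's
lemma. In length one the pairing is nondegenerate on both sides: every intertwining map `p : M(i, j;
V) → U` is `Φ` of its transpose (`evalDual_transpose`), and `Φ(φ)` determines `φ`
(`eq_zero_of_evalDual_eq_zero`). Indeed a nonzero `f` is injective and has an equivariant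
retraction, and a nonzero `Φ(φ)` is surjective and has an equivariant section. Hence dual bases
exist and are unique. In length `n` the composite `Φ(φ_γ) ∘ f_γ'` collapses one arrow at a time
(`evalDual_ambCirc`): the inner composite `Φ(f_n^∨) ∘ f'_n` is `0` or the identity, by the choice of
dual bases if the two middle irreducibles agree, and by Schur's lemma otherwise. So `(f_γ' | φ_γ)`
is a Kronecker delta (`evalDual_pathIntertwiner`).

A spanning family with a dual family of linear forms is a basis, and the forms give the coordinates;
this is the expansion formula. As `f_γγ' = f_γ' ⊛ f_γ`, the bijection between the bases `γ` and
`f_γ` is an isomorphism of algebras onto the opposite algebra. -/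

namespace Representation

/-! ### Representations of a finite group whose order is invertible -/

open scoped MonoidAlgebra

variable {k H : Type*} [Field k] [Group H]
  {V W X : Type*} [AddCommGroup V] [Module k V] [AddCommGroup W] [Module k W]
  [AddCommGroup X] [Module k X]
  {ρ : Representation k H V} {σ : Representation k H W} {τ : Representation k H X}

theorem Equiv.isIrreducible (e : ρ.Equiv σ) (h : ρ.IsIrreducible) : σ.IsIrreducible := by
  rw [irreducible_iff_isSimpleModule_asModule] at h ⊢
  let f := IntertwiningMap.equivLinearMapAsModule ρ σ e.toIntertwiningMap
  have hf : Function.Bijective f := e.toLinearEquiv.bijective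
  exact IsSimpleModule.congr (LinearEquiv.ofBijective f hf).symm

theorem IsIrreducible.nontrivial (h : ρ.IsIrreducible) : Nontrivial V := by
  have : IsSimpleModule k[H] ρ.asModule := (irreducible_iff_isSimpleModule_asModule ρ).1 h
  exact IsSimpleModule.nontrivial k[H] ρ.asModule

theorem IsIrreducible.finiteDimensional [Finite H] (h : ρ.IsIrreducible) :
    FiniteDimensional k V := by
  have : IsSimpleModule k[H] ρ.asModule := (irreducible_iff_isSimpleModule_asModule ρ).1 h
  have : Module.Finite k ρ.asModule := Module.Finite.trans k[H] ρ.asModule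
  exact Module.Finite.equiv ρ.asModuleEquiv

/-- Schur's lemma. -/
theorem IsIrreducible.exists_eq_smul [IsAlgClosed k] [Finite H] (h : ρ.IsIrreducible)
    (f : IntertwiningMap ρ ρ) : ∃ c : k, ∀ v, f v = c • v := by
  have := h.finiteDimensional
  obtain ⟨c, rfl⟩ := (algebraMap_intertwiningMap_bijective_of_isAlgClosed (ρ := ρ)).2 f
  exact ⟨c, fun v => rfl⟩

/-- Intertwining maps from `ρ` lift along surjective intertwining maps. -/
theorem IntertwiningMap.exists_comp_eq {W X : Type*} [AddCommMonoid W] [Module k W]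
    [AddCommMonoid X] [Module k X] {σ : Representation k H W} {τ : Representation k H X}
    [Finite H] [NeZero (Nat.card H : k)]
    (p : IntertwiningMap σ τ) (hp : Function.Surjective p) (f : IntertwiningMap ρ τ) :
    ∃ g : IntertwiningMap ρ σ, p.comp g = f := by
  -- By Maschke's theorem the group algebra is semisimple, so all its modules are projective.
  have := Module.projective_of_isSemisimpleRing k[H] ρ.asModule
  obtain ⟨g, hg⟩ := Module.projective_lifting_property
    (equivLinearMapAsModule σ τ p) (equivLinearMapAsModule ρ τ f) hp
  refine ⟨(equivLinearMapAsModule ρ σ).symm g, DFunLike.ext _ _ fun v => ?_⟩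
  exact LinearMap.congr_fun hg v

/-- Injective intertwining maps have a retraction. -/
theorem IntertwiningMap.exists_comp_eq_id [Finite H] [NeZero (Nat.card H : k)]
    (f : IntertwiningMap ρ σ) (hf : Function.Injective f) :
    ∃ g : IntertwiningMap σ ρ, ∀ v, g (f v) = v := by
  obtain ⟨g, hg⟩ := MonoidAlgebra.exists_leftInverse_of_injective
    (equivLinearMapAsModule ρ σ f) (LinearMap.ker_eq_bot.2 hf)
  exact ⟨(equivLinearMapAsModule σ ρ).symm g, fun v => LinearMap.congr_fun hg v⟩

/-- The inclusion of a subrepresentation. -/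
def _root_.Subrepresentation.subtypeMap (S : Subrepresentation σ) :
    IntertwiningMap S.toRepresentation σ where
  toLinearMap := S.toSubmodule.subtype
  isIntertwining' _ := rfl

/-- A finite dimensional representation of a finite group whose order is invertible is a direct sum
of irreducible ones. -/
theorem exists_irreducible_decomposition [Finite H] [NeZero (Nat.card H : k)]
    [FiniteDimensional k W] (σ : Representation k H W) :
    ∃ (n : ℕ) (S : Fin n → Subrepresentation σ)
      (ι : (r : Fin n) → IntertwiningMap (S r).toRepresentation σ)
      (π : (r : Fin n) → IntertwiningMap σ (S r).toRepresentation),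
      (∀ r, (S r).toRepresentation.IsIrreducible) ∧ ∀ w, ∑ r, ι r (π r w) = w := by
  have : Module.Finite k[H] σ.asModule := Module.Finite.of_restrictScalars_finite k _ _
  obtain ⟨n, S, e, hS⟩ := IsSemisimpleModule.exists_linearEquiv_fin_dfinsupp k[H] σ.asModule
  -- The submodule `S r` and the module of the corresponding subrepresentation are distinct as types
  -- with `k[H]`-action; `J r` embeds the latter with range `S r`, and `E r` is the resulting
  -- isomorphism.
  let J (r : Fin n) := IntertwiningMap.equivLinearMapAsModule _ σ
    (Subrepresentation.ofSubmodule' (S r)).subtypeMap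
  have hJ (r : Fin n) : Function.Injective (J r) := Subtype.val_injective
  have hJ' (r : Fin n) : LinearMap.range (J r) = S r := by
    ext w
    exact ⟨fun ⟨a, ha⟩ => ha ▸ a.2, fun hw => ⟨⟨w, hw⟩, rfl⟩⟩
  let E (r : Fin n) : S r ≃ₗ[k[H]] (Subrepresentation.ofSubmodule' (S r)).toRepresentation.asModule :=
    ((LinearEquiv.ofInjective (J r) (hJ r)).trans (LinearEquiv.ofEq _ _ (hJ' r))).symm
  refine ⟨n, fun r => Subrepresentation.ofSubmodule' (S r),
    fun r => (IntertwiningMap.equivLinearMapAsModule _ _).symm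
      (e.symm.toLinearMap ∘ₗ DFinsupp.lsingle r ∘ₗ (E r).symm.toLinearMap),
    fun r => (IntertwiningMap.equivLinearMapAsModule _ _).symm
      ((E r).toLinearMap ∘ₗ DFinsupp.lapply r ∘ₗ e.toLinearMap), fun r => ?_, fun w => ?_⟩
  · rw [irreducible_iff_isSimpleModule_asModule]
    have := hS r
    exact IsSimpleModule.congr (E r).symm
  · have h : ∀ f : Π₀ r, S r, ∑ r, DFinsupp.single r (f r) = f := by
      intro f
      ext r
      simp [DFinsupp.single_apply]
    have h1 (w : σ.asModule) : ∑ r, e.symm (DFinsupp.single r (((E r).symm ((E r) (e w r))))) = w := by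
      simp only [LinearEquiv.symm_apply_apply]
      rw [← map_sum, h, LinearEquiv.symm_apply_apply]
    exact h1 w

end Representation

/-! ### Decomposition into the chosen irreducible representations -/

namespace OrbitData

open Representation

variable {k : Type u} {G : Type v} {Q₀ : Type w} [Field k] [Group G] [MulAction G Q₀]
  {D : OrbitData.{u, v, w, x, y} k G Q₀}

/-- The field `exists_equiv` only speaks of spaces in the universe of `k`. An irreducible
representation of a finite group is finite dimensional, so it can be transported to a coordinate
space `k^n`, which lives there. -/
theorem exists_equiv_irr [Finite G] (i : D.orb) {W : Type*} [AddCommGroup W] [Module k W]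
    (τ : Representation k (Stab i) W) (h : τ.IsIrreducible) :
    ∃ U, Nonempty (τ.Equiv (D.sigma i U)) := by
  have := h.finiteDimensional
  let e := (Module.finBasis k W).equivFun
  let τ' : Representation k (Stab i) (Fin (Module.finrank k W) → k) :=
    { toFun g := e.toLinearMap ∘ₗ τ g ∘ₗ e.symm.toLinearMap
      map_one' := LinearMap.ext fun w => by simp
      map_mul' g h := LinearMap.ext fun w => by simp }
  let E : τ.Equiv τ' := .mk e (by
    intro g
    ext1 w
    simp [τ'])
  obtain ⟨U, ⟨E'⟩⟩ := D.exists_equiv i _ τ' (E.isIrreducible h)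
  exact ⟨U, ⟨E.trans E'⟩⟩

theorem neZero_card_stab [Finite G] (hG : (Nat.card G : k) ≠ 0) (i : D.orb) :
    NeZero (Nat.card (Stab i) : k) := ⟨fun h => hG <| by
  rw [← (Stab i).card_mul_index, Nat.cast_mul, h, zero_mul]⟩

/-- The resolution of the identity `∑ ι_r π_r = id` is all that is needed to factor intertwiners;
the `U r` may repeat, according to multiplicity. -/
theorem exists_irr_decomposition [Finite G] (hG : (Nat.card G : k) ≠ 0) (i : D.orb) {W : Type*}
    [AddCommGroup W] [Module k W] [FiniteDimensional k W] (σ : Representation k (Stab i) W) :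
    ∃ (n : ℕ) (U : Fin n → D.Irr i) (ι : (r : Fin n) → IntertwiningMap (D.sigma i (U r)) σ)
      (π : (r : Fin n) → IntertwiningMap σ (D.sigma i (U r))), ∀ w, ∑ r, ι r (π r w) = w := by
  have := neZero_card_stab hG i
  obtain ⟨n, S, ι, π, hS, h⟩ := exists_irreducible_decomposition σ
  choose U hU using fun r => exists_equiv_irr i _ (hS r)
  let E r := (hU r).some
  refine ⟨n, U, fun r => (ι r).comp (E r).symm.toIntertwiningMap,
    fun r => (E r).toIntertwiningMap.comp (π r), fun w => ?_⟩
  simpa [IntertwiningMap.comp_apply] using h w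

theorem Vertex.isIrreducible (a : D.Vertex) : a.rep.IsIrreducible := D.irreducible a.pt a.irr

instance [Finite G] (a : D.Vertex) : FiniteDimensional k a.Sp :=
  a.isIrreducible.finiteDimensional

instance (a : D.Vertex) : Nontrivial a.Sp := a.isIrreducible.nontrivial

end OrbitData

/-! ### Sequences decomposed at their last step -/

namespace EndSeq

variable {X : Type u}

/-- Sequences are built by adding points on the left, while paths of a quiver grow on the right;
inductions along paths need this second principle, with the first point fixed. -/
theorem snoc_induction {i : X} {motive : (j : X) → EndSeq X i j → Prop} (nil : motive i (.nil i))
    (snoc : ∀ (j l : X) (s : EndSeq X i j), motive j s → motive l (s.append (pair j l)))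
    {j : X} (s : EndSeq X i j) : motive j s := by
  induction s with
  | nil i => exact nil
  | cons i s ih =>
    exact ih (motive := fun l t => motive l (cons i t)) (snoc _ _ (.nil i) nil)
      (fun j l t ht => snoc j l (cons i t) ht)

/-- The number `n` of steps of the sequence `i₀, …, i_n`. -/
def length : {i j : X} → EndSeq X i j → ℕ
  | _, _, nil _ => 0
  | _, _, cons _ s => length s + 1

theorem length_append : {i j l : X} → (s : EndSeq X i j) → (t : EndSeq X j l) →
    (s.append t).length = s.length + t.length
  | _, _, _, nil _, t => by simp [append, length]
  | _, _, _, cons i s, t => by simp only [append, length, length_append s t]; omega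

/-- The sequence `i₀, …, i_{n-1}`, if `n ≥ 1`. -/
def init : {i j : X} → EndSeq X i j → Option (Σ l, EndSeq X i l)
  | _, _, nil _ => none
  | _, _, cons i s => some ((init s).elim ⟨i, nil i⟩ fun p => ⟨p.1, cons i p.2⟩)

theorem init_append_pair : {i j : X} → (s : EndSeq X i j) → (l : X) →
    (s.append (pair j l)).init = some ⟨j, s⟩
  | _, _, nil _, _ => rfl
  | _, _, cons i s, l => by simp [append, init, init_append_pair s l]

theorem append_pair_ne_nil {i j : X} (s : EndSeq X i j) : s.append (pair j i) ≠ nil i := by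
  intro h
  have := congrArg init h
  rw [init_append_pair] at this
  cases this

/-- `init` strips the last step. The points before the last one are not known to agree in advance,
hence the equality in a sigma type. -/
theorem append_pair_inj {i j j' l : X} {s : EndSeq X i j} {s' : EndSeq X i j'}
    (h : s.append (pair j l) = s'.append (pair j' l)) :
    (⟨j, s⟩ : Σ l, EndSeq X i l) = ⟨j', s'⟩ := by
  have := congrArg init h
  rwa [init_append_pair, init_append_pair, Option.some_inj] at this

end EndSeq

/-! ### Factorisation of intertwiners through irreducible representations -/

section Intertwiners

variable {k : Type u} {G : Type v} {Q₀ : Type w} [Field k] [Group G]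
  [MulAction G Q₀] {M : Type z} [AddCommGroup M] [Module k M]
  {D : OrbitData.{u, v, w, x, y} k G Q₀}

namespace OrbitData

theorem exists_eq_append_of_isReps : {i j l : D.orb} → (s : EndSeq D.orb i j) →
    (t : EndSeq D.orb j l) → {ws : List G} → IsReps (s.append t) ws →
    ∃ ys zs, ws = ys ++ zs ∧ IsReps s ys ∧ IsReps t zs
  | _, _, _, .nil _, t, ws, h => ⟨[], ws, rfl, trivial, h⟩
  | _, _, _, .cons _ s, t, [], h => h.elim
  | _, _, _, .cons _ s, t, y :: ws, h => by
      obtain ⟨ys, zs, rfl, hy, hz⟩ := exists_eq_append_of_isReps s t h.2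
      exact ⟨y :: ys, zs, rfl, ⟨h.1, hy⟩, hz⟩

theorem isReps_pair {i j : D.orb} {ys : List G} (h : IsReps (.pair i j) ys) :
    ∃ y, ys = [y] ∧ y ∈ D.cosets j := by
  match ys, h with
  | [y], h => exact ⟨y, rfl, h.1⟩

end OrbitData

variable [Fintype Q₀]

namespace EquivariantBimodule

open OrbitData Representation

variable (B : EquivariantBimodule k G Q₀ M)

/-- `M(i₀, …, i_n; V)` as an additive group. -/
noncomputable abbrev moduleSpaceAddCommGroup (V : Type*) [AddCommGroup V] [Module k V]
    {i j : D.orb} (s : EndSeq D.orb i j) : AddCommGroup (B.moduleSpace V s) :=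
  Module.addCommMonoidToAddCommGroup k

theorem tensorAct_inv_apply (g : G) (t : TensorAlgebra k M) :
    B.tensorAct g (B.tensorAct g⁻¹ t) = t := by
  rw [← tensorAct_mul_apply, mul_inv_cancel, tensorAct_one, AlgHom.id_apply]

/-- The inclusion `prodSpace_append` suffices to define `⊛`; to cut a tensor into a head and a tail,
equality is required. -/
theorem prodSpace_append_eq : {i j l : D.orb} → (s : EndSeq D.orb i j) → (t : EndSeq D.orb j l) →
    (a : G) → {ys zs : List G} → IsReps s ys →
    B.prodSpace (s.append t) a (ys ++ zs) = B.prodSpace s a ys * B.prodSpace t (a * ys.prod) zs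
  | _, _, _, .nil _, _, _, [], _, _ => by simp [prodSpace, EndSeq.append]
  | _, _, _, .nil _, _, _, _ :: _, _, h => h.elim
  | _, _, _, .cons _ _, _, _, [], _, h => h.elim
  | _, _, _, .cons _ s, t, a, y :: ys, zs, h => by
      simp only [prodSpace, EndSeq.append, List.cons_append, List.prod_cons]
      rw [mul_assoc, ← mul_assoc a, prodSpace_append_eq s t (a * y) h.2]

/-- Translation by `a⁻¹` brings a product space based at `a` back to one based at `1`, without
changing the index, since no remainder has to be moved. -/
theorem prodSpace_le_map {i j : D.orb} (s : EndSeq D.orb i j) (a : G) {ys : List G}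
    (h : IsReps s ys) :
    B.prodSpace s a ys ≤ (B.prodSpace s 1 ys).map (B.tensorAct a).toLinearMap := by
  intro t ht
  have := B.prodSpace_move s a⁻¹ a 1 1 (by simp) h (Submodule.mem_map_of_mem ht)
  rw [(moveReps_one s h).1] at this
  exact ⟨_, this, B.tensorAct_inv_apply a t⟩

variable {V : Type*} [AddCommGroup V] [Module k V] {W : Type*} [AddCommGroup W] [Module k W]
  {i j l : D.orb} {σ : Representation k (Stab j) V} {τ : Representation k (Stab l) W}

/-- The intertwining map `f' ⊛ -` from `M(i₀, …, i_m; V)` to `M(i₀, …, i_{m+n}; W)`. -/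
noncomputable def circMap (s : EndSeq D.orb i j) {t : EndSeq D.orb j l}
    (f' : IntertwiningMap σ (B.moduleRep t τ)) :
    IntertwiningMap (B.moduleRep s σ) (B.moduleRep (s.append t) τ) where
  toLinearMap := (B.ambCirc ((B.moduleSpace W t).subtype ∘ₗ f'.toLinearMap)).restrict
    fun _ hF => B.ambCirc_mem (fun v => (f' v).2) hF
  isIntertwining' g := by
    ext1 F
    apply Subtype.ext
    refine B.ext_moduleSpace
      (A := B.ambCirc ((B.moduleSpace W t).subtype ∘ₗ f'.toLinearMap) ∘ₗ B.ambAct s σ g)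
      (A' := B.ambAct (s.append t) τ g ∘ₗ
        B.ambCirc ((B.moduleSpace W t).subtype ∘ₗ f'.toLinearMap)) ?_ F.2
    intro ys x v hy _
    rw [LinearMap.comp_apply, LinearMap.comp_apply, B.ambAct_single, B.ambCirc_single,
      B.ambCirc_single]
    have := congrArg Subtype.val (f'.isIntertwining _ _ (moveRem s g ys) v)
    rw [B.moduleRep_coe] at this
    refine (congrArg _ this).trans ?_
    exact B.ambMul_ambAct τ g hy _ (f' v).2

section

attribute [local instance] moduleSpaceAddCommGroup

/-- The map is `M(s; M(t; W)) → M(s t; W)`, `m ⊗ y(m' ⊗ z w) ↦ m ⊗ ^y m' ⊗ y z w`. A tensor of the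
target splits as `b c` at the junction, and `c` is a translate `^y c'` because `G` acts invertibly.
-/
theorem circMap_id_surjective (s : EndSeq D.orb i j) (t : EndSeq D.orb j l) :
    Function.Surjective (B.circMap s (IntertwiningMap.id (B.moduleRep t τ))) := by
  have : B.moduleSpace W (s.append t) ≤ (B.moduleSpace (B.moduleSpace W t) s).map
      (B.ambCirc (B.moduleSpace W t).subtype) := by
    rw [← B.span_gens, Submodule.span_le]
    rintro _ ⟨ws, a, v, hw, ha, rfl⟩
    obtain ⟨ys, zs, rfl, hy, hz⟩ := exists_eq_append_of_isReps s t hw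
    rw [B.prodSpace_append_eq s t 1 hy, one_mul] at ha
    induction ha using Submodule.mul_induction_on' with
    | mem_mul_mem b hb c hc =>
      obtain ⟨c, hc', rfl⟩ := B.prodSpace_le_map t _ hz hc
      refine ⟨Finsupp.single ys (b ⊗ₜ[k] ⟨Finsupp.single zs (c ⊗ₜ[k] v),
        B.single_mem hz (B.tmul_mem_layer hc' v)⟩), B.single_mem hy (B.tmul_mem_layer hb _), ?_⟩
      rw [B.ambCirc_single]
      exact B.ambMul_single ys zs b c v
    | add b _ c _ hb hc =>
      rw [TensorProduct.add_tmul, Finsupp.single_add]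
      exact add_mem hb hc
  rintro ⟨F, hF⟩
  obtain ⟨E, hE, h⟩ := this hF
  exact ⟨⟨E, hE⟩, Subtype.ext h⟩

end

variable {V' : Type*} [AddCommGroup V'] [Module k V'] {σ' : Representation k (Stab j) V'}

/-- The map `m₁ ⊗ ⋯ ⊗ m_n ⊗ y₁⋯y_n v ↦ m₁ ⊗ ⋯ ⊗ m_n ⊗ y₁⋯y_n π(v)` on the ambient spaces. -/
noncomputable def ambMap (π : V →ₗ[k] V') : Amb k G M V →ₗ[k] Amb k G M V' :=
  Finsupp.mapRange.linearMap (π.lTensor (TensorAlgebra k M))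

omit [MulAction G Q₀] [Fintype Q₀] [Group G] in
theorem ambMap_single (π : V →ₗ[k] V') (ys : List G) (t : TensorAlgebra k M) (v : V) :
    ambMap π (Finsupp.single ys (t ⊗ₜ[k] v)) = Finsupp.single ys (t ⊗ₜ[k] π v) := by
  simp [ambMap]

theorem ambMap_mem {s : EndSeq D.orb i j} (π : V →ₗ[k] V') {F : Amb k G M V}
    (hF : F ∈ B.moduleSpace V s) : ambMap π F ∈ B.moduleSpace V' s := by
  revert F
  change B.moduleSpace V s ≤ (B.moduleSpace V' s).comap (ambMap π)
  rw [← B.span_gens, Submodule.span_le]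
  rintro _ ⟨zs, b, v, hz, hb, rfl⟩
  rw [SetLike.mem_coe, Submodule.mem_comap, ambMap_single]
  exact B.single_mem hz (B.tmul_mem_layer hb _)

/-- The intertwining map `M(i₀, …, i_n; π)`. -/
noncomputable def moduleMap (s : EndSeq D.orb i j) (π : IntertwiningMap σ σ') :
    IntertwiningMap (B.moduleRep s σ) (B.moduleRep s σ') where
  toLinearMap := (ambMap π.toLinearMap).restrict fun _ hF => B.ambMap_mem _ hF
  isIntertwining' g := by
    ext1 F
    apply Subtype.ext
    refine B.ext_moduleSpace
      (A := ambMap π.toLinearMap ∘ₗ B.ambAct s σ g)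
      (A' := B.ambAct s σ' g ∘ₗ ambMap π.toLinearMap) ?_ F.2
    intro ys x v hy _
    simp only [LinearMap.comp_apply, ambAct_single, ambMap_single]
    rw [π.toLinearMap_apply, π.isIntertwining, π.toLinearMap_apply]

variable (W) in
-- Indices have length one and tensors have degree one, so the space lies in the image of the finite
-- dimensional space of functions `G → M ⊗ W`.
theorem finite_moduleSpace_pair [Finite G] [FiniteDimensional k M]
    [FiniteDimensional k W] : Module.Finite k (B.moduleSpace W (.pair j l)) := by
  have := Fintype.ofFinite G
  let E := (Module.finBasis k (G → M ⊗[k] W)).equivFun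
  let L : (Fin (Module.finrank k (G → M ⊗[k] W)) → k) →ₗ[k] Amb k G M W :=
    (∑ y : G, Finsupp.lsingle [y] ∘ₗ (TensorAlgebra.ι k (M := M)).rTensor W ∘ₗ
      LinearMap.proj y) ∘ₗ E.symm.toLinearMap
  have hL : B.moduleSpace W (.pair j l) ≤ LinearMap.range L := by
    classical
    rw [← B.span_gens, Submodule.span_le]
    rintro _ ⟨ws, a, v, hw, ha, rfl⟩
    obtain ⟨y, rfl, -⟩ := isReps_pair hw
    simp only [EndSeq.pair, prodSpace, mul_one] at ha
    obtain ⟨m, -, rfl⟩ := ha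
    refine ⟨E (Pi.single y (m ⊗ₜ v)), ?_⟩
    simp only [L, LinearMap.comp_apply, LinearEquiv.coe_coe, LinearEquiv.symm_apply_apply,
      LinearMap.sum_apply, LinearMap.proj_apply]
    rw [Finset.sum_eq_single y]
    · simp
    · intro b _ hb
      simp [hb]
    · simp
  let L' : (B.moduleSpace W (.pair j l)).comap L →ₗ[k] B.moduleSpace W (.pair j l) :=
    L.restrict fun _ h => h
  refine Module.Finite.of_surjective L' ?_
  rintro ⟨F, hF⟩
  obtain ⟨x, rfl⟩ := hL hF
  exact ⟨⟨x, hF⟩, rfl⟩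

end EquivariantBimodule

namespace Intertwiner

open OrbitData Representation

variable {B : EquivariantBimodule k G Q₀ M}

/-- `lin` as a linear map. -/
noncomputable def linL {a b : D.Vertex} (s : EndSeq D.orb a.pt b.pt) :
    Intertwiner B a b s →ₗ[k] a.Sp →ₗ[k] Amb k G M b.Sp where
  toFun := lin
  map_add' _ _ := rfl
  map_smul' _ _ := rfl

theorem lin_sum {a b : D.Vertex} {s : EndSeq D.orb a.pt b.pt} {ι : Type*} (S : Finset ι)
    (f : ι → Intertwiner B a b s) : (∑ r ∈ S, f r).lin = ∑ r ∈ S, (f r).lin :=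
  map_sum (linL s) f S

/-- Lift `f` to `f₀ : U → M(s; M(t; W))` and insert the identity `∑ ι_r π_r` of `M(t; W)`: the
factors are `ι_r` and `M(s; π_r) ∘ f₀`. -/
theorem exists_eq_sum_circ [Finite G] (hG : (Nat.card G : k) ≠ 0) {a c : D.Vertex} {j : D.orb}
    (s : EndSeq D.orb a.pt j) (t : EndSeq D.orb j c.pt)
    [Module.Finite k (B.moduleSpace c.Sp t)] (f : Intertwiner B a c (s.append t)) :
    ∃ (n : ℕ) (U : Fin n → D.Irr j) (f₂ : (r : Fin n) → Intertwiner B ⟨j, U r⟩ c t)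
      (f₁ : (r : Fin n) → Intertwiner B a ⟨j, U r⟩ s), f = ∑ r, (f₂ r).circ (f₁ r) := by
  have := neZero_card_stab hG a.pt
  let _ := B.moduleSpaceAddCommGroup c.Sp t
  let _ := fun r => B.moduleSpaceAddCommGroup (D.V j r) s
  obtain ⟨f₀, hf₀⟩ := IntertwiningMap.exists_comp_eq
    (B.circMap s (IntertwiningMap.id (B.moduleRep t c.rep))) (B.circMap_id_surjective s t) f
  obtain ⟨n, U, ι, π, h⟩ := exists_irr_decomposition hG j (B.moduleRep t c.rep)
  refine ⟨n, U, ι, fun r => (B.moduleMap s (π r)).comp f₀, ?_⟩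
  rw [← hf₀]
  apply lin_injective
  rw [lin_sum]
  ext1 u
  -- On a tensor ending in `v`, both sides prolong it by an element of `M(t; W)`, namely `v` and `∑
  -- ι_r (π_r v)` respectively.
  have key : B.ambCirc (B.moduleSpace c.Sp t).subtype =
      ∑ r, B.ambCirc (lin (a := ⟨j, U r⟩) (b := c) (ι r)) ∘ₗ
        EquivariantBimodule.ambMap (π r).toLinearMap := by
    refine amb_ext fun ys x v => ?_
    simp only [LinearMap.sum_apply, LinearMap.comp_apply, EquivariantBimodule.ambMap_single,
      EquivariantBimodule.ambCirc_single, ← map_sum]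
    congr 1
    have := congrArg Subtype.val (h v)
    rw [Submodule.coe_sum] at this
    exact this.symm
  refine (LinearMap.congr_fun key (f₀ u)).trans ?_
  rw [LinearMap.sum_apply, LinearMap.sum_apply]
  rfl

end Intertwiner

end Intertwiners

/-! ### Multiplicativity of the contraction of tensors -/

namespace TensorContraction

variable {k : Type u} {M : Type z} [Field k] [AddCommGroup M] [Module k M]

/-- The contraction matches the first factors on the left with the last factors on the right. As `t`
and `θ` have the same degree `n`, they are used up together and leave `t'` against `θ'`. -/
theorem contract_mul (n : ℕ) {t : TensorAlgebra k M}
    (ht : t ∈ LinearMap.range (TensorAlgebra.ι k (M := M)) ^ n)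
    {θ : TensorAlgebra k (Module.Dual k M)}
    (hθ : θ ∈ LinearMap.range (TensorAlgebra.ι k (M := Module.Dual k M)) ^ n)
    (t' : TensorAlgebra k M) (θ' : TensorAlgebra k (Module.Dual k M)) :
    contract k M (t * t') (θ' * θ) = contract k M t θ * contract k M t' θ' := by
  induction n generalizing t θ t' θ' with
  | zero =>
    rw [pow_zero, Submodule.mem_one] at ht hθ
    obtain ⟨r, rfl⟩ := ht
    obtain ⟨r', rfl⟩ := hθ
    simp only [Algebra.algebraMap_eq_smul_one, smul_mul_assoc, mul_smul_comm, one_mul, mul_one,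
      map_smul, LinearMap.smul_apply, contract_one_one, smul_eq_mul]
    ring
  | succ n ih =>
    rw [pow_succ'] at ht
    rw [pow_succ] at hθ
    induction ht using Submodule.mul_induction_on' with
    | mem_mul_mem a ha b hb =>
      induction hθ using Submodule.mul_induction_on' with
      | mem_mul_mem c hc d hd =>
        obtain ⟨m, rfl⟩ := ha
        obtain ⟨φ, rfl⟩ := hd
        rw [mul_assoc, ← mul_assoc θ', contract_ι_mul, contract_ι_mul, ih hb hc, mul_assoc]
      | add a _ b _ ha hb => simp only [mul_add, add_mul, map_add, ha, hb]
    | add a _ b _ ha hb => simp only [add_mul, map_add, LinearMap.add_apply, ha, hb]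

/-- `t ↦ (θ ⊗ u ↦ (t, θ) u)`. -/
noncomputable def contractTensor (U : Type*) [AddCommGroup U] [Module k U] :
    TensorAlgebra k M →ₗ[k] TensorAlgebra k (Module.Dual k M) ⊗[k] U →ₗ[k] U :=
  (LinearMap.llcomp k _ _ _ (TensorProduct.lid k U).toLinearMap) ∘ₗ LinearMap.rTensorHom U ∘ₗ
    contract k M

theorem contractTensor_tmul {U : Type*} [AddCommGroup U] [Module k U] (t : TensorAlgebra k M)
    (θ : TensorAlgebra k (Module.Dual k M)) (u : U) :
    contractTensor U t (θ ⊗ₜ[k] u) = contract k M t θ • u := by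
  simp [contractTensor]

end TensorContraction

/-! ### Equivariance and multiplicativity of `Φ` -/

section Pairing

variable {k : Type u} {G : Type v} {Q₀ : Type w} [Field k] [Group G]
  [MulAction G Q₀] {M : Type z} [AddCommGroup M] [Module k M]
  {D : OrbitData.{u, v, w, x, y} k G Q₀}

theorem EndSeq.length_rev {X : Type*} : {i j : X} → (s : EndSeq X i j) → s.rev.length = s.length
  | _, _, .nil _ => rfl
  | _, _, .cons i s => by rw [rev, length_append, length_rev s]; rfl

namespace OrbitData

theorem length_eq_of_isReps : {i j : D.orb} → (s : EndSeq D.orb i j) → {ys : List G} →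
    IsReps s ys → ys.length = s.length
  | _, _, .nil _, [], _ => rfl
  | _, _, .nil _, _ :: _, h => h.elim
  | _, _, .cons _ _, [], h => h.elim
  | _, _, .cons _ s, _ :: _, h => congrArg (· + 1) (length_eq_of_isReps s h.2)

theorem coset_mul (j : D.orb) (g : G) (h : Stab j) :
    cosetRep j (g * h) = cosetRep j g ∧ cosetRem j (g * h) = cosetRem j g * h := by
  have := coset_unique j (cosetRep_mem j g) (cosetRem j g * h)
  rwa [Subgroup.coe_mul, ← mul_assoc, cosetRep_mul_cosetRem] at this

theorem moveReps_injective {i j : D.orb} (s : EndSeq D.orb i j) (g : Stab i) {ys zs : List G}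
    (hy : IsReps s ys) (hz : IsReps s zs) (h : moveReps s g ys = moveReps s g zs) : ys = zs := by
  have e := congrArg (moveReps s g⁻¹) h
  rwa [← (moveReps_mul s _ _ hy).1, ← (moveReps_mul s _ _ hz).1, inv_mul_cancel,
    (moveReps_one s hy).1, (moveReps_one s hz).1] at e

theorem isReps_dualReps : {i j : D.orb} → (s : EndSeq D.orb i j) → {ys : List G} → IsReps s ys →
    IsReps s.rev (dualReps s ys).1
  | _, _, .nil _, [], _ => trivial
  | _, _, .nil _, _ :: _, h => h.elim
  | _, _, .cons _ _, [], h => h.elim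
  | _, _, .cons i s, _ :: _, h =>
      isReps_append s.rev _ (isReps_dualReps s h.2) ⟨cosetRep_mem _ _, trivial⟩

/-- Write `y⁻¹ = x h` and `z⁻¹ = x' h'` for the data attached to `ys` and `zs`. Then `(y z)⁻¹ = x'
h' x h`, and pushing `h'` to the right through the sequence `x` is what `moveReps` and `moveRem` do.
-/
theorem dualReps_append : {i j l : D.orb} → (s : EndSeq D.orb i j) → (t : EndSeq D.orb j l) →
    {ys zs : List G} → IsReps s ys → dualReps (s.append t) (ys ++ zs) =
      ((dualReps t zs).1 ++ moveReps s.rev (dualReps t zs).2 (dualReps s ys).1,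
        moveRem s.rev (dualReps t zs).2 (dualReps s ys).1 * (dualReps s ys).2)
  | _, _, _, .nil _, t, [], zs, _ => by simp [EndSeq.append, dualReps, EndSeq.rev, moveReps, moveRem]
  | _, _, _, .nil _, _, _ :: _, _, h => h.elim
  | _, _, _, .cons _ _, _, [], _, h => h.elim
  | _, _, _, .cons (j := j) i s, t, y :: ys, zs, h => by
      have hx := isReps_dualReps s h.2
      simp only [EndSeq.append, List.cons_append, dualReps, EndSeq.rev]
      rw [dualReps_append s t h.2, (moveReps_append _ _ _ _ hx).1, (moveReps_append _ _ _ _ hx).2]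
      simp only [EndSeq.pair, moveReps, moveRem]
      have e := coset_mul i (moveRem s.rev (dualReps t zs).2 (dualReps s ys).1 *
        cosetRep i ((dualReps s ys).2 * y⁻¹)) (cosetRem i ((dualReps s ys).2 * y⁻¹))
      rw [mul_assoc, cosetRep_mul_cosetRem, ← mul_assoc, ← Subgroup.coe_mul] at e
      rw [e.1, e.2, List.append_assoc]

/-- If `g y = y' r` and `y⁻¹ = x h`, then `y'⁻¹ = r x h g⁻¹`, and `r` is pushed to the right through
`x`. -/
theorem dualReps_move : {i j : D.orb} → (s : EndSeq D.orb i j) → (g : Stab i) → {ys : List G} →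
    IsReps s ys → dualReps s (moveReps s g ys) =
      (moveReps s.rev (moveRem s g ys) (dualReps s ys).1,
        moveRem s.rev (moveRem s g ys) (dualReps s ys).1 * (dualReps s ys).2 * g⁻¹)
  | _, _, .nil _, g, [], _ => by simp [dualReps, EndSeq.rev, moveReps, moveRem]
  | _, _, .nil _, _, _ :: _, h => h.elim
  | _, _, .cons _ _, _, [], h => h.elim
  | _, _, .cons (j := j) i s, g, y :: ys, h => by
      have hx := isReps_dualReps s h.2
      simp only [dualReps, moveReps, moveRem, EndSeq.rev]
      rw [dualReps_move s _ h.2, (moveReps_append _ _ _ _ hx).1, (moveReps_append _ _ _ _ hx).2]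
      simp only [EndSeq.pair, moveReps, moveRem]
      set c := moveRem s.rev (moveRem s (cosetRem j (g * y)) ys) (dualReps s ys).1
      have e := coset_mul i (c * cosetRep i ((dualReps s ys).2 * y⁻¹))
        (cosetRem i ((dualReps s ys).2 * y⁻¹) * g⁻¹)
      -- Both sides factor the last element before it is split into representative and remainder;
      -- the remainder of `g y` cancels against its inverse, which leaves `y⁻¹ g⁻¹`.
      have e' : (c : G) * cosetRep i ((dualReps s ys).2 * y⁻¹) *
          ((cosetRem i ((dualReps s ys).2 * y⁻¹) * g⁻¹ : Stab i) : G) =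
          ((c * (dualReps s ys).2 * (cosetRem j (g * y))⁻¹ : Stab j) : G) *
            (cosetRep j (g * y))⁻¹ := by
        push_cast
        rw [mul_assoc, ← mul_assoc (cosetRep i _), cosetRep_mul_cosetRem, mul_assoc _ _ (cosetRep j _)⁻¹,
          ← mul_inv_rev, cosetRep_mul_cosetRem, mul_inv_rev]
        simp only [mul_assoc]
      rw [e'] at e
      rw [e.1, e.2, mul_assoc]

end OrbitData

variable [Fintype Q₀]

namespace EquivariantBimodule

open OrbitData TensorContraction Representation

variable (B : EquivariantBimodule k G Q₀ M)

theorem prodSpace_le_pow : {i j : D.orb} → (s : EndSeq D.orb i j) → (a : G) → (ys : List G) →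
    B.prodSpace s a ys ≤ LinearMap.range (TensorAlgebra.ι k (M := M)) ^ s.length
  | _, _, .nil _, _, _ => le_rfl
  | _, _, .cons _ _, _, [] => bot_le
  | _, _, .cons i s, a, y :: ys => by
      rw [prodSpace, EndSeq.length, pow_succ']
      exact mul_le_mul' LinearMap.map_le_range (prodSpace_le_pow s _ ys)

theorem tensorAct_mem_pow (g : G) (n : ℕ) {t : TensorAlgebra k M}
    (ht : t ∈ LinearMap.range (TensorAlgebra.ι k (M := M)) ^ n) :
    B.tensorAct g t ∈ LinearMap.range (TensorAlgebra.ι k (M := M)) ^ n := by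
  have h := Submodule.mem_map_of_mem (f := (B.tensorAct g).toLinearMap) ht
  rw [Submodule.map_pow] at h
  suffices hle : (LinearMap.range (TensorAlgebra.ι k (M := M))).map (B.tensorAct g).toLinearMap ≤
      LinearMap.range (TensorAlgebra.ι k (M := M)) from pow_le_pow_left' hle n h
  rintro _ ⟨_, ⟨m, rfl⟩, rfl⟩
  exact ⟨B.rho g m, (B.tensorAct_ι g m).symm⟩

/-- Factor by factor this is `(^gφ)(^gm) = φ(m)`. -/
theorem contract_tensorAct (g : G) (n : ℕ) {t : TensorAlgebra k M}
    (ht : t ∈ LinearMap.range (TensorAlgebra.ι k (M := M)) ^ n)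
    {θ : TensorAlgebra k (Module.Dual k M)}
    (hθ : θ ∈ LinearMap.range (TensorAlgebra.ι k (M := Module.Dual k M)) ^ n) :
    contract k M (B.tensorAct g t) (B.dual.tensorAct g θ) = contract k M t θ := by
  induction n generalizing t θ with
  | zero =>
    rw [pow_zero, Submodule.mem_one] at ht hθ
    obtain ⟨r, rfl⟩ := ht
    obtain ⟨r', rfl⟩ := hθ
    rw [AlgHom.commutes, AlgHom.commutes]
  | succ n ih =>
    rw [pow_succ'] at ht
    rw [pow_succ] at hθ
    induction ht using Submodule.mul_induction_on' with
    | mem_mul_mem a ha b hb =>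
      induction hθ using Submodule.mul_induction_on' with
      | mem_mul_mem c hc d hd =>
        obtain ⟨m, rfl⟩ := ha
        obtain ⟨φ, rfl⟩ := hd
        rw [map_mul (B.tensorAct g), map_mul (B.dual.tensorAct g), tensorAct_ι, tensorAct_ι,
          contract_ι_mul, contract_ι_mul, ih hb hc]
        congr 1
        change φ (B.rho g⁻¹ (B.rho g m)) = φ m
        rw [← Module.End.mul_apply, ← map_mul, inv_mul_cancel, map_one, Module.End.one_apply]
      | add a _ b _ ha hb => simp only [map_add, ha, hb]
    | add a _ b _ ha hb => simp only [map_add, LinearMap.add_apply, ha, hb]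

/-- The action of `g` permutes the indices, so the component at the moved index comes from a single
component of `F`. -/
theorem ambAct_apply_moveReps {V : Type*} [AddCommGroup V] [Module k V] {i j : D.orb}
    (s : EndSeq D.orb i j) (σ : Representation k (Stab j) V) (g : Stab i) {F : Amb k G M V}
    (hF : F ∈ B.moduleSpace V s) {xs : List G} (hx : IsReps s xs) :
    B.ambAct s σ g F (moveReps s g xs) =
      TensorProduct.map (B.tensorAct g).toLinearMap (σ (moveRem s g xs)) (F xs) := by
  classical
  refine B.ext_moduleSpace
    (A := Finsupp.lapply (moveReps s g xs) ∘ₗ B.ambAct s σ g)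
    (A' := TensorProduct.map (B.tensorAct g).toLinearMap (σ (moveRem s g xs)) ∘ₗ
      Finsupp.lapply xs) ?_ hF
  intro ys t v hy _
  simp only [LinearMap.comp_apply, ambAct_single, Finsupp.lapply_apply]
  by_cases h : ys = xs
  · subst h
    simp
  · rw [Finsupp.single_eq_of_ne (Ne.symm h), map_zero, Finsupp.single_eq_of_ne]
    exact fun h' => h (moveReps_injective s g hy hx h'.symm)

theorem ambMul_apply_append {V : Type*} [AddCommGroup V] [Module k V] (ys zs : List G)
    (t : TensorAlgebra k M) (F : Amb k G M V) : B.ambMul V ys t F (ys ++ zs) =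
      TensorProduct.map (LinearMap.mulLeft k t ∘ₗ (B.tensorAct ys.prod).toLinearMap) LinearMap.id
        (F zs) := by
  classical
  refine LinearMap.congr_fun (f := Finsupp.lapply (ys ++ zs) ∘ₗ B.ambMul V ys t)
    (g := TensorProduct.map (LinearMap.mulLeft k t ∘ₗ (B.tensorAct ys.prod).toLinearMap)
      LinearMap.id ∘ₗ Finsupp.lapply zs) (amb_ext fun ws a v => ?_) F
  simp only [LinearMap.comp_apply, ambMul_single, Finsupp.lapply_apply]
  by_cases h : ws = zs
  · subst h
    simp
  · rw [Finsupp.single_eq_of_ne (Ne.symm h), map_zero, Finsupp.single_eq_of_ne]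
    simpa using Ne.symm h

/-- Prefixes of equal length can be compared, so a component whose index has another prefix
vanishes. -/
theorem ambMul_apply_append_of_ne {V : Type*} [AddCommGroup V] [Module k V] {ys ys' : List G}
    (zs : List G) (hl : ys.length = ys'.length) (h : ys ≠ ys')
    (t : TensorAlgebra k M) (F : Amb k G M V) : B.ambMul V ys t F (ys' ++ zs) = 0 := by
  classical
  refine LinearMap.congr_fun (f := Finsupp.lapply (ys' ++ zs) ∘ₗ B.ambMul V ys t)
    (g := 0) (amb_ext fun ws a v => ?_) F
  simp only [LinearMap.comp_apply, ambMul_single, Finsupp.lapply_apply, LinearMap.zero_apply]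
  rw [Finsupp.single_eq_of_ne]
  exact fun h' => h (List.append_inj_left h' hl.symm).symm

end EquivariantBimodule

open OrbitData TensorContraction EquivariantBimodule

variable (B : EquivariantBimodule k G Q₀ M) {U V V' W : Type*} [AddCommGroup U] [Module k U]
  [AddCommGroup V] [Module k V] [AddCommGroup V'] [Module k V'] [AddCommGroup W] [Module k W]
  {i j l : D.orb}

theorem evalDual_single_eq (s : EndSeq D.orb i j) (σ : Representation k (Stab i) U)
    (φ : V →ₗ[k] Amb k G (Module.Dual k M) U) (ys : List G) (t : TensorAlgebra k M) (v : V) :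
    evalDual B s σ φ (Finsupp.single ys (t ⊗ₜ[k] v)) = σ (dualReps s ys).2⁻¹
      (contractTensor U (B.tensorAct ys.prod⁻¹ t) (φ v (dualReps s ys).1)) := by
  simp [evalDual, contractTensor]

/-- Invariance of the contraction with coefficients: `A` is any linear map on the coefficient space,
typically the action of a remainder, so one statement covers every change of index. -/
theorem contractTensor_tensorAct (g : G) (A : U →ₗ[k] V) (n : ℕ) {t : TensorAlgebra k M}
    (ht : t ∈ LinearMap.range (TensorAlgebra.ι k (M := M)) ^ n) {s : EndSeq D.orb i j}
    (hs : s.length = n) {xs : List G} {ω : TensorAlgebra k (Module.Dual k M) ⊗[k] U}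
    (hω : ω ∈ B.dual.layer U s xs) :
    contractTensor V (B.tensorAct g t)
      (TensorProduct.map (B.dual.tensorAct g).toLinearMap A ω) = A (contractTensor U t ω) := by
  have : B.dual.layer U s xs ≤ LinearMap.eqLocus
      (contractTensor V (B.tensorAct g t) ∘ₗ
        TensorProduct.map (B.dual.tensorAct g).toLinearMap A) (A ∘ₗ contractTensor U t) := by
    refine Submodule.map₂_le.2 fun θ hθ u _ => ?_
    have hθ' := B.dual.prodSpace_le_pow s 1 xs hθ
    rw [hs] at hθ'
    simp only [LinearMap.mem_eqLocus, LinearMap.comp_apply, TensorProduct.mk_apply,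
      TensorProduct.map_tmul, contractTensor_tmul, AlgHom.toLinearMap_apply, map_smul,
      B.contract_tensorAct g n ht hθ']
  exact this hω

/-- `Φ(φ)` is equivariant. -/
theorem evalDual_ambAct (s : EndSeq D.orb i j) (σ : Representation k (Stab i) U)
    (τ : Representation k (Stab j) V) (φ : V →ₗ[k] Amb k G (Module.Dual k M) U)
    (hφ : ∀ v, φ v ∈ B.dual.moduleSpace U s.rev)
    (hφ' : ∀ g v, φ (τ g v) = B.dual.ambAct s.rev σ g (φ v)) (g : Stab i) {F : Amb k G M V}
    (hF : F ∈ B.moduleSpace V s) :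
    evalDual B s σ φ (B.ambAct s τ g F) = σ g (evalDual B s σ φ F) := by
  refine B.ext_moduleSpace (A := evalDual B s σ φ ∘ₗ B.ambAct s τ g)
    (A' := σ g ∘ₗ evalDual B s σ φ) ?_ hF
  intro ys t v hy ht
  have hx := isReps_dualReps s hy
  simp only [LinearMap.comp_apply, ambAct_single, evalDual_single_eq]
  rw [dualReps_move s g hy, hφ', B.dual.ambAct_apply_moveReps s.rev σ _ (hφ v) hx,
    ← tensorAct_mul_apply]
  -- With `g y = y' r`, the tensor is moved by `y'⁻¹ g = r y⁻¹`. Since `φ(r v)` is `φ(v)` moved by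
  -- `r`, the element `r` drops out of the contraction, and on `U` the remainders combine to `g
  -- h₀⁻¹`.
  have e : (moveReps s g ys).prod⁻¹ * (g : G) = moveRem s g ys * ys.prod⁻¹ := by
    rw [inv_mul_eq_iff_eq_mul, ← mul_assoc, ← mul_prod_eq s g hy, mul_inv_cancel_right]
  rw [e, tensorAct_mul_apply, contractTensor_tensorAct B _ _ s.length
    (B.tensorAct_mem_pow _ _ (B.prodSpace_le_pow s _ _ ht)) s.length_rev
    (((hφ v) _).1 hx), ← Module.End.mul_apply, ← Module.End.mul_apply, ← map_mul, ← map_mul]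
  congr 2
  group

/-- `Φ(φ ⊛ φ') (f' ⊛ F) = Φ(φ) ((Φ(φ') ∘ f') F)`. -/
theorem evalDual_ambCirc (s : EndSeq D.orb i j) (t : EndSeq D.orb j l)
    (σ : Representation k (Stab i) U) (τ : Representation k (Stab j) V')
    (φ : V' →ₗ[k] Amb k G (Module.Dual k M) U)
    (hφ : ∀ v, φ v ∈ B.dual.moduleSpace U s.rev)
    (hφ' : ∀ g v, φ (τ g v) = B.dual.ambAct s.rev σ g (φ v))
    (ψ : W →ₗ[k] Amb k G (Module.Dual k M) V') (hψ : ∀ w, ψ w ∈ B.dual.moduleSpace V' t.rev)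
    (f : V →ₗ[k] Amb k G M W) (hf : ∀ v, f v ∈ B.moduleSpace W t) {F : Amb k G M V}
    (hF : F ∈ B.moduleSpace V s) :
    evalDual B (s.append t) σ (B.dual.ambCirc φ ∘ₗ ψ) (B.ambCirc f F) =
      evalDual B s σ φ (ambMap (evalDual B t τ ψ ∘ₗ f) F) := by
  refine B.ext_moduleSpace
    (A := evalDual B (s.append t) σ (B.dual.ambCirc φ ∘ₗ ψ) ∘ₗ B.ambCirc f)
    (A' := evalDual B s σ φ ∘ₗ ambMap (evalDual B t τ ψ ∘ₗ f)) ?_ hF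
  intro ys x v hy hx
  have hxs := isReps_dualReps s hy
  simp only [LinearMap.comp_apply, ambCirc_single, ambMap_single]
  -- The tensor `x` at index `ys` is now fixed, and linearity in `f v` reduces the claim to
  -- homogeneous tensors of `M(t; W)`.
  refine B.ext_moduleSpace
    (A := evalDual B (s.append t) σ (B.dual.ambCirc φ ∘ₗ ψ) ∘ₗ B.ambMul W ys x)
    (A' := evalDual B s σ φ ∘ₗ Finsupp.lsingle ys ∘ₗ TensorProduct.mk k _ _ x ∘ₗ
      evalDual B t τ ψ) ?_ (hf v)
  intro zs x' w hz hx'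
  have hzs := isReps_dualReps t hz
  simp only [LinearMap.comp_apply, ambMul_single, Finsupp.lsingle_apply, TensorProduct.mk_apply,
    evalDual_single_eq]
  rw [dualReps_append s t hy]
  set p := dualReps s ys
  set p' := dualReps t zs with hp'
  -- Both sides are linear in `ψ w` as well, so that it may also be taken to be a homogeneous
  -- tensor.
  refine B.dual.ext_moduleSpace
    (A := σ (moveRem s.rev p'.2 p.1 * p.2)⁻¹ ∘ₗ
      contractTensor U (B.tensorAct (ys ++ zs).prod⁻¹ (x * B.tensorAct ys.prod x')) ∘ₗ
      Finsupp.lapply (p'.1 ++ moveReps s.rev p'.2 p.1) ∘ₗ B.dual.ambCirc φ)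
    (A' := σ p.2⁻¹ ∘ₗ contractTensor U (B.tensorAct ys.prod⁻¹ x) ∘ₗ Finsupp.lapply p.1 ∘ₗ φ ∘ₗ
      τ p'.2⁻¹ ∘ₗ contractTensor V' (B.tensorAct zs.prod⁻¹ x') ∘ₗ Finsupp.lapply p'.1) ?_ (hψ w)
  intro xs θ v' hxs' hθ
  simp only [LinearMap.comp_apply, Finsupp.lapply_apply, ambCirc_single]
  -- Only the component of `ψ w` whose index is dual to `zs` contributes to either side.
  by_cases h : xs = p'.1
  · subst h
    -- The index involves the move by `p'.2`. Writing `v'` as `τ p'.2` of a vector brings in the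
    -- equivariance of `φ`, which relates this index to `p.1`.
    obtain ⟨v', rfl⟩ : ∃ v'', v' = τ p'.2 v'' := ⟨τ p'.2⁻¹ v', by
      rw [← Module.End.mul_apply, ← map_mul, mul_inv_cancel, map_one, Module.End.one_apply]⟩
    rw [ambMul_apply_append, hφ', B.dual.ambAct_apply_moveReps s.rev σ _ (hφ v') hxs,
      Finsupp.single_eq_same, contractTensor_tmul, map_smul, ← Module.End.mul_apply (τ _),
      ← map_mul, inv_mul_cancel, map_one, Module.End.one_apply]
    -- On tensors `θ' ⊗ u` the contraction splits by `contract_mul`; the part along `s` loses the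
    -- common translation, and the remainder `moveRem` cancels on `U`.
    have key : B.dual.layer U s.rev p.1 ≤ LinearMap.eqLocus
        (σ (moveRem s.rev p'.2 p.1 * p.2)⁻¹ ∘ₗ
          contractTensor U (B.tensorAct (ys ++ zs).prod⁻¹ (x * B.tensorAct ys.prod x')) ∘ₗ
          TensorProduct.map (LinearMap.mulLeft k θ ∘ₗ (B.dual.tensorAct p'.1.prod).toLinearMap)
            LinearMap.id ∘ₗ TensorProduct.map (B.dual.tensorAct p'.2).toLinearMap
              (σ (moveRem s.rev p'.2 p.1)))
        (contract k M (B.tensorAct zs.prod⁻¹ x') θ •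
          (σ p.2⁻¹ ∘ₗ contractTensor U (B.tensorAct ys.prod⁻¹ x))) := by
      refine Submodule.map₂_le.2 fun θ' hθ' u _ => ?_
      have hθ'' := B.dual.prodSpace_le_pow _ _ _ hθ'
      rw [s.length_rev] at hθ''
      have hx'' := B.tensorAct_mem_pow ys.prod⁻¹ _ (B.prodSpace_le_pow _ _ _ hx)
      simp only [LinearMap.mem_eqLocus, LinearMap.comp_apply, TensorProduct.mk_apply,
        TensorProduct.map_tmul, contractTensor_tmul, AlgHom.toLinearMap_apply, LinearMap.id_apply,
        LinearMap.mulLeft_apply, LinearMap.smul_apply, List.prod_append, mul_inv_rev]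
      rw [← tensorAct_mul_apply, ← prod_inv_eq t hz, map_mul (B.tensorAct _), ← tensorAct_mul_apply,
        inv_mul_cancel_right, tensorAct_mul_apply, contract_mul s.length
          (B.tensorAct_mem_pow _ _ hx'') (B.dual.tensorAct_mem_pow _ _ hθ''),
        B.contract_tensorAct _ s.length hx'' hθ'', map_smul, map_smul, map_mul,
        Module.End.mul_apply, ← Module.End.mul_apply (σ (moveRem _ _ _)⁻¹), ← map_mul,
        inv_mul_cancel, map_one, Module.End.one_apply, smul_smul, mul_comm]
    have := key (((hφ v') _).1 hxs)
    simp only [LinearMap.mem_eqLocus, LinearMap.comp_apply, LinearMap.smul_apply] at this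
    rw [this, map_smul, Finsupp.smul_apply, map_smul, map_smul]
  · rw [ambMul_apply_append_of_ne _ _ _ h, Finsupp.single_eq_of_ne (Ne.symm h)]
    · simp
    · rw [length_eq_of_isReps _ hxs', length_eq_of_isReps _ hzs]

end Pairing

/-! ### Transposes of intertwining maps `M(i, j; V) → U` -/

section Pairing

variable {k : Type u} {G : Type v} {Q₀ : Type w} [Field k] [Group G] [Fintype Q₀]
  [MulAction G Q₀] {M : Type z} [AddCommGroup M] [Module k M]
  {D : OrbitData.{u, v, w, x, y} k G Q₀}

open OrbitData TensorContraction Representation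

namespace EquivariantBimodule

variable (B : EquivariantBimodule k G Q₀ M) {U V : Type*} [AddCommGroup U] [Module k U]
  [AddCommGroup V] [Module k V] {i j : D.orb}

theorem rho_proj_apply (g : G) (p q : Q₀) (m : M) :
    B.rho g (B.proj p q m) = B.proj (g • p) (g • q) (B.rho g m) :=
  LinearMap.congr_fun (B.rho_proj g p q) m

theorem proj_proj (p q : Q₀) (m : M) : B.proj p q (B.proj p q m) = B.proj p q m :=
  LinearMap.congr_fun (B.proj_comp_self p q) m

theorem eq_of_apply_eq {s : EndSeq D.orb i j} {F F' : Amb k G M V} (hF : F ∈ B.moduleSpace V s)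
    (hF' : F' ∈ B.moduleSpace V s) (h : ∀ ys, IsReps s ys → F ys = F' ys) : F = F' := by
  ext1 ys
  by_cases hy : IsReps s ys
  · exact h ys hy
  · rw [(hF ys).2 hy, (hF' ys).2 hy]

omit [Fintype Q₀] in
theorem isReps_singleton {y : G} (hy : y ∈ D.cosets j) : IsReps (.pair i j) [y] :=
  ⟨hy, trivial⟩

/-- In degree one the contraction is evaluation under `M^* ⊗ U → Hom(M, U)`, so components of
elements of `M^*(j, i; U)` can be treated as linear maps `M → U`. -/
theorem contractTensor_ι (m : M) (ω : Module.Dual k M ⊗[k] U) :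
    contractTensor U (TensorAlgebra.ι k m)
      ((TensorAlgebra.ι k (M := Module.Dual k M)).rTensor U ω) = dualTensorHom k M U ω m := by
  induction ω with
  | zero => simp
  | add a b ha hb => simp [ha, hb]
  | tmul φ u =>
    rw [LinearMap.rTensor_tmul, contractTensor_tmul, dualTensorHom_apply]
    have := contract_ι_mul m 1 φ 1
    rw [mul_one, one_mul, contract_one_one, mul_one] at this
    rw [this]

/-- The component of index `x` is `_jM^*_{xi} ⊗ U`; its elements are linear maps `M → U` that only
see the summand `_{xi}M_j`. Finite dimension of `M` enters only in the converse,
`rTensor_ι_mem_dual_layer_pair`. -/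
theorem exists_of_mem_dual_layer_pair {x : G} {ω : TensorAlgebra k (Module.Dual k M) ⊗[k] U}
    (hω : ω ∈ B.dual.layer U (.pair j i) [x]) :
    ∃ ω' : Module.Dual k M ⊗[k] U,
      ω = (TensorAlgebra.ι k (M := Module.Dual k M)).rTensor U ω' ∧
      dualTensorHom k M U ω' ∘ₗ B.proj (x • (i : Q₀)) j = dualTensorHom k M U ω' := by
  have : B.dual.layer U (.pair j i) [x] ≤
      (LinearMap.eqLocus ((LinearMap.lcomp k U (B.proj (x • (i : Q₀)) j)) ∘ₗ dualTensorHom k M U)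
        (dualTensorHom k M U)).map ((TensorAlgebra.ι k (M := Module.Dual k M)).rTensor U) := by
    refine Submodule.map₂_le.2 fun θ hθ u _ => ?_
    simp only [EndSeq.pair, prodSpace, mul_one, one_smul, one_mul] at hθ
    obtain ⟨_, ⟨φ, rfl⟩, rfl⟩ := hθ
    refine ⟨B.dual.proj j (x • (i : Q₀)) φ ⊗ₜ u, ?_, rfl⟩
    ext m
    change φ (B.proj _ _ (B.proj _ _ m)) • u = φ (B.proj _ _ m) • u
    rw [B.proj_proj]
  obtain ⟨ω', h, rfl⟩ := this hω
  exact ⟨ω', rfl, h⟩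

variable [FiniteDimensional k M]

theorem rTensor_ι_mem_dual_layer_pair {x : G} {L : M →ₗ[k] U}
    (hL : L ∘ₗ B.proj (x • (i : Q₀)) j = L) :
    (TensorAlgebra.ι k (M := Module.Dual k M)).rTensor U
      ((dualTensorHomEquiv (R := k) (M := M) (N := U)).symm L) ∈
        B.dual.layer U (.pair j i) [x] := by
  obtain ⟨ω, rfl⟩ := (dualTensorHomEquiv (R := k) (M := M) (N := U)).surjective L
  rw [LinearEquiv.symm_apply_apply]
  -- The dual projection corresponds to precomposition with the projection of `M`, which fixes `L`.
  have e : (B.dual.proj j (x • (i : Q₀))).rTensor U ω = ω := by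
    apply (dualTensorHomEquiv (R := k) (M := M) (N := U)).injective
    rw [← hL]
    clear hL
    induction ω with
    | zero => simp
    | add a b ha hb => simp only [map_add, ha, hb, LinearMap.add_comp]
    | tmul φ u => rfl
  rw [← e]
  clear hL e
  induction ω with
  | zero => simp
  | add a b ha hb =>
    rw [map_add, map_add]
    exact add_mem ha hb
  | tmul φ u =>
    refine B.dual.tmul_mem_layer ?_ u
    simp only [EndSeq.pair, prodSpace, mul_one, one_smul, one_mul]
    exact ⟨_, ⟨φ, rfl⟩, rfl⟩

variable (τ : Representation k (Stab j) V)

omit [FiniteDimensional k M] in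
theorem single_proj_mem (g : G) (m : M) (v : V) :
    Finsupp.single [cosetRep j g] (TensorAlgebra.ι k (B.proj i (g • (j : Q₀)) m) ⊗ₜ[k] v) ∈
      B.moduleSpace V (.pair i j) := by
  refine B.single_mem (isReps_singleton (cosetRep_mem j g)) (B.tmul_mem_layer ?_ _)
  simp only [EndSeq.pair, prodSpace, mul_one, one_smul, one_mul]
  refine ⟨_, ⟨m, ?_⟩, rfl⟩
  have e : g • (j : Q₀) = cosetRep j g • (j : Q₀) := by
    conv_lhs => rw [← cosetRep_mul_cosetRem j g]
    rw [mul_smul, (cosetRem j g).2]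
  rw [e]

/-- The element `m' ⊗ g v` of `M(i, j; V)`, where `m'` is the component of `m` in `_iM_{g j}`. -/
noncomputable def pairElt (i : D.orb) (g : G) :
    M →ₗ[k] V →ₗ[k] B.moduleSpace V (.pair i j) :=
  LinearMap.mk₂ k (fun m v => ⟨_, B.single_proj_mem g m (τ (cosetRem j g) v)⟩)
    (fun m m' v => Subtype.ext (by simp [TensorProduct.add_tmul]))
    (fun c m v => Subtype.ext (by simp [TensorProduct.smul_tmul']))
    (fun m v v' => Subtype.ext (by simp [TensorProduct.tmul_add]))
    (fun c m v => Subtype.ext (by simp))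

omit [FiniteDimensional k M] in
theorem pairElt_coe (g : G) (m : M) (v : V) : (B.pairElt τ i g m v : Amb k G M V) =
    Finsupp.single [cosetRep j g]
      (TensorAlgebra.ι k (B.proj i (g • (j : Q₀)) m) ⊗ₜ[k] τ (cosetRem j g) v) := rfl

omit [FiniteDimensional k M] in
-- With arbitrary `g` in place of coset representatives, the action reads `h(m ⊗ g v) = ^hm ⊗ (h g)
-- v`, and no remainder appears.
theorem moduleRep_pairElt (h : Stab i) (g : G) (m : M) (v : V) :
    B.moduleRep (.pair i j) τ h (B.pairElt τ i g m v) =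
      B.pairElt τ i (h * g) (B.rho h m) v := by
  apply Subtype.ext
  rw [moduleRep_coe, pairElt_coe, pairElt_coe, ambAct_single]
  have e := coset_mul j (h * cosetRep j g) (cosetRem j g)
  rw [mul_assoc, cosetRep_mul_cosetRem] at e
  simp only [EndSeq.pair, moveReps, moveRem, tensorAct_ι, rho_proj_apply]
  rw [e.1, e.2, map_mul, mul_smul, h.2]
  rfl

omit [FiniteDimensional k M] in
-- The balancing relation `m ⊗ (g h) v = m ⊗ g (h v)`; together with `moduleRep_pairElt` it replaces
-- most manipulations of representatives.
theorem pairElt_mul (g : G) (h : Stab j) (m : M) (v : V) :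
    B.pairElt τ i (g * h) m v = B.pairElt τ i g m (τ h v) := by
  apply Subtype.ext
  rw [pairElt_coe, pairElt_coe, (coset_mul j g h).1, (coset_mul j g h).2, map_mul, mul_smul, h.2]
  rfl

omit [FiniteDimensional k M] in
theorem pairElt_of_mem {y : G} (hy : y ∈ D.cosets j) (m : M) (v : V) :
    (B.pairElt τ i y (B.proj i (y • (j : Q₀)) m) v : Amb k G M V) =
      Finsupp.single [y] (TensorAlgebra.ι k (B.proj i (y • (j : Q₀)) m) ⊗ₜ[k] v) := by
  have e := coset_unique j hy 1
  rw [OneMemClass.coe_one, mul_one] at e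
  rw [pairElt_coe, e.1, e.2, B.proj_proj, map_one]
  rfl

variable {τ} {σ : Representation k (Stab i) U}
  (p : IntertwiningMap (B.moduleRep (.pair i j) τ) σ)

/-- Auxiliary to `transpose`: `v ↦ (m ↦ p(x⁻¹ (m ⊗ v)))`. -/
noncomputable def transposeAux (x : G) : V →ₗ[k] M →ₗ[k] U :=
  ((B.pairElt τ i x⁻¹).compr₂ p.toLinearMap ∘ₗ B.rho x⁻¹).flip

omit [FiniteDimensional k M] in
theorem transposeAux_apply (x : G) (v : V) (m : M) :
    B.transposeAux p x v m = p (B.pairElt τ i x⁻¹ (B.rho x⁻¹ m) v) := rfl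

omit [FiniteDimensional k M] in
theorem transposeAux_comp_proj (x : G) (v : V) :
    B.transposeAux p x v ∘ₗ B.proj (x • (i : Q₀)) j = B.transposeAux p x v := by
  ext m
  rw [LinearMap.comp_apply, transposeAux_apply, transposeAux_apply]
  congr 1
  apply Subtype.ext
  rw [pairElt_coe, pairElt_coe, rho_proj_apply, inv_smul_smul, B.proj_proj]

variable [Finite G]

/-- The linear map `V → M^*(j, i; U)` attached to an intertwining map `M(i, j; V) → U`. -/
noncomputable def transpose : V →ₗ[k] Amb k G (Module.Dual k M) U :=
  letI := Fintype.ofFinite (D.cosets i)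
  ∑ x : D.cosets i, Finsupp.lsingle [(x : G)] ∘ₗ
    (TensorAlgebra.ι k (M := Module.Dual k M)).rTensor U ∘ₗ
      (dualTensorHomEquiv (R := k) (M := M) (N := U)).symm.toLinearMap ∘ₗ B.transposeAux p x

theorem transpose_apply (v : V) {x : G} (hx : x ∈ D.cosets i) :
    B.transpose p v [x] = (TensorAlgebra.ι k (M := Module.Dual k M)).rTensor U
      ((dualTensorHomEquiv (R := k) (M := M) (N := U)).symm (B.transposeAux p x v)) := by
  classical
  let _ := Fintype.ofFinite (D.cosets i)
  rw [transpose, LinearMap.sum_apply, Finsupp.finsetSum_apply, Finset.sum_eq_single ⟨x, hx⟩]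
  · simp
  · rintro ⟨b, hb⟩ _ h
    rw [LinearMap.comp_apply, Finsupp.lsingle_apply, Finsupp.single_eq_of_ne]
    intro h'
    exact h (Subtype.ext (List.singleton_inj.1 h').symm)
  · intro h
    exact (h (Finset.mem_univ _)).elim

theorem transpose_mem (v : V) : B.transpose p v ∈ B.dual.moduleSpace U (.pair j i) := by
  rw [transpose, LinearMap.sum_apply]
  refine Submodule.sum_mem _ fun x _ => ?_
  exact B.dual.single_mem (isReps_singleton x.2)
    (B.rTensor_ι_mem_dual_layer_pair (B.transposeAux_comp_proj p x v))

/-- Let `g x = x' r` with `x'` a representative and `r` in `G_i`. Then `x'⁻¹ g = r x⁻¹`, so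
`p(x'⁻¹(m ⊗ g v)) = r p(x⁻¹(^{g⁻¹}m ⊗ v))` because `p` commutes with `r`. This compares the
components at `x'` and at `x`. -/
theorem transpose_rep (g : Stab j) (v : V) :
    B.transpose p (τ g v) = B.dual.ambAct (.pair j i) σ g (B.transpose p v) := by
  refine B.dual.eq_of_apply_eq (B.transpose_mem p _)
    (B.dual.ambAct_mem _ _ _ (B.transpose_mem p v)) fun ys hy => ?_
  obtain ⟨xs, hx, rfl⟩ : ∃ xs, IsReps (.pair j i) xs ∧ ys = moveReps (.pair j i) g xs :=
    ⟨_, moveReps_isReps _ g⁻¹ hy, by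
      rw [← (moveReps_mul _ _ _ hy).1, mul_inv_cancel, (moveReps_one _ hy).1]⟩
  rw [B.dual.ambAct_apply_moveReps _ _ _ (B.transpose_mem p v) hx]
  obtain ⟨x, rfl, hx'⟩ := isReps_pair hx
  simp only [EndSeq.pair, moveReps, moveRem]
  rw [B.transpose_apply p _ (cosetRep_mem i _), B.transpose_apply p _ hx']
  have key : B.transposeAux p (cosetRep i (g * x)) (τ g v) =
      σ (cosetRem i (g * x)) ∘ₗ B.transposeAux p x v ∘ₗ B.rho (g : G)⁻¹ := by
    have e : (cosetRem i (g * x) : G) * x⁻¹ = (cosetRep i (g * x))⁻¹ * g := by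
      rw [eq_inv_mul_iff_mul_eq, ← mul_assoc, cosetRep_mul_cosetRem, mul_inv_cancel_right]
    ext m
    rw [LinearMap.comp_apply, LinearMap.comp_apply, transposeAux_apply, transposeAux_apply,
      ← p.isIntertwining, moduleRep_pairElt, e, ← Module.End.mul_apply, ← Module.End.mul_apply,
      ← map_mul, ← map_mul, e, pairElt_mul, mul_inv_cancel_right]
  -- In terms of linear maps `M → U`, the action on `M^* ⊗ U` is `L ↦ r ∘ L ∘ g⁻¹`.
  have nat : ∀ ω : Module.Dual k M ⊗[k] U,
      TensorProduct.map (B.dual.tensorAct g).toLinearMap (σ (cosetRem i (g * x)))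
        ((TensorAlgebra.ι k (M := Module.Dual k M)).rTensor U ω) =
      (TensorAlgebra.ι k (M := Module.Dual k M)).rTensor U
        ((dualTensorHomEquiv (R := k) (M := M) (N := U)).symm
          (σ (cosetRem i (g * x)) ∘ₗ dualTensorHom k M U ω ∘ₗ B.rho (g : G)⁻¹)) := by
    intro ω
    induction ω with
    | zero => simp
    | add a b ha hb =>
      simp only [map_add, ha, hb, LinearMap.add_comp, LinearMap.comp_add]
    | tmul φ u =>
      rw [LinearMap.rTensor_tmul, TensorProduct.map_tmul, AlgHom.toLinearMap_apply, tensorAct_ι]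
      rw [← LinearMap.rTensor_tmul]
      congr 1
      rw [LinearEquiv.eq_symm_apply]
      ext m
      simp [dual, Module.Dual.transpose_apply]
  have h1 : dualTensorHom k M U ((dualTensorHomEquiv (R := k) (M := M) (N := U)).symm
      (B.transposeAux p x v)) = B.transposeAux p x v :=
    (dualTensorHomEquiv (R := k) (M := M) (N := U)).apply_symm_apply _
  rw [key, nat, h1]

/-- For a representative `y` with `y⁻¹ = x h₀`, the value on `m ⊗ y v` is `h₀⁻¹ p(x⁻¹(^{y⁻¹}m ⊗
v))`, which is `p(m ⊗ y v)` since `h₀⁻¹ x⁻¹ = y`. Thus every intertwining map to `U` is some `Φ(φ)`.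
-/
theorem evalDual_transpose (F : B.moduleSpace V (.pair i j)) :
    evalDual B (.pair i j) σ (B.transpose p) F = p F := by
  let E : B.moduleSpace V (.pair i j) →ₗ[k] U :=
    evalDual B (.pair i j) σ (B.transpose p) ∘ₗ (B.moduleSpace V (.pair i j)).subtype
  -- `p` is only defined on the submodule, so its equality locus is pushed to the ambient space,
  -- where the generators live.
  have key : B.moduleSpace V (.pair i j) ≤
      (LinearMap.eqLocus E p.toLinearMap).map (B.moduleSpace V (.pair i j)).subtype := by
    conv_lhs => rw [← B.span_gens]
    rw [Submodule.span_le]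
    rintro _ ⟨ys, t, v, hy, ht, rfl⟩
    obtain ⟨y, rfl, hy'⟩ := isReps_pair hy
    simp only [EndSeq.pair, prodSpace, mul_one, one_smul, one_mul] at ht
    obtain ⟨_, ⟨m, rfl⟩, rfl⟩ := ht
    refine ⟨B.pairElt τ i y (B.proj i (y • (j : Q₀)) m) v, ?_, B.pairElt_of_mem τ hy' m v⟩
    change evalDual B (.pair i j) σ (B.transpose p)
      (B.pairElt τ i y (B.proj i (y • (j : Q₀)) m) v : Amb k G M V) = p _
    rw [B.pairElt_of_mem τ hy' m v, evalDual_single_eq]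
    simp only [EndSeq.pair, dualReps, List.nil_append, List.prod_cons, List.prod_nil, mul_one,
      OneMemClass.coe_one, one_mul]
    rw [B.transpose_apply p _ (cosetRep_mem i _), tensorAct_ι, contractTensor_ι]
    have h1 : dualTensorHom k M U ((dualTensorHomEquiv (R := k) (M := M) (N := U)).symm
        (B.transposeAux p (cosetRep i y⁻¹) v)) = B.transposeAux p (cosetRep i y⁻¹) v :=
      (dualTensorHomEquiv (R := k) (M := M) (N := U)).apply_symm_apply _
    have e : ((cosetRem i y⁻¹)⁻¹ : G) * (cosetRep i y⁻¹)⁻¹ = y := by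
      rw [← mul_inv_rev, cosetRep_mul_cosetRem, inv_inv]
    rw [h1, transposeAux_apply, ← p.isIntertwining, moduleRep_pairElt, Subgroup.coe_inv, e,
      ← Module.End.mul_apply, ← Module.End.mul_apply, ← map_mul, ← map_mul, e,
      mul_inv_cancel, map_one, Module.End.one_apply]
    rfl
  obtain ⟨F', h, e⟩ := key F.2
  obtain rfl : F' = F := Subtype.ext e
  exact h

end EquivariantBimodule

end Pairing

/-- The coordinate map `Q : y ↦ (P (b j) y)_j` is injective by nondegeneracy in `y`. It is
surjective because a linear form killing its range gives a linear combination of the `b j` in the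
left kernel, hence is zero. The dual vector is the preimage of a standard basis vector. -/
theorem Module.Basis.existsUnique_dual {k X Y ι : Type*} [Field k] [AddCommMonoid X] [Module k X]
    [AddCommMonoid Y] [Module k Y] [Finite ι] (b : Module.Basis ι k X) (P : X →ₗ[k] Y →ₗ[k] k)
    (h₁ : ∀ x, (∀ y, P x y = 0) → x = 0) (h₂ : ∀ y, (∀ x, P x y = 0) → y = 0) (i : ι) :
    ∃! y, ∀ j, (j = i → P (b j) y = 1) ∧ (j ≠ i → P (b j) y = 0) := by
  classical
  have := Fintype.ofFinite ι
  -- Negatives are supplied by the scalar `-1`.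
  let _ : AddCommGroup X := Module.addCommMonoidToAddCommGroup k
  let _ : AddCommGroup Y := Module.addCommMonoidToAddCommGroup k
  let Q : Y →ₗ[k] ι → k := LinearMap.pi fun j => P (b j)
  have hinj : Function.Injective Q := by
    rw [injective_iff_map_eq_zero]
    intro y hy
    refine h₂ y fun x => ?_
    have : P.flip y = 0 := b.ext fun j => congrFun hy j
    exact LinearMap.congr_fun this x
  have hsurj : Function.Surjective Q := by
    rw [← LinearMap.range_eq_top]
    by_contra h
    obtain ⟨c, hc, hc'⟩ := Submodule.exists_le_ker_of_lt_top _ (lt_top_iff_ne_top.2 h)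
    apply hc
    have h0 : ∑ j, c (Pi.single j 1) • b j = 0 := by
      refine h₁ _ fun y => ?_
      have : c (Q y) = 0 := hc' ⟨y, rfl⟩
      rw [← Finset.univ_sum_single (Q y), map_sum] at this
      rw [map_sum, LinearMap.sum_apply, ← this]
      refine Finset.sum_congr rfl fun j _ => ?_
      have e : Pi.single j (Q y j) = (Q y j) • (Pi.single j 1 : ι → k) := by
        rw [← Pi.single_smul, smul_eq_mul, mul_one]
      rw [e, map_smul, map_smul, LinearMap.smul_apply, smul_eq_mul, smul_eq_mul, mul_comm]
      rfl
    have h1 := Fintype.linearIndependent_iff.1 b.linearIndependent _ h0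
    refine LinearMap.pi_ext' fun j => ?_
    ext
    simpa using h1 j
  obtain ⟨y, hy⟩ := hsurj (Pi.single i 1)
  refine ⟨y, fun j => ⟨?_, fun h => ?_⟩, fun y' h => hinj ?_⟩
  · rintro rfl
    exact (congrFun hy j).trans (by simp)
  · exact (congrFun hy j).trans (by simp [h])
  · rw [hy]
    ext j
    by_cases hj : j = i
    · subst hj
      exact ((h j).1 rfl).trans (by simp)
    · exact ((h j).2 hj).trans (by simp [hj])

/-! ### Nondegeneracy in length one and the dual family -/

section Pairing

variable {k : Type u} {G : Type v} {Q₀ : Type w} [Field k] [Group G] [Fintype Q₀]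
  [MulAction G Q₀] {M : Type z} [AddCommGroup M] [Module k M]
  {D : OrbitData.{u, v, w, x, y} k G Q₀}

open OrbitData TensorContraction Representation EquivariantBimodule

theorem Representation.eq_zero_of_apply_eq_zero {H V : Type*} [Group H] [AddCommGroup V]
    [Module k V] (σ : Representation k H V) (h : H) {v : V} (hv : σ h v = 0) : v = 0 := by
  have := congrArg (σ h⁻¹) hv
  rwa [← Module.End.mul_apply, ← map_mul, inv_mul_cancel, map_one, Module.End.one_apply,
    map_zero] at this

/-- The component of `φ v` at `x`, as a linear map `M → U`, is recovered from `Φ(φ)`: its value at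
`m` is, up to an invertible operator on `U`, the value of `Φ(φ)` on `x⁻¹(m ⊗ v)`. -/
theorem eq_zero_of_evalDual_eq_zero [FiniteDimensional k M] (B : EquivariantBimodule k G Q₀ M)
    {U V : Type*} [AddCommGroup U] [Module k U] [AddCommGroup V] [Module k V] {i j : D.orb}
    {σ : Representation k (Stab i) U} {τ : Representation k (Stab j) V}
    {φ : V →ₗ[k] Amb k G (Module.Dual k M) U}
    (hφ : ∀ v, φ v ∈ B.dual.moduleSpace U (.pair j i))
    (hφ' : ∀ g v, φ (τ g v) = B.dual.ambAct (.pair j i) σ g (φ v))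
    (h : ∀ F ∈ B.moduleSpace V (.pair i j), evalDual B (.pair i j) σ φ F = 0) : φ = 0 := by
  ext1 v
  refine B.dual.eq_of_apply_eq (hφ v) (zero_mem _) fun ys hy => ?_
  obtain ⟨x, rfl, hx⟩ := isReps_pair hy
  obtain ⟨ω, hω, hω'⟩ := B.exists_of_mem_dual_layer_pair (((hφ v) _).1 hy)
  suffices dualTensorHom k M U ω = 0 by
    rw [hω, (dualTensorHomEquiv (R := k) (M := M) (N := U)).injective
      (a₁ := ω) (a₂ := 0) (this.trans (map_zero _).symm), map_zero]
    rfl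
  rw [← hω']
  ext m
  have e : (cosetRem j x⁻¹ : G) * x = (cosetRep j x⁻¹)⁻¹ := by
    rw [eq_inv_iff_mul_eq_one, mul_assoc, mul_eq_one_iff_eq_inv, mul_inv_rev, eq_comm,
      inv_mul_eq_iff_eq_mul]
    have := cosetRep_mul_cosetRem j x⁻¹
    rw [← mul_inv_eq_iff_eq_mul.2 this.symm]
    group
  have h0 := h _ (B.single_proj_mem x⁻¹ (B.rho x⁻¹ m) (τ (cosetRem j x⁻¹) v))
  rw [evalDual_single_eq, hφ'] at h0
  replace h0 := eq_zero_of_apply_eq_zero σ _ h0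
  -- Here `x⁻¹ = y h`. The index dual to `y` need not be `x`, but it is the representative of `y⁻¹ =
  -- h x`, so equivariance of `φ` under `h` leads back to `x`.
  have e1 : (dualReps (.pair i j) [cosetRep j x⁻¹]).1 =
      moveReps (.pair j i) (cosetRem j x⁻¹) [x] := by
    simp only [EndSeq.pair, dualReps, moveReps, List.nil_append, OneMemClass.coe_one, one_mul, e]
  have e2 : (cosetRep j x⁻¹)⁻¹ * x⁻¹ = cosetRem j x⁻¹ := by
    rw [← e, mul_inv_cancel_right]
  have e3 : B.tensorAct [cosetRep j x⁻¹].prod⁻¹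
      (TensorAlgebra.ι k (B.proj i (x⁻¹ • (j : Q₀)) (B.rho x⁻¹ m))) =
      B.tensorAct (cosetRem j x⁻¹) (TensorAlgebra.ι k (B.proj (x • (i : Q₀)) j m)) := by
    have := B.rho_proj_apply x⁻¹ (x • (i : Q₀)) j m
    rw [inv_smul_smul] at this
    rw [← this, tensorAct_ι, tensorAct_ι, ← Module.End.mul_apply, ← map_mul, List.prod_singleton, e2]
  rw [e1, B.dual.ambAct_apply_moveReps _ _ _ (hφ v) hy, e3,
    contractTensor_tensorAct B _ _ 1 (by rw [pow_one]; exact ⟨_, rfl⟩) (s := .pair j i) rfl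
      (((hφ v) _).1 hy)] at h0
  replace h0 := eq_zero_of_apply_eq_zero σ _ h0
  rwa [hω, contractTensor_ι] at h0

variable {B : EquivariantBimodule k G Q₀ M}

theorem evalDual_add_right {U V : Type*} [AddCommGroup U] [Module k U] [AddCommGroup V]
    [Module k V] {i j : D.orb} (s : EndSeq D.orb i j) (σ : Representation k (Stab i) U)
    (φ φ' : V →ₗ[k] Amb k G (Module.Dual k M) U) :
    evalDual B s σ (φ + φ') = evalDual B s σ φ + evalDual B s σ φ' :=
  amb_ext fun ys t v => by simp [evalDual_single_eq]

theorem evalDual_smul_right {U V : Type*} [AddCommGroup U] [Module k U] [AddCommGroup V]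
    [Module k V] {i j : D.orb} (s : EndSeq D.orb i j) (σ : Representation k (Stab i) U) (c : k)
    (φ : V →ₗ[k] Amb k G (Module.Dual k M) U) :
    evalDual B s σ (c • φ) = c • evalDual B s σ φ :=
  amb_ext fun ys t v => by simp [evalDual_single_eq]

namespace Intertwiner

/-- The intertwining map `Φ(φ) ∘ f`. -/
noncomputable def evalMap {i : D.orb} {U U' : D.Irr i} {c : D.Vertex} (t : EndSeq D.orb i c.pt)
    (f : Intertwiner B ⟨i, U⟩ c t) (φ : Intertwiner B.dual c ⟨i, U'⟩ t.rev) :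
    IntertwiningMap (D.sigma i U) (D.sigma i U') where
  toLinearMap := evalDual B t (D.sigma i U') φ.lin ∘ₗ f.lin
  isIntertwining' g := by
    ext1 u
    rw [LinearMap.comp_apply, LinearMap.comp_apply, LinearMap.comp_apply, LinearMap.comp_apply]
    refine (congrArg _ (f.lin_rep g u)).trans ?_
    exact evalDual_ambAct B t (D.sigma i U') c.rep φ.lin φ.lin_mem φ.lin_rep g (f.lin_mem u)

/-- Schur's lemma: a bijective map would be an isomorphism, and the chosen irreducibles are pairwise
nonisomorphic. -/
theorem evalMap_eq_zero {i : D.orb} {U U' : D.Irr i} (h : U ≠ U') {c : D.Vertex}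
    (t : EndSeq D.orb i c.pt)
    (f : Intertwiner B ⟨i, U⟩ c t) (φ : Intertwiner B.dual c ⟨i, U'⟩ t.rev) :
    evalMap t f φ = 0 := by
  have := D.irreducible i U
  have := D.irreducible i U'
  refine (IsIrreducible.bijective_or_eq_zero (evalMap t f φ)).resolve_left fun hb => h ?_
  exact D.eq_of_equiv i U U' ⟨(evalMap t f φ).ofBijective hb⟩

/-- Transport of an intertwiner along an equality of sequences. -/
def cast {a b : D.Vertex} {s t : EndSeq D.orb a.pt b.pt} (h : s = t) (f : Intertwiner B a b s) :
    Intertwiner B a b t := h ▸ f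

theorem lin_cast {a b : D.Vertex} {s t : EndSeq D.orb a.pt b.pt} (h : s = t)
    (f : Intertwiner B a b s) : (cast h f).lin = f.lin := by
  subst h
  rfl

end Intertwiner

/-- The pairing is a choice among scalars with the defining property; as `U ≠ 0` there is at most
one. -/
theorem pairing_eq_of {a b : D.Vertex} {s : EndSeq D.orb a.pt b.pt} {f : a.Sp →ₗ[k] Amb k G M b.Sp}
    {φ : b.Sp →ₗ[k] Amb k G (Module.Dual k M) a.Sp} {c : k}
    (h : ∀ u, evalDual B s a.rep φ (f u) = c • u) : pairing B s f φ = c := by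
  obtain ⟨u, hu⟩ := exists_ne (0 : a.Sp)
  have := Classical.epsilon_spec (p := fun c : k => ∀ u, evalDual B s a.rep φ (f u) = c • u) ⟨c, h⟩
  exact smul_left_injective k hu ((this u).symm.trans (h u))

section

variable [IsAlgClosed k] [Finite G]

/-- Schur's lemma over an algebraically closed field, applied to the endomorphism `Φ(φ) ∘ f` of `U`:
the scalar exists. -/
theorem evalDual_eq_pairing_smul {a b : D.Vertex} {s : EndSeq D.orb a.pt b.pt}
    (f : Intertwiner B a b s) (φ : Intertwiner B.dual b a s.rev) (u : a.Sp) :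
    evalDual B s a.rep φ.lin (f.lin u) = pairing B s f.lin φ.lin • u := by
  obtain ⟨c, hc⟩ := a.isIrreducible.exists_eq_smul (f.evalMap s φ)
  rw [pairing_eq_of hc]
  exact hc u

/-- The pairing, as a bilinear map. -/
noncomputable def pairingL (B : EquivariantBimodule k G Q₀ M) {a b : D.Vertex}
    (s : EndSeq D.orb a.pt b.pt) :
    Intertwiner B a b s →ₗ[k] Intertwiner B.dual b a s.rev →ₗ[k] k :=
  LinearMap.mk₂ k (fun f φ => pairing B s f.lin φ.lin)
    (fun f f' φ => pairing_eq_of fun u => by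
      have : (f + f').lin u = f.lin u + f'.lin u := rfl
      rw [this, map_add, evalDual_eq_pairing_smul, evalDual_eq_pairing_smul, add_smul])
    (fun c f φ => pairing_eq_of fun u => by
      have : (c • f).lin u = c • f.lin u := rfl
      rw [this, map_smul, evalDual_eq_pairing_smul, smul_smul, smul_eq_mul])
    (fun f φ φ' => pairing_eq_of fun u => by
      have : (φ + φ').lin = φ.lin + φ'.lin := rfl
      rw [this, evalDual_add_right, LinearMap.add_apply, evalDual_eq_pairing_smul,
        evalDual_eq_pairing_smul, add_smul])
    (fun c f φ => pairing_eq_of fun u => by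
      have : (c • φ).lin = c • φ.lin := rfl
      rw [this, evalDual_smul_right, LinearMap.smul_apply, evalDual_eq_pairing_smul, smul_smul,
        smul_eq_mul])

theorem pairingL_apply {a b : D.Vertex} {s : EndSeq D.orb a.pt b.pt}
    (f : Intertwiner B a b s) (φ : Intertwiner B.dual b a s.rev) :
    pairingL B s f φ = pairing B s f.lin φ.lin := rfl

variable [FiniteDimensional k M]

omit [IsAlgClosed k] in
-- If `f ≠ 0`, it is injective and has an equivariant retraction `p`; the transpose of `p` pairs to
-- `1` with `f`.
theorem eq_zero_of_pairing_left (hG : (Nat.card G : k) ≠ 0) {a b : D.Vertex}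
    (f : Intertwiner B a b (.pair a.pt b.pt))
    (h : ∀ φ : Intertwiner B.dual b a (.pair b.pt a.pt),
      pairing B (.pair a.pt b.pt) f.lin φ.lin = 0) : f = 0 := by
  have := neZero_card_stab hG a.pt
  have := a.isIrreducible
  let _ := B.moduleSpaceAddCommGroup b.Sp (.pair a.pt b.pt)
  refine (IsIrreducible.injective_or_eq_zero f).resolve_left fun hf => ?_
  obtain ⟨p, hp⟩ := IntertwiningMap.exists_comp_eq_id f hf
  have h1 := h (.mk' (B.transpose p) (B.transpose_mem p) (B.transpose_rep p))
  rw [Intertwiner.lin_mk', pairing_eq_of (c := 1)] at h1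
  · exact one_ne_zero h1
  · intro u
    rw [one_smul]
    exact (B.evalDual_transpose p (f u)).trans (hp u)

omit [IsAlgClosed k] in
-- If `Φ(φ) ≠ 0`, it is surjective and has an equivariant section, which pairs to `1` with `φ`.
-- Hence `Φ(φ) = 0`, and then `φ = 0`.
theorem eq_zero_of_pairing_right (hG : (Nat.card G : k) ≠ 0) {a b : D.Vertex}
    (φ : Intertwiner B.dual b a (.pair b.pt a.pt))
    (h : ∀ f : Intertwiner B a b (.pair a.pt b.pt),
      pairing B (.pair a.pt b.pt) f.lin φ.lin = 0) : φ = 0 := by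
  have := neZero_card_stab hG a.pt
  have := a.isIrreducible
  let p : IntertwiningMap (B.moduleRep (.pair a.pt b.pt) b.rep) a.rep :=
    { toLinearMap := evalDual B (.pair a.pt b.pt) a.rep φ.lin ∘ₗ
        (B.moduleSpace b.Sp (.pair a.pt b.pt)).subtype
      isIntertwining' := fun g => by
        ext1 F
        exact evalDual_ambAct B (.pair a.pt b.pt) a.rep b.rep φ.lin φ.lin_mem φ.lin_rep g F.2 }
  have hp : p = 0 := by
    let _ := B.moduleSpaceAddCommGroup b.Sp (.pair a.pt b.pt)
    refine (IsIrreducible.surjective_or_eq_zero p).resolve_left fun hs => ?_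
    obtain ⟨f, hf⟩ := IntertwiningMap.exists_comp_eq p hs (IntertwiningMap.id a.rep)
    have h1 := h f
    rw [pairing_eq_of (c := 1)] at h1
    · exact one_ne_zero h1
    · intro u
      rw [one_smul]
      exact DFunLike.congr_fun hf u
  apply Intertwiner.lin_injective
  exact eq_zero_of_evalDual_eq_zero B φ.lin_mem φ.lin_rep
    fun F hF => DFunLike.congr_fun hp (⟨F, hF⟩ : B.moduleSpace b.Sp (.pair a.pt b.pt))

omit [IsAlgClosed k] in
theorem Intertwiner.finite_pair (a b : D.Vertex) :
    Module.Finite k (Intertwiner B a b (.pair a.pt b.pt)) := by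
  let _ := B.moduleSpaceAddCommGroup b.Sp (.pair a.pt b.pt)
  have := B.finite_moduleSpace_pair b.Sp (j := a.pt) (l := b.pt)
  infer_instance

theorem existsUnique_isDualFamily (hG : (Nat.card G : k) ≠ 0) [Quiver.{q + 1} D.Vertex]
    (arr : (a b : D.Vertex) → Module.Basis (a ⟶ b) k (Intertwiner B a b (.pair a.pt b.pt))) :
    ∃! d : (a b : D.Vertex) → (a ⟶ b) → Intertwiner B.dual b a (.pair b.pt a.pt),
      IsDualFamily (fun a b => arr a b) d := by
  have key : ∀ (a b : D.Vertex) (f : a ⟶ b),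
      ∃! φ : Intertwiner B.dual b a (.pair b.pt a.pt), ∀ f' : a ⟶ b,
        (f' = f → pairing B (.pair a.pt b.pt) (arr a b f').lin φ.lin = 1) ∧
        (f' ≠ f → pairing B (.pair a.pt b.pt) (arr a b f').lin φ.lin = 0) := by
    intro a b f
    have := Intertwiner.finite_pair (B := B) a b
    have := Module.Finite.finite_basis (arr a b)
    exact (arr a b).existsUnique_dual (pairingL B (.pair a.pt b.pt))
      (eq_zero_of_pairing_left hG) (eq_zero_of_pairing_right hG) f
  choose d hd hd' using key
  refine ⟨d, hd, fun d' h => ?_⟩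
  funext a b f
  exact hd' a b f _ (h a b f)

end

end Pairing

/-! ### Intertwiners attached to paths: duality and spanning -/

section Pairing

variable {k : Type u} {G : Type v} {Q₀ : Type w} [Field k] [Group G] [Fintype Q₀]
  [MulAction G Q₀] {M : Type z} [AddCommGroup M] [Module k M]
  {D : OrbitData.{u, v, w, x, y} k G Q₀}

open OrbitData TensorContraction Representation EquivariantBimodule

variable {B : EquivariantBimodule k G Q₀ M}

theorem evalDual_one (a : D.Vertex) (u : a.Sp) :
    evalDual B (.nil a.pt) a.rep (Intertwiner.one B.dual a).lin ((Intertwiner.one B a).lin u) =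
      u := by
  rw [Intertwiner.lin_one_apply, evalDual_single_eq, Intertwiner.lin_one_apply]
  simp [dualReps, contractTensor_tmul, contract_one_one]

/-- For the sequence of length zero the tensors are scalars, so `M(i; U)` is identified with `U`,
with `Φ(id_U)` as the inverse of `id_U`. This reduces the base case of the spanning argument to
Schur's lemma. -/
theorem single_evalDual_one (a : D.Vertex) {F : Amb k G M a.Sp}
    (hF : F ∈ B.moduleSpace a.Sp (.nil a.pt)) :
    (Intertwiner.one B a).lin
      (evalDual B (.nil a.pt) a.rep (Intertwiner.one B.dual a).lin F) = F := by
  refine B.ext_moduleSpace (A := (Intertwiner.one B a).lin ∘ₗ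
    evalDual B (.nil a.pt) a.rep (Intertwiner.one B.dual a).lin) (A' := LinearMap.id) ?_ hF
  intro ys t v hy ht
  obtain rfl : ys = [] := by
    cases ys with
    | nil => rfl
    | cons y ys => exact hy.elim
  obtain ⟨r, rfl⟩ := Submodule.mem_one.1 ht
  have h := congrArg (fun F => (Intertwiner.one B a).lin F) (evalDual_one (B := B) a (r • v))
  have e : (Intertwiner.one B a).lin (r • v) =
      Finsupp.single [] (algebraMap k (TensorAlgebra k M) r ⊗ₜ[k] v) := by
    rw [Intertwiner.lin_one_apply, Algebra.algebraMap_eq_smul_one, TensorProduct.smul_tmul]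
  simp only [e] at h
  exact h

theorem Intertwiner.eq_smul_one [IsAlgClosed k] [Finite G] {a : D.Vertex}
    (f : Intertwiner B a a (.nil a.pt)) : ∃ c : k, f = c • Intertwiner.one B a := by
  refine ⟨pairing B (.nil a.pt) f.lin (Intertwiner.one B.dual a).lin,
    Intertwiner.lin_injective (LinearMap.ext fun u => ?_)⟩
  refine (single_evalDual_one a (f.lin_mem u)).symm.trans ?_
  refine (congrArg _ (evalDual_eq_pairing_smul (s := .nil a.pt) f
    (Intertwiner.one B.dual a) u)).trans ?_
  exact map_smul _ _ _

theorem Intertwiner.eq_zero_of_nil {i : D.orb} {U W : D.Irr i} (h : U ≠ W)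
    (f : Intertwiner B ⟨i, U⟩ ⟨i, W⟩ (.nil i)) : f = 0 := by
  refine Intertwiner.lin_injective (LinearMap.ext fun u => ?_)
  refine (single_evalDual_one (B := B) ⟨i, W⟩ (f.lin_mem u)).symm.trans ?_
  have h2 := DFunLike.congr_fun (Intertwiner.evalMap_eq_zero (c := ⟨i, W⟩) h (.nil i) f
    (Intertwiner.one B.dual ⟨i, W⟩)) u
  exact (congrArg _ h2).trans (map_zero _)

section Paths

variable [Quiver.{q + 1} D.Vertex]

omit [Fintype Q₀] in
theorem length_pathSeq {a b : D.Vertex} (p : Quiver.Path a b) : (pathSeq p).length = p.length := by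
  induction p with
  | nil => rfl
  | cons p e ih => rw [pathSeq, EndSeq.length_append, ih]; rfl

theorem Quiver.Path.finite_of_length {V : Type*} [Quiver V] [Finite V]
    (h : ∀ a b : V, Finite (a ⟶ b)) (a : V) (n : ℕ) :
    ∀ b, Finite {p : Quiver.Path a b // p.length = n} := by
  induction n with
  | zero =>
    intro b
    have : Subsingleton {p : Quiver.Path a b // p.length = 0} := by
      refine ⟨?_⟩
      rintro ⟨p, hp⟩ ⟨p', hp'⟩
      cases p with
      | cons p e => simp at hp
      | nil =>
        cases p' with
        | nil => rfl
        | cons p e => simp at hp'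
    infer_instance
  | succ n ih =>
    intro c
    refine Finite.of_surjective
      (α := Σ b : V, {p : Quiver.Path a b // p.length = n} × (b ⟶ c))
      (fun x => ⟨x.2.1.1.cons x.2.2, by simp [x.2.1.2]⟩) ?_
    rintro ⟨p, hp⟩
    cases p with
    | nil => simp at hp
    | cons p e => exact ⟨⟨_, ⟨p, by simpa using hp⟩, e⟩, rfl⟩

omit [Fintype Q₀] in
-- The sequence fixes the length of the path, and there are finitely many vertices and arrows.
theorem finite_pathSeq_eq [Finite Q₀] (h : ∀ a b : D.Vertex, Finite (a ⟶ b)) {a b : D.Vertex}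
    (s : EndSeq D.orb a.pt b.pt) : Finite {p : Quiver.Path a b // pathSeq p = s} := by
  have := Quiver.Path.finite_of_length h a s.length b
  exact Finite.of_injective
    (fun p : {p : Quiver.Path a b // pathSeq p = s} =>
      (⟨p.1, by rw [← length_pathSeq, p.2]⟩ : {p : Quiver.Path a b // p.length = s.length}))
    fun p p' hp => Subtype.ext (congrArg (fun x => x.1) hp)

variable (arr : (a b : D.Vertex) → (a ⟶ b) → Intertwiner B a b (.pair a.pt b.pt))

omit [Fintype Q₀] in
theorem pathSeq_comp {a b c : D.Vertex} (p : Quiver.Path a b) (r : Quiver.Path b c) :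
    pathSeq (p.comp r) = (pathSeq p).append (pathSeq r) := by
  induction r with
  | nil => exact (EndSeq.append_nil _).symm
  | cons r e ih => rw [Quiver.Path.comp_cons, pathSeq, ih, pathSeq, EndSeq.append_assoc]

/-- The two sequences agree only propositionally, so underlying linear maps are compared; the
content is associativity of `⊛`. -/
theorem lin_pathIntertwiner_comp {a b c : D.Vertex} (p : Quiver.Path a b) (r : Quiver.Path b c) :
    (pathIntertwiner arr (p.comp r)).lin =
      ((pathIntertwiner arr r).circ (pathIntertwiner arr p)).lin := by
  induction r with
  | nil => exact (Intertwiner.lin_one_circ _).symm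
  | cons r e ih =>
    refine Eq.trans ?_ (Intertwiner.lin_circ_circ (arr _ _ e) (pathIntertwiner arr r)
      (pathIntertwiner arr p)).symm
    exact congrArg (fun F => B.ambCirc (arr _ _ e).lin ∘ₗ F) ih

open Classical in
/-- The intertwiners `f_γ` and `φ_γ` attached to paths are dual to each other. -/
theorem evalDual_pathIntertwiner [IsAlgClosed k] [Finite G]
    {d : (a b : D.Vertex) → (a ⟶ b) → Intertwiner B.dual b a (.pair b.pt a.pt)}
    (hd : IsDualFamily arr d) {a b : D.Vertex} (p p' : Quiver.Path a b)
    (h : pathSeq p' = pathSeq p) (u : a.Sp) :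
    evalDual B (pathSeq p) a.rep (pathDualIntertwiner d p).lin ((pathIntertwiner arr p').lin u) =
      (if p' = p then 1 else 0 : k) • u := by
  induction p with
  | nil =>
    cases p' with
    | nil =>
      rw [if_pos rfl, one_smul]
      exact evalDual_one a u
    | cons p' e => exact (EndSeq.append_pair_ne_nil _ h).elim
  | @cons b c p e ih =>
    cases p' with
    | nil => exact (EndSeq.append_pair_ne_nil _ h.symm).elim
    | @cons b' _ p' e' =>
      -- The last arrows start over the same orbit representative, possibly at different
      -- irreducibles `U` and `U'`.
      have hs := EndSeq.append_pair_inj h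
      obtain ⟨j, U⟩ := b
      obtain ⟨j', U'⟩ := b'
      obtain rfl : j' = j := congrArg Sigma.fst hs
      replace hs : pathSeq p' = pathSeq p := eq_of_heq (Sigma.mk.inj hs).2
      -- The dual intertwiner lives over `pathSeqRev p`, which has to be rewritten as `(pathSeq
      -- p).rev`.
      have hφ : ∀ v, (pathDualIntertwiner d p).lin v ∈
          B.dual.moduleSpace a.Sp (pathSeq p).rev := by
        rw [← pathSeqRev_eq]
        exact (pathDualIntertwiner d p).lin_mem
      have hφ' : ∀ g v, (pathDualIntertwiner d p).lin (D.sigma j' U g v) =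
          B.dual.ambAct (pathSeq p).rev a.rep g ((pathDualIntertwiner d p).lin v) := by
        rw [← pathSeqRev_eq]
        exact (pathDualIntertwiner d p).lin_rep
      have hF : (pathIntertwiner arr p').lin u ∈ B.moduleSpace (D.V j' U') (pathSeq p) := by
        rw [← hs]
        exact (pathIntertwiner arr p').lin_mem u
      have main := evalDual_ambCirc B (pathSeq p) (.pair j' c.pt) a.rep (D.sigma j' U)
        (pathDualIntertwiner d p).lin hφ hφ' (d _ _ e).lin (d _ _ e).lin_mem
        (arr _ _ e').lin (arr _ _ e').lin_mem hF
      refine main.trans ?_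
      -- The inner composite `Φ(e^∨) ∘ e'` is the scalar `0` or `1` if the irreducibles agree, and
      -- zero by Schur's lemma otherwise.
      by_cases hU : U' = U
      · subst hU
        have h1 : evalDual B (.pair j' c.pt) (D.sigma j' U') (d _ _ e).lin ∘ₗ (arr _ _ e').lin =
            (if e' = e then 1 else 0 : k) • LinearMap.id := by
          ext1 v
          have hp : pairing B (a := ⟨j', U'⟩) (.pair j' c.pt) (arr _ _ e').lin (d _ _ e).lin =
              if e' = e then 1 else 0 := by
            split_ifs with he
            · exact (hd _ _ e e').1 he
            · exact (hd _ _ e e').2 he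
          exact (evalDual_eq_pairing_smul (a := ⟨j', U'⟩) (arr _ _ e') (d _ _ e) v).trans
            (congrArg (· • v) hp)
        have h2 : ∀ r : k, ambMap (M := M) (G := G) (r • (LinearMap.id : D.V j' U' →ₗ[k] _)) =
            r • LinearMap.id := fun r => amb_ext fun ys t v => by
          simp [ambMap_single]
        rw [h1, h2, LinearMap.smul_apply, LinearMap.id_apply, map_smul, ih p' hs, smul_smul]
        congr 1
        simp only [Quiver.Path.cons.injEq, heq_eq_eq, true_and]
        split_ifs <;> simp_all
      · have h1 : evalDual B (.pair j' c.pt) (D.sigma j' U) (d _ _ e).lin ∘ₗ (arr _ _ e').lin =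
            0 := congrArg IntertwiningMap.toLinearMap
              (Intertwiner.evalMap_eq_zero hU (.pair j' c.pt) (arr _ _ e') (d _ _ e))
        have h2 : ambMap (M := M) (G := G) (0 : D.V j' U' →ₗ[k] D.V j' U) = 0 :=
          amb_ext fun ys t v => by simp [ambMap_single]
        rw [h1, h2, LinearMap.zero_apply, map_zero, if_neg, zero_smul]
        intro h3
        simp only [Quiver.Path.cons.injEq, Vertex.mk.injEq, heq_eq_eq, true_and] at h3
        exact hU h3.1

/-- Induction on the last step: split it off by `exists_eq_sum_circ`, expand the short factors in
arrows and the long ones in paths, and multiply out. -/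
theorem mem_span_pathIntertwiner [IsAlgClosed k] [Finite G] [FiniteDimensional k M]
    (hG : (Nat.card G : k) ≠ 0)
    (arr : (a b : D.Vertex) → Module.Basis (a ⟶ b) k (Intertwiner B a b (.pair a.pt b.pt)))
    {a : D.Vertex} {j : D.orb} (s : EndSeq D.orb a.pt j) (W : D.Irr j)
    (f : Intertwiner B a ⟨j, W⟩ s) :
    f ∈ Submodule.span k {g | ∃ (p : Quiver.Path a ⟨j, W⟩) (h : pathSeq p = s),
      g = (pathIntertwiner (fun a b => arr a b) p).cast h} := by
  induction s using EndSeq.snoc_induction with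
  | nil =>
    obtain ⟨i, U⟩ := a
    by_cases h : U = W
    · subst h
      obtain ⟨c, rfl⟩ := Intertwiner.eq_smul_one (a := ⟨i, U⟩) f
      exact Submodule.smul_mem _ _ (Submodule.subset_span ⟨.nil, rfl, rfl⟩)
    · rw [Intertwiner.eq_zero_of_nil h f]
      exact zero_mem _
  | snoc j l s ih =>
    have : FiniteDimensional k (D.V l W) := (D.irreducible l W).finiteDimensional
    have := B.finite_moduleSpace_pair (D.V l W) (j := j) (l := l)
    obtain ⟨n, U, f₂, f₁, rfl⟩ :=
      Intertwiner.exists_eq_sum_circ (c := ⟨l, W⟩) hG s (.pair j l) f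
    refine Submodule.sum_mem _ fun r _ => ?_
    have h2 : f₂ r ∈ Submodule.span k (Set.range (arr ⟨j, U r⟩ ⟨l, W⟩)) := by
      rw [Module.Basis.span_eq]
      trivial
    have h3 := Submodule.apply_mem_map₂
      (Intertwiner.circL (a := a) (b := ⟨j, U r⟩) (c := ⟨l, W⟩) s (.pair j l)) h2
      (ih (U r) (f₁ r))
    rw [Submodule.map₂_span_span] at h3
    refine Submodule.span_mono ?_ h3
    rintro _ ⟨_, ⟨e, rfl⟩, _, ⟨p, hp, rfl⟩, rfl⟩
    subst hp
    exact ⟨p.cons e, rfl, rfl⟩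

end Paths

end Pairing

/-! ### The expansion formula -/

section Pairing

variable {k : Type u} {G : Type v} {Q₀ : Type w} [Field k] [IsAlgClosed k] [Group G] [Finite G]
  [Fintype Q₀] [MulAction G Q₀] {M : Type z} [AddCommGroup M] [Module k M]
  {D : OrbitData.{u, v, w, x, y} k G Q₀} {B : EquivariantBimodule k G Q₀ M}
  [Quiver.{q + 1} D.Vertex]

open OrbitData

open Classical in
theorem pairing_pathIntertwiner
    {arr : (a b : D.Vertex) → (a ⟶ b) → Intertwiner B a b (.pair a.pt b.pt)}
    {d : (a b : D.Vertex) → (a ⟶ b) → Intertwiner B.dual b a (.pair b.pt a.pt)}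
    (hd : IsDualFamily arr d) {a b : D.Vertex} {s : EndSeq D.orb a.pt b.pt}
    (p p' : {p : Quiver.Path a b // pathSeq p = s}) :
    pairing B s (pathIntertwiner arr p'.1).lin (pathDualIntertwiner d p.1).lin =
      if p' = p then 1 else 0 := by
  obtain ⟨p, rfl⟩ := p
  obtain ⟨p', h⟩ := p'
  simp only [Subtype.mk.injEq]
  exact pairing_eq_of (evalDual_pathIntertwiner arr hd p p' h)

/-- The linear form `f ↦ (f | φ_γ)`. -/
noncomputable def pathForm
    (d : (a b : D.Vertex) → (a ⟶ b) → Intertwiner B.dual b a (.pair b.pt a.pt)) {a b : D.Vertex}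
    {s : EndSeq D.orb a.pt b.pt} (p : {p : Quiver.Path a b // pathSeq p = s}) :
    Intertwiner B a b s →ₗ[k] k :=
  (pairingL B s).flip ((pathDualIntertwiner d p.1).cast
    ((pathSeqRev_eq p.1).trans (congrArg EndSeq.rev p.2)))

theorem pathForm_apply
    (d : (a b : D.Vertex) → (a ⟶ b) → Intertwiner B.dual b a (.pair b.pt a.pt)) {a b : D.Vertex}
    {s : EndSeq D.orb a.pt b.pt} (p : {p : Quiver.Path a b // pathSeq p = s})
    (f : Intertwiner B a b s) :
    pathForm d p f = pairing B s f.lin (pathDualIntertwiner d p.1).lin := by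
  rw [pathForm, LinearMap.flip_apply, pairingL_apply, Intertwiner.lin_cast]

/-- Both sides are linear in `f`, they agree on the `f_γ` by duality, and the `f_γ` span. -/
theorem eq_sum_pairing_smul_pathIntertwiner [FiniteDimensional k M] (hG : (Nat.card G : k) ≠ 0)
    (arr : (a b : D.Vertex) → Module.Basis (a ⟶ b) k (Intertwiner B a b (.pair a.pt b.pt)))
    {d : (a b : D.Vertex) → (a ⟶ b) → Intertwiner B.dual b a (.pair b.pt a.pt)}
    (hd : IsDualFamily (fun a b => arr a b) d) {a b : D.Vertex} {s : EndSeq D.orb a.pt b.pt}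
    [Fintype {p : Quiver.Path a b // pathSeq p = s}] (f : Intertwiner B a b s) :
    f = ∑ p : {p : Quiver.Path a b // pathSeq p = s},
      pairing B s f.lin (pathDualIntertwiner d p.1).lin •
        (pathIntertwiner (fun a b => arr a b) p.1).cast p.2 := by
  classical
  let T : Intertwiner B a b s →ₗ[k] Intertwiner B a b s :=
    ∑ p, (pathForm d p).smulRight ((pathIntertwiner (fun a b => arr a b) p.1).cast p.2)
  have hT : ∀ f, T f = ∑ p : {p : Quiver.Path a b // pathSeq p = s},
      pairing B s f.lin (pathDualIntertwiner d p.1).lin •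
        (pathIntertwiner (fun a b => arr a b) p.1).cast p.2 := fun f => by
    simp only [T, LinearMap.sum_apply, LinearMap.smulRight_apply, pathForm_apply]
  have h : T f = (LinearMap.id : Intertwiner B a b s →ₗ[k] Intertwiner B a b s) f := by
    refine LinearMap.eqOn_span (f := T) (g := LinearMap.id) ?_ (mem_span_pathIntertwiner hG arr s b.irr f)
    rintro _ ⟨p, hp, rfl⟩
    rw [hT, LinearMap.id_apply, Finset.sum_eq_single ⟨p, hp⟩]
    · rw [Intertwiner.lin_cast, pairing_pathIntertwiner hd ⟨p, hp⟩ ⟨p, hp⟩, if_pos rfl, one_smul]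
    · intro p' _ hne
      rw [Intertwiner.lin_cast, pairing_pathIntertwiner hd p' ⟨p, hp⟩, if_neg hne.symm, zero_smul]
    · exact fun h => (h (Finset.mem_univ _)).elim
  exact h.symm.trans (hT f)

/-- In the algebra of intertwiners the casts along `pathSeq p = s` disappear. -/
theorem of_eq_sum_pairing_smul [FiniteDimensional k M] (hG : (Nat.card G : k) ≠ 0)
    (arr : (a b : D.Vertex) → Module.Basis (a ⟶ b) k (Intertwiner B a b (.pair a.pt b.pt)))
    {d : (a b : D.Vertex) → (a ⟶ b) → Intertwiner B.dual b a (.pair b.pt a.pt)}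
    (hd : IsDualFamily (fun a b => arr a b) d) {a b : D.Vertex} {s : EndSeq D.orb a.pt b.pt}
    [Fintype {p : Quiver.Path a b // pathSeq p = s}] (f : Intertwiner B a b s) :
    Intw.of s f = ∑ p : {p : Quiver.Path a b // pathSeq p = s},
      pairing B s f.lin (pathDualIntertwiner d p.1).lin •
        Intw.of (pathSeq p.1) (pathIntertwiner (fun a b => arr a b) p.1) := by
  refine (congrArg (Intw.of s) (eq_sum_pairing_smul_pathIntertwiner hG arr hd f)).trans ?_
  rw [map_sum]
  refine Finset.sum_congr rfl fun p _ => ?_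
  rw [map_smul]
  exact congrArg _ (Intw.of_eq p.2.symm (Intertwiner.lin_cast _ _))

end Pairing

/-! ### The isomorphism of the path algebra with the opposite algebra of intertwiners -/

section PathAlgebra

variable {k : Type u} {G : Type v} {Q₀ : Type w} [Field k] [Group G]
  [Fintype Q₀] [MulAction G Q₀] {M : Type z} [AddCommGroup M] [Module k M]
  {D : OrbitData.{u, v, w, x, y} k G Q₀} {B : EquivariantBimodule k G Q₀ M}
  [Quiver.{q + 1} D.Vertex]

/-- The linear map `kQ_G → Intw^op` that maps every path `γ` to `f_γ`. -/
noncomputable def pathAlgebraLin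
    (arr : (a b : D.Vertex) → (a ⟶ b) → Intertwiner B a b (.pair a.pt b.pt)) :
    PathAlgebra k D.Vertex →ₗ[k] (Intw D B)ᵐᵒᵖ :=
  PathAlgebra.lift fun p => MulOpposite.op (Intw.of (pathSeq p.path) (pathIntertwiner arr p.path))

variable (arr : (a b : D.Vertex) → (a ⟶ b) → Intertwiner B a b (.pair a.pt b.pt))

theorem pathAlgebraLin_of {a b : D.Vertex} (p : Quiver.Path a b) :
    pathAlgebraLin arr (PathAlgebra.of k p) =
      MulOpposite.op (Intw.of (pathSeq p) (pathIntertwiner arr p)) :=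
  PathAlgebra.lift_of _ _

theorem pathAlgebraLin_one : pathAlgebraLin arr 1 = 1 := by
  let _ := Fintype.ofFinite D.Vertex
  change pathAlgebraLin arr (∑ a : D.Vertex, PathAlgebra.of k (Quiver.Path.nil : Quiver.Path a a)) =
    MulOpposite.op (∑ a : D.Vertex, Intw.of (.nil a.pt) (Intertwiner.one B a))
  rw [map_sum, Finset.op_sum]
  exact Finset.sum_congr rfl fun a _ => pathAlgebraLin_of arr _

theorem pathAlgebraLin_mul (x₁ x₂ : PathAlgebra k D.Vertex) :
    pathAlgebraLin arr (x₁ * x₂) = pathAlgebraLin arr x₁ * pathAlgebraLin arr x₂ := by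
  induction x₁ using PathAlgebra.induction with
  | h0 => simp
  | hadd x y hx hy => simp [add_mul, hx, hy]
  | hsmul r x hx => rw [smul_mul_assoc, map_smul, map_smul, smul_mul_assoc, hx]
  | hof a b p =>
  induction x₂ using PathAlgebra.induction with
  | h0 => simp
  | hadd x y hx hy => simp [mul_add, hx, hy]
  | hsmul r x hx => rw [mul_smul_comm, map_smul, map_smul, mul_smul_comm, hx]
  | hof b' c p' =>
  rw [pathAlgebraLin_of, pathAlgebraLin_of, ← MulOpposite.op_mul]
  refine (congrArg (pathAlgebraLin arr) (PathAlgebra.mulL_of_of p p')).trans ?_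
  by_cases h : b' = b
  · subst h
    rw [PathAlgebra.mulAux_self, pathAlgebraLin_of, Intw.of_mul_of]
    exact congrArg _ (Intw.of_eq (pathSeq_comp p p') (lin_pathIntertwiner_comp arr p p'))
  -- If the paths cannot be composed, neither can their intertwiners, and both products vanish.
  · rw [PathAlgebra.mulAux_ne h, map_zero]
    refine (congrArg MulOpposite.op ?_).symm
    exact (Intw.mulL_of_of _ _ _ _).trans (Intw.mulAux_ne (Ne.symm h) _ _ _ _)

/-- The algebra homomorphism `kQ_G → Intw^op` that maps every path `γ` to `f_γ`. -/
noncomputable def pathAlgebraHom : PathAlgebra k D.Vertex →ₐ[k] (Intw D B)ᵐᵒᵖ :=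
  AlgHom.ofLinearMap (pathAlgebraLin arr) (pathAlgebraLin_one arr) (pathAlgebraLin_mul arr)

theorem pathAlgebraHom_of {a b : D.Vertex} (p : Quiver.Path a b) :
    pathAlgebraHom arr (PathAlgebra.of k p) =
      MulOpposite.op (Intw.of (pathSeq p) (pathIntertwiner arr p)) :=
  pathAlgebraLin_of arr p

variable {arr} [IsAlgClosed k] [Finite G]

/-- The forms `(· | φ_γ)` provide a linear left inverse, `f ↦ ∑ (f | φ_γ) γ` on each summand. -/
theorem pathAlgebraHom_injective
    (hfin : ∀ (a b : D.Vertex) (s : EndSeq D.orb a.pt b.pt),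
      Finite {p : Quiver.Path a b // pathSeq p = s})
    {d : (a b : D.Vertex) → (a ⟶ b) → Intertwiner B.dual b a (.pair b.pt a.pt)}
    (hd : IsDualFamily arr d) : Function.Injective (pathAlgebraHom arr) := by
  classical
  let _ a b s := @Fintype.ofFinite _ (hfin a b s)
  let Ψ : Intw D B →ₗ[k] PathAlgebra k D.Vertex := Intw.lift fun i =>
    ∑ p : {p : Quiver.Path i.src i.tgt // pathSeq p = i.seq},
      (pathForm d p).smulRight (PathAlgebra.of k p.1)
  refine Function.LeftInverse.injective (g := fun x => Ψ x.unop) fun x => ?_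
  induction x using PathAlgebra.induction with
  | h0 => simp
  | hadd x y hx hy =>
    simp only [map_add, MulOpposite.unop_add] at hx hy ⊢
    rw [hx, hy]
  | hsmul r x hx =>
    simp only [map_smul, MulOpposite.unop_smul] at hx ⊢
    rw [hx]
  | hof a b p =>
    rw [pathAlgebraHom_of]
    refine (Intw.lift_of _ _ _).trans ?_
    rw [LinearMap.sum_apply, Finset.sum_eq_single ⟨p, rfl⟩]
    · rw [LinearMap.smulRight_apply, pathForm_apply, pairing_pathIntertwiner hd ⟨p, rfl⟩ ⟨p, rfl⟩,
        if_pos rfl, one_smul]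
    · intro p' _ hne
      rw [LinearMap.smulRight_apply, pathForm_apply, pairing_pathIntertwiner hd p' ⟨p, rfl⟩,
        if_neg hne.symm, zero_smul]
    · exact fun h => (h (Finset.mem_univ _)).elim

theorem pathAlgebraHom_surjective [FiniteDimensional k M] (hG : (Nat.card G : k) ≠ 0)
    (arr : (a b : D.Vertex) → Module.Basis (a ⟶ b) k (Intertwiner B a b (.pair a.pt b.pt)))
    (hfin : ∀ (a b : D.Vertex) (s : EndSeq D.orb a.pt b.pt),
      Finite {p : Quiver.Path a b // pathSeq p = s})
    {d : (a b : D.Vertex) → (a ⟶ b) → Intertwiner B.dual b a (.pair b.pt a.pt)}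
    (hd : IsDualFamily (fun a b => arr a b) d) :
    Function.Surjective (pathAlgebraHom fun a b => arr a b) := by
  intro x
  obtain ⟨x, rfl⟩ := MulOpposite.op_surjective x
  induction x using Intw.induction with
  | h0 => exact ⟨0, map_zero _⟩
  | hadd x y hx hy =>
    obtain ⟨x', hx⟩ := hx
    obtain ⟨y', hy⟩ := hy
    exact ⟨x' + y', by rw [map_add, hx, hy, MulOpposite.op_add]⟩
  | hof a b s f =>
    let _ := @Fintype.ofFinite _ (hfin a b s)
    refine ⟨∑ p : {p : Quiver.Path a b // pathSeq p = s},
      pairing B s f.lin (pathDualIntertwiner d p.1).lin • PathAlgebra.of k p.1, ?_⟩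
    rw [of_eq_sum_pairing_smul hG arr hd f, map_sum, Finset.op_sum]
    refine Finset.sum_congr rfl fun p _ => ?_
    rw [map_smul, pathAlgebraHom_of]
    rfl

end PathAlgebra

theorem mainTheorem1 {k : Type u} {G : Type v} {Q₀ : Type w} {M : Type z}
    [Field k] [IsAlgClosed k] [Group G] [Finite G] [Fintype Q₀] [MulAction G Q₀]
    [AddCommGroup M] [Module k M] [FiniteDimensional k M]
    (hG : (Nat.card G : k) ≠ 0)
    (B : EquivariantBimodule k G Q₀ M) (D : OrbitData.{u, v, w, x, y} k G Q₀)
    [Quiver.{q + 1} D.Vertex]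
    (arr : (a b : D.Vertex) → Module.Basis (a ⟶ b) k (Intertwiner B a b (.pair a.pt b.pt))) :
    (∃ Φ : PathAlgebra k D.Vertex ≃ₐ[k] (Intw D B)ᵐᵒᵖ,
      ∀ (a b : D.Vertex) (γ : Quiver.Path a b),
        Φ (PathAlgebra.of k γ) =
          MulOpposite.op (Intw.of (pathSeq γ) (pathIntertwiner (fun a b => arr a b) γ))) ∧
    (∀ (a b : D.Vertex) (s : EndSeq D.orb a.pt b.pt) (f : Intertwiner B a b s)
      (φ : Intertwiner B.dual b a s.rev) (u : a.Sp),
        evalDual B s a.rep φ.lin (f.lin u) = pairing B s f.lin φ.lin • u) ∧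
    (∃! d : (a b : D.Vertex) → (a ⟶ b) → Intertwiner B.dual b a (.pair b.pt a.pt),
      IsDualFamily (fun a b => arr a b) d) ∧
    (∀ d : (a b : D.Vertex) → (a ⟶ b) → Intertwiner B.dual b a (.pair b.pt a.pt),
      IsDualFamily (fun a b => arr a b) d →
      ∀ (a b : D.Vertex) (s : EndSeq D.orb a.pt b.pt) (f : Intertwiner B a b s),
        Finite {γ : Quiver.Path a b // pathSeq γ = s} ∧
        Intw.of s f =
          ∑ᶠ γ : {γ : Quiver.Path a b // pathSeq γ = s},
            pairing B s f.lin (pathDualIntertwiner d γ.1).lin •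
              Intw.of (pathSeq γ.1) (pathIntertwiner (fun a b => arr a b) γ.1)) := by
  have harr : ∀ a b : D.Vertex, Finite (a ⟶ b) := fun a b =>
    have := Intertwiner.finite_pair (B := B) a b
    Module.Finite.finite_basis (arr a b)
  have hfin (a b : D.Vertex) (s : EndSeq D.orb a.pt b.pt) := finite_pathSeq_eq harr s
  have hex := existsUnique_isDualFamily hG arr
  refine ⟨?_, fun a b s f φ u => evalDual_eq_pairing_smul f φ u, hex, fun d hd a b s f =>
    ⟨hfin a b s, ?_⟩⟩
  -- The isomorphism does not involve the dual family, but its bijectivity is proved with one.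
  · obtain ⟨d, hd, -⟩ := hex
    exact ⟨AlgEquiv.ofBijective (pathAlgebraHom fun a b => arr a b)
      ⟨pathAlgebraHom_injective hfin hd, pathAlgebraHom_surjective hG arr hfin hd⟩,
      fun a b γ => pathAlgebraHom_of _ γ⟩
  · let _ := @Fintype.ofFinite _ (hfin a b s)
    rw [finsum_eq_sum_of_fintype]
    exact of_eq_sum_pairing_smul hG arr hd f
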